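/- Let $\gamma>0$, $\beta\neq 0$, $k>0$ and $c$ be real numbers and let $\phi:\mathbb R\to\mathbb R$ be smooth and $1$-periodic (for instance the profile of a $1$-periodic traveling wave of the Ostrovsky equation, $k^2(-c\phi'+\phi\phi'+\beta k^2\phi''')'=\gamma\phi$). Set $$\mathcal L[\phi]=\gamma+k^2\partial_\theta^2\bigl(c-\phi-\beta k^2\partial_\theta^2\bigr)\ \text{ and } k\partial_\theta \text{ on } L^2(\mathbb R),$$ and, for $\xi\in[-\pi,\pi)$, $$\mathcal L_\xi[\phi]=e^{-i\xi\theta}\mathcal L[\phi]e^{i\xi\theta}=\gamma+k^2(\partial_\theta+i\xi)^2\bigl(c-\phi-\beta k^2(\partial_\theta+i\xi)^2\bigr)\ \text{ and } k(\partial_\theta+i\xi) \text{ on } L^2_{\rm per}(0,1),$$ each operator taken on its natural (Sobolev) domain. For unbounded operators $A,B$ on a Hilbert space $X$, let $\sigma_X(A;B)$ be the set of $\lambda\in\mathbb C$ such that $\lambda B-A$, with domain $D(A)\cap D(B)$, is not boundedly invertible. Its essential part consists of those $\lambda\in\sigma_X(A;B)$ for which $\lambda B-A$ is not Fredholm of index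 zero; its point spectrum is the remaining part. An eigenvalue is a $\lambda$ with $Av=\lambda Bv$ for some $v\ne0$ in $D(A)\cap D(B)$. A Jordan chain at $\lambda$ is $w_0,\dots,w_{\ell-1}$ with $w_0\neq0$, $(\lambda B-A)w_0=0$, $(\lambda B-A)w_{j+1}=Bw_j$; the algebraic multiplicity of $\lambda$ is the supremum of the sums of the lengths of Jordan chains at $\lambda$ over finite families of chains whose leading vectors $w_0$ are linearly independent. Then: 1. The spectrum $\sigma_{L^2(\mathbb R)}(\mathcal L[\phi];k\partial_\theta)$ is entirely essential: the point spectrum is empty, and in fact the pencil has no eigenvalues in $L^2(\mathbb R)$. 2. For $\lambda\in\mathbb C$: $\lambda\in\sigma_{L^2(\mathbb R)}(\mathcal L[\phi];k\partial_\theta)$ if and only if there is $\xi\in[-\pi,\pi)$ with $\lambda\in\sigma_{L^2_{\rm per}(0,1)}(\mathcal L_\xi[\phi];k(\partial_\theta+i\xi))$; equivalently, if and only if for some $\xi\in[-\pi,\pi)$ the equation $\mathcal L_\xi[\phi]w=\lambda k(\partial_\theta+i\xi)w$ has a nontrivial solution $w$ in $L^2_{\rm per}(0,1)$. 3. For each $\xi\in[-\pi,\pi)$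 the set $\sigma_{L^2_{\rm per}(0,1)}(\mathcal L_\xi[\phi];k(\partial_\theta+i\xi))$ coincides with its point spectrum, consists entirely of eigenvalues of finite algebraic multiplicity, and has no accumulation point in $\mathbb C$ (so all of them are isolated). 4. $\displaystyle\sigma_{L^2(\mathbb R)}(\mathcal L[\phi];k\partial_\theta)=\bigcup_{\xi\in[-\pi,\pi)}\sigma_{L^2_{\rm per}(0,1)}(\mathcal L_\xi[\phi];k(\partial_\theta+i\xi)).$ -/

import Mathlib

open MeasureTheory
open scoped ContDiff

noncomputable section

namespace Ostrovsky

/-! ### Unbounded operators and linear operator pencils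

Unbounded operators in `X` are Mathlib's `X →ₗ.[ℂ] X`; sums and scalar multiples of these have their
natural domains, e.g. `(z • B - A).domain = B.domain ⊓ A.domain`. -/

section Pencil

variable {X : Type*} [NormedAddCommGroup X] [NormedSpace ℂ X]

/-- The identity, as an everywhere defined partial operator. -/
def idOp (X : Type*) [NormedAddCommGroup X] [NormedSpace ℂ X] : X →ₗ.[ℂ] X :=
  (LinearMap.id : X →ₗ[ℂ] X).toPMap ⊤

/-- The composition `g ∘ f` of unbounded operators on its natural domain
`{x ∈ D(f) | f x ∈ D(g)}`. -/
def natComp (g f : X →ₗ.[ℂ] X) : X →ₗ.[ℂ] X where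
  domain := (g.domain.comap f.toFun).map f.domain.subtype
  toFun :=
    { toFun := fun x => g ⟨f ⟨x.1, by
          obtain ⟨y, -, hy⟩ := x.2; exact hy ▸ y.2⟩, by
          obtain ⟨x, y, hy, rfl⟩ := x; exact hy⟩
      map_add' := by
        rintro ⟨_, x, hx, rfl⟩ ⟨_, y, hy, rfl⟩
        rw [← g.map_add]
        congr 1
        exact Subtype.ext (f.map_add x y)
      map_smul' := by
        rintro a ⟨_, x, hx, rfl⟩
        rw [RingHom.id_apply, ← g.map_smul]
        congr 1
        exact Subtype.ext (f.map_smul a x) }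

/-- `T : D(T) → X` is boundedly invertible: it has an everywhere defined bounded two-sided
inverse. -/
def BoundedlyInvertible (T : X →ₗ.[ℂ] X) : Prop :=
  ∃ R : X →L[ℂ] X, (∀ f : X, (R f, f) ∈ T.graph) ∧ ∀ x : T.domain, R (T x) = x

/-- `T` is Fredholm: finite dimensional kernel, closed range, finite dimensional cokernel. -/
structure IsFredholm (T : X →ₗ.[ℂ] X) : Prop where
  finite_ker : FiniteDimensional ℂ (LinearMap.ker T.toFun)
  closed_range : IsClosed (LinearMap.range T.toFun : Set X)
  finite_coker : FiniteDimensional ℂ (X ⧸ LinearMap.range T.toFun)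

/-- The index of a Fredholm operator. -/
def fredholmIndex (T : X →ₗ.[ℂ] X) : ℤ :=
  (Module.finrank ℂ (LinearMap.ker T.toFun) : ℤ) -
    (Module.finrank ℂ (X ⧸ LinearMap.range T.toFun) : ℤ)

/-- The resolvent set `ρ(A, B)` of the pencil `λ B - A`. -/
def resolventSet (A B : X →ₗ.[ℂ] X) : Set ℂ :=
  {z | BoundedlyInvertible (z • B - A)}

/-- The spectrum `σ(A, B)` of the pencil `λ B - A`. -/
def spectrum (A B : X →ₗ.[ℂ] X) : Set ℂ :=
  (resolventSet A B)ᶜ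

/-- `z` is an eigenvalue of the pencil: `A v = z B v` for some `v ≠ 0` in `D(A) ∩ D(B)`. -/
def IsEigenvalue (A B : X →ₗ.[ℂ] X) (z : ℂ) : Prop :=
  ∃ v : X, v ≠ 0 ∧ ∃ (hA : v ∈ A.domain) (hB : v ∈ B.domain), A ⟨v, hA⟩ = z • B ⟨v, hB⟩

/-- The essential spectrum: `λ B - A` is not Fredholm, or is Fredholm of nonzero index. -/
def essentialSpectrum (A B : X →ₗ.[ℂ] X) : Set ℂ :=
  {z ∈ spectrum A B | ¬ (IsFredholm (z • B - A) ∧ fredholmIndex (z • B - A) = 0)}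

/-- The point spectrum: the complement of the essential spectrum in the spectrum. -/
def pointSpectrum (A B : X →ₗ.[ℂ] X) : Set ℂ :=
  spectrum A B \ essentialSpectrum A B

/-- `w 0, …, w (ℓ - 1)` is a Jordan chain of length `ℓ ≥ 1` of the pencil at `z`:
`w 0 ≠ 0`, `(z B - A) w₀ = 0` and `(z B - A) w_{j+1} = B w_j`. -/
def IsJordanChain (A B : X →ₗ.[ℂ] X) (z : ℂ) (ℓ : ℕ) (w : ℕ → X) : Prop :=
  0 < ℓ ∧ w 0 ≠ 0 ∧ (w 0, 0) ∈ (z • B - A).graph ∧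
    ∀ j, j + 1 < ℓ → ∃ y, (w j, y) ∈ B.graph ∧ (w (j + 1), y) ∈ (z • B - A).graph

/-- The algebraic multiplicity of `z`: the supremum of the total length of finite systems of Jordan
chains at `z` whose leading eigenvectors are linearly independent. -/
def algebraicMultiplicity (A B : X →ₗ.[ℂ] X) (z : ℂ) : ℕ∞ :=
  sSup {N : ℕ∞ | ∃ (m : ℕ) (ℓ : Fin m → ℕ) (w : Fin m → ℕ → X),
    (∀ i, IsJordanChain A B z (ℓ i) (w i)) ∧ LinearIndependent ℂ (fun i => w i 0) ∧
      N = ((∑ i, ℓ i : ℕ) : ℕ∞)}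

end Pencil

/-! ### Multiplication and differentiation in `L²` -/

/-- The maximal operator of multiplication by `g` in `L²(μ)`. -/
def mulOp {α : Type*} [MeasurableSpace α] (μ : Measure α) (g : α → ℂ) :
    Lp ℂ 2 μ →ₗ.[ℂ] Lp ℂ 2 μ :=
  Submodule.toLinearPMap
    { carrier := {p | ∀ᵐ x ∂μ, p.2 x = g x * p.1 x}
      zero_mem' := by
        filter_upwards [Lp.coeFn_zero ℂ 2 μ] with x hx
        simp only [Prod.fst_zero, Prod.snd_zero]
        rw [hx]
        simp
      add_mem' := by
        intro p q hp hq
        filter_upwards [hp, hq, Lp.coeFn_add p.1 q.1, Lp.coeFn_add p.2 q.2] with x h1 h2 h3 h4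
        simp only [Prod.fst_add, Prod.snd_add, h3, h4, Pi.add_apply, h1, h2]
        ring
      smul_mem' := by
        intro a p hp
        filter_upwards [hp, Lp.coeFn_smul a p.1, Lp.coeFn_smul a p.2] with x h1 h3 h4
        simp only [Prod.smul_fst, Prod.smul_snd, h3, h4, Pi.smul_apply, h1, smul_eq_mul]
        ring }

/-- `L²(ℝ)`. -/
abbrev L2R : Type := Lp ℂ 2 (volume : Measure ℝ)

/-- `L²_per(0,1)`: square integrable functions on the circle `ℝ / ℤ` with its Haar measure of
total mass one. -/
abbrev L2per : Type := Lp ℂ 2 (AddCircle.haarAddCircle (T := (1 : ℝ)))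

/-- `w` is the weak derivative of `v` on `ℝ`, tested against `C_c^∞(ℝ)`. -/
def IsWeakDerivR (v w : L2R) : Prop :=
  ∀ η : ℝ → ℂ, ContDiff ℝ ∞ η → HasCompactSupport η →
    ∫ x, v x * deriv η x = - ∫ x, w x * η x

/-- `w` is the weak derivative of `v` on the circle, tested against smooth `1`-periodic
functions. -/
def IsWeakDerivPer (v w : L2per) : Prop :=
  ∀ η : ℝ → ℂ, ContDiff ℝ ∞ η → Function.Periodic η 1 →
    ∫ x in (0 : ℝ)..1, v (x : AddCircle (1 : ℝ)) * deriv η x =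
      - ∫ x in (0 : ℝ)..1, w (x : AddCircle (1 : ℝ)) * η x

theorem integrable_mul_of_hasCompactSupport (v : L2R) {η : ℝ → ℂ} (h : Continuous η)
    (hc : HasCompactSupport η) : Integrable (fun x => v x * η x) :=
  MemLp.integrable_mul (p := 2) (q := 2) (Lp.memLp v) (h.memLp_of_hasCompactSupport hc)

theorem haarAddCircle_eq_volume :
    AddCircle.haarAddCircle (T := (1 : ℝ)) = (volume : Measure (AddCircle (1 : ℝ))) := by
  rw [AddCircle.volume_eq_smul_haarAddCircle]
  simp

theorem measurePreserving_coe : MeasurePreserving ((↑) : ℝ → AddCircle (1 : ℝ))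
    (volume.restrict (Set.Ioc 0 1)) (AddCircle.haarAddCircle (T := (1 : ℝ))) := by
  rw [haarAddCircle_eq_volume]
  simpa using AddCircle.measurePreserving_mk (1 : ℝ) 0

theorem intervalIntegrable_mul (v : L2per) {η : ℝ → ℂ} (h : Continuous η) :
    IntervalIntegrable (fun x : ℝ => v (x : AddCircle (1 : ℝ)) * η x) volume 0 1 := by
  rw [intervalIntegrable_iff_integrableOn_Ioc_of_le zero_le_one]
  refine MemLp.integrable_mul (p := 2) (q := 2)
    ((Lp.memLp v).comp_measurePreserving measurePreserving_coe) ?_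
  obtain ⟨C, hC⟩ := isCompact_Icc.exists_bound_of_continuousOn (s := Set.Icc (0 : ℝ) 1)
    h.continuousOn
  refine MemLp.of_bound h.aestronglyMeasurable C ?_
  filter_upwards [ae_restrict_mem measurableSet_Ioc] with x hx
  exact hC x ⟨hx.1.le, hx.2⟩

theorem ae_coe {p : AddCircle (1 : ℝ) → Prop}
    (h : ∀ᵐ x ∂(AddCircle.haarAddCircle (T := (1 : ℝ))), p x) :
    ∀ᵐ x : ℝ, x ∈ Set.uIoc (0 : ℝ) 1 → p (x : AddCircle (1 : ℝ)) := by
  rw [Set.uIoc_of_le zero_le_one]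
  exact (ae_restrict_iff' measurableSet_Ioc).1
    (measurePreserving_coe.quasiMeasurePreserving.ae h)

/-- The pairs `(v, w)` such that `w` is the weak derivative of `v` on `ℝ`. -/
def weakDerivGraphR : Submodule ℂ (L2R × L2R) where
  carrier := {p | IsWeakDerivR p.1 p.2}
  zero_mem' := by
    intro η _ _
    have h : ∀ f : ℝ → ℂ, ∫ x, (0 : L2R) x * f x = 0 := fun f => by
      refine integral_eq_zero_of_ae ?_
      filter_upwards [Lp.coeFn_zero ℂ 2 (volume : Measure ℝ)] with x hx
      rw [hx]
      simp
    simp only [Prod.fst_zero, Prod.snd_zero, h, neg_zero]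
  add_mem' := by
    intro p q hp hq η h1 h2
    have key : ∀ (a b : L2R) (f : ℝ → ℂ), Continuous f → HasCompactSupport f →
        ∫ x, (a + b : L2R) x * f x = (∫ x, a x * f x) + ∫ x, b x * f x := by
      intro a b f hf hc
      rw [← integral_add (integrable_mul_of_hasCompactSupport a hf hc)
        (integrable_mul_of_hasCompactSupport b hf hc)]
      refine integral_congr_ae ?_
      filter_upwards [Lp.coeFn_add a b] with x hx
      rw [hx, Pi.add_apply, add_mul]
    rw [Prod.fst_add, Prod.snd_add, key _ _ _ (h1.continuous_deriv (by simp)) h2.deriv,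
      key _ _ _ h1.continuous h2, hp η h1 h2, hq η h1 h2]
    ring
  smul_mem' := by
    intro c p hp η h1 h2
    have key : ∀ (a : L2R) (f : ℝ → ℂ), ∫ x, (c • a : L2R) x * f x = c * ∫ x, a x * f x := by
      intro a f
      rw [← integral_const_mul]
      refine integral_congr_ae ?_
      filter_upwards [Lp.coeFn_smul c a] with x hx
      rw [hx, Pi.smul_apply, smul_eq_mul, mul_assoc]
    rw [Prod.smul_fst, Prod.smul_snd, key, key, hp η h1 h2, mul_neg]

/-- The pairs `(v, w)` such that `w` is the weak derivative of `v` on the circle. -/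
def weakDerivGraphPer : Submodule ℂ (L2per × L2per) where
  carrier := {p | IsWeakDerivPer p.1 p.2}
  zero_mem' := by
    intro η _ _
    have h : ∀ f : ℝ → ℂ,
        ∫ x in (0 : ℝ)..1, (0 : L2per) (x : AddCircle (1 : ℝ)) * f x = 0 := fun f => by
      refine intervalIntegral.integral_zero_ae ?_
      filter_upwards [ae_coe (Lp.coeFn_zero ℂ 2 AddCircle.haarAddCircle)] with x hx h
      rw [hx h]
      simp
    simp only [Prod.fst_zero, Prod.snd_zero, h, neg_zero]
  add_mem' := by
    intro p q hp hq η h1 h2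
    have key : ∀ (a b : L2per) (f : ℝ → ℂ), Continuous f →
        ∫ x in (0 : ℝ)..1, (a + b : L2per) (x : AddCircle (1 : ℝ)) * f x =
          (∫ x in (0 : ℝ)..1, a (x : AddCircle (1 : ℝ)) * f x) +
            ∫ x in (0 : ℝ)..1, b (x : AddCircle (1 : ℝ)) * f x := by
      intro a b f hf
      rw [← intervalIntegral.integral_add (intervalIntegrable_mul a hf)
        (intervalIntegrable_mul b hf)]
      refine intervalIntegral.integral_congr_ae ?_
      filter_upwards [ae_coe (Lp.coeFn_add a b)] with x hx h
      rw [hx h, Pi.add_apply, add_mul]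
    rw [Prod.fst_add, Prod.snd_add, key _ _ _ (h1.continuous_deriv (by simp)),
      key _ _ _ h1.continuous, hp η h1 h2, hq η h1 h2]
    ring
  smul_mem' := by
    intro c p hp η h1 h2
    have key : ∀ (a : L2per) (f : ℝ → ℂ),
        ∫ x in (0 : ℝ)..1, (c • a : L2per) (x : AddCircle (1 : ℝ)) * f x =
          c * ∫ x in (0 : ℝ)..1, a (x : AddCircle (1 : ℝ)) * f x := by
      intro a f
      rw [← intervalIntegral.integral_const_mul]
      refine intervalIntegral.integral_congr_ae ?_
      filter_upwards [ae_coe (Lp.coeFn_smul c a)] with x hx h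
      rw [hx h, Pi.smul_apply, smul_eq_mul, mul_assoc]
    rw [Prod.smul_fst, Prod.smul_snd, key, key, hp η h1 h2, mul_neg]

/-- A weak derivative on `ℝ` is unique, so that `weakDerivGraphR` is the graph of an operator. -/
theorem weakDerivGraphR_functional (p : L2R × L2R) (hp : p ∈ weakDerivGraphR) (h0 : p.1 = 0) :
    p.2 = 0 := by
  obtain ⟨v, w⟩ := p
  obtain rfl : v = 0 := h0
  have hz : ∀ᵐ x : ℝ, w x = 0 := by
    refine ae_eq_zero_of_integral_contDiff_smul_eq_zero
      ((Lp.memLp w).locallyIntegrable (by norm_num)) ?_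
    intro g hg hgc
    have hη : ContDiff ℝ ∞ (fun x => (g x : ℂ)) := Complex.ofRealCLM.contDiff.comp hg
    have h := hp (fun x => (g x : ℂ)) hη (hgc.comp_left (g := Complex.ofReal) (by simp))
    have h2 : ∫ x, (0 : L2R) x * deriv (fun x => (g x : ℂ)) x = 0 := by
      refine integral_eq_zero_of_ae ?_
      filter_upwards [Lp.coeFn_zero ℂ 2 (volume : Measure ℝ)] with x hx
      rw [hx]
      simp
    have h3 : ∫ x, w x * (g x : ℂ) = 0 := by
      have h4 := h2.symm.trans h
      simpa using h4.symm
    rw [← h3]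
    refine integral_congr_ae (Filter.Eventually.of_forall fun x => ?_)
    simp [mul_comm]
  refine Lp.ext ?_
  filter_upwards [hz, Lp.coeFn_zero ℂ 2 (volume : Measure ℝ)] with x h1 h2
  rw [h1, h2]
  rfl

/-- A weak derivative on the circle is unique, so that `weakDerivGraphPer` is the graph of an
operator. -/
theorem weakDerivGraphPer_functional (p : L2per × L2per) (hp : p ∈ weakDerivGraphPer)
    (h0 : p.1 = 0) : p.2 = 0 := by
  obtain ⟨v, w⟩ := p
  obtain rfl : v = 0 := h0
  have hz : ∀ n : ℤ, fourierCoeff w n = 0 := by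
    intro n
    rw [fourierCoeff_eq_intervalIntegral w n 0]
    set η : ℝ → ℂ := fun x => fourier (-n) (x : AddCircle (1 : ℝ)) with hη
    have hs : ContDiff ℝ ∞ η := by
      simp only [hη, fourier_coe_apply]
      have hc : ContDiff ℝ ∞ (fun x : ℝ => (x : ℂ)) := Complex.ofRealCLM.contDiff
      exact ((contDiff_const.mul hc).div_const _).cexp
    have hper : Function.Periodic η 1 := by
      intro x
      simp only [hη]
      rw [AddCircle.coe_add_period]
    have h := hp η hs hper
    have h2 : ∫ x in (0 : ℝ)..1, (0 : L2per) (x : AddCircle (1 : ℝ)) * deriv η x = 0 := by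
      refine intervalIntegral.integral_zero_ae ?_
      filter_upwards [ae_coe (Lp.coeFn_zero ℂ 2 AddCircle.haarAddCircle)] with x hx h
      rw [hx h]
      simp
    have h4 := h2.symm.trans h
    have h5 : ∫ x in (0 : ℝ)..1, w (x : AddCircle (1 : ℝ)) * η x = 0 := by
      simpa using h4.symm
    simp only [zero_add, smul_eq_mul, div_one, one_smul]
    rw [← h5]
    refine intervalIntegral.integral_congr fun x _ => ?_
    simp only [hη]
    ring
  have h6 : fourierBasis.repr w = 0 := by
    ext n
    rw [fourierBasis_repr, hz n]
    rfl
  simpa using h6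

/-- The operator `∂_θ` in `L²(ℝ)`, with domain `H¹(ℝ)`. -/
def derivR : L2R →ₗ.[ℂ] L2R := weakDerivGraphR.toLinearPMap

/-- The operator `∂_θ` in `L²_per(0,1)`, with domain `H¹_per(0,1)`. -/
def derivPer : L2per →ₗ.[ℂ] L2per := weakDerivGraphPer.toLinearPMap

/-- The Bloch derivative `∂_θ + i ξ` in `L²_per(0,1)`. -/
def blochDeriv (ξ : ℝ) : L2per →ₗ.[ℂ] L2per :=
  derivPer + (Complex.I * (ξ : ℂ)) • idOp L2per

/-! ### The linearized operator and its Bloch operators -/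

/-- The operator `γ + k² D² (c - M - β k² D²)` for an abstract derivative `D` and a multiplication
operator `M`, with all products understood on their natural domains. -/
def linOp {X : Type*} [NormedAddCommGroup X] [NormedSpace ℂ X] (D M : X →ₗ.[ℂ] X)
    (γ β k c : ℝ) : X →ₗ.[ℂ] X :=
  (γ : ℂ) • idOp X +
    ((k : ℂ) ^ 2) • natComp (natComp D D)
      ((c : ℂ) • idOp X - M - ((β : ℂ) * (k : ℂ) ^ 2) • natComp D D)

/-- `𝓛[φ] = γ + k² ∂_θ² (c - φ - β k² ∂_θ²)` in `L²(ℝ)`. -/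
def opL (φ : ℝ → ℝ) (γ β k c : ℝ) : L2R →ₗ.[ℂ] L2R :=
  linOp derivR (mulOp volume fun x => (φ x : ℂ)) γ β k c

/-- `𝓗 = k ∂_θ` in `L²(ℝ)`. -/
def opH (k : ℝ) : L2R →ₗ.[ℂ] L2R := (k : ℂ) • derivR

/-- `𝓛_ξ[φ] = γ + k² (∂_θ + i ξ)² (c - φ - β k² (∂_θ + i ξ)²)` in `L²_per(0,1)`. -/
def blochL {φ : ℝ → ℝ} (hφ : Function.Periodic φ 1) (γ β k c ξ : ℝ) : L2per →ₗ.[ℂ] L2per :=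
  linOp (blochDeriv ξ) (mulOp AddCircle.haarAddCircle fun x => (hφ.lift x : ℂ)) γ β k c

/-- `𝓗_ξ = k (∂_θ + i ξ)` in `L²_per(0,1)`. -/
def blochH (k ξ : ℝ) : L2per →ₗ.[ℂ] L2per := (k : ℂ) • blochDeriv ξ

end Ostrovsky

end

open MeasureTheory
open scoped ContDiff

noncomputable section

namespace Ostrovsky

/-! ### Graphs of partial operators and the pencil as a two-component equation -/

section Graphs

variable {X : Type*} [NormedAddCommGroup X] [NormedSpace ℂ X]

/-! Write `D` for the derivative (`∂` on the line, `∂ + iξ` on the circle); it is skew-adjoint. With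
the auxiliary unknown `q = (c - φ - βk²D²)v`, the equation `(zB - A)v = f` becomes two second-order
equations, `βk²D²v = (c - φ)v - q` and `k²D²q = zkDv - γv - f`. Inverting `D² - 1 = (D - 1)(D + 1)`
turns them into a fixed-point equation for `(v, q)` with a bounded operator
(`SkewResolvent.isSolution_iff`), so domain questions disappear.

On the circle `D` is diagonal in the Fourier basis and `(D + 1)⁻¹` is compact, hence so is the
fixed-point operator, and the Fredholm alternative shows that every spectral value is an eigenvalue.
An energy identity, which uses `γ ≠ 0`, shows that the pencil is injective when `Re z` is large
(`eq_zero_of_re_large`), so there is a point `z₀` with bounded inverse `R`, and `K = BR` is compact.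
Since `zB - A = (1 + (z - z₀)K)R⁻¹`, Riesz theory for `K` gives index zero, discreteness, and the
bound of Jordan chain lengths by the dimension of a generalized eigenspace of `K`
(`IsCompactResolvent`).

On the line the equation is a first-order system in `ℂ⁴` with 1-periodic coefficients and monodromy
`M = Φ 1`. Samples of an `L²` solution at the integers form an `ℓ²` sequence with `y(n+1) = M y(n)`
up to forcing. A finite-dimensional recurrence has no nonzero `ℓ²` solution
(`eq_zero_of_recurrence`), so there are no eigenvalues; and an injective Fredholm operator of index
zero is invertible, so the spectrum is purely essential.

If `M` has no eigenvalue of modulus one, the recurrence bounds `(v, q)` by `f`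
(`exists_bound_recurrence`), so the range is closed. It is also dense: `D²` carries a vector
orthogonal to the range at `z` to a null vector of the pencil at `-z̄`, and the pencil is injective
at every point (`eq_zero_of_orthogonal_range`). Hence `z` is in the resolvent set. Conversely,
cutting off a bounded Floquet solution at scale `N` gives a Weyl sequence, so a multiplier of
modulus one excludes a bounded inverse (`not_boundedlyInvertible_of_floquet`). Finally, `e^{iξ}` is
a multiplier exactly when the Bloch pencil at `ξ` has the eigenvalue `z`, via `U(x) = e^{iξx} w(x)`.
This links the line spectrum to the Bloch spectra. -/

theorem mem_graph_add {A B : X →ₗ.[ℂ] X} {v w : X} :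
    (v, w) ∈ (A + B).graph ↔ ∃ a b, (v, a) ∈ A.graph ∧ (v, b) ∈ B.graph ∧ w = a + b := by
  simp only [LinearPMap.mem_graph_iff]
  constructor
  · rintro ⟨⟨x, hx⟩, rfl, rfl⟩
    exact ⟨_, _, ⟨⟨x, hx.1⟩, rfl, rfl⟩, ⟨⟨x, hx.2⟩, rfl, rfl⟩, rfl⟩
  · rintro ⟨a, b, ⟨⟨x, hx⟩, rfl, rfl⟩, ⟨⟨y, hy⟩, hxy, rfl⟩, rfl⟩
    obtain rfl : y = x := hxy
    exact ⟨⟨y, hx, hy⟩, rfl, rfl⟩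

theorem mem_graph_sub {A B : X →ₗ.[ℂ] X} {v w : X} :
    (v, w) ∈ (A - B).graph ↔ ∃ a b, (v, a) ∈ A.graph ∧ (v, b) ∈ B.graph ∧ w = a - b := by
  simp only [LinearPMap.mem_graph_iff]
  constructor
  · rintro ⟨⟨x, hx⟩, rfl, rfl⟩
    exact ⟨_, _, ⟨⟨x, hx.1⟩, rfl, rfl⟩, ⟨⟨x, hx.2⟩, rfl, rfl⟩, rfl⟩
  · rintro ⟨a, b, ⟨⟨x, hx⟩, rfl, rfl⟩, ⟨⟨y, hy⟩, hxy, rfl⟩, rfl⟩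
    obtain rfl : y = x := hxy
    exact ⟨⟨y, hx, hy⟩, rfl, rfl⟩

theorem mem_graph_smul {A : X →ₗ.[ℂ] X} {a : ℂ} {v w : X} :
    (v, w) ∈ (a • A).graph ↔ ∃ b, (v, b) ∈ A.graph ∧ w = a • b := by
  simp only [LinearPMap.mem_graph_iff]
  constructor
  · rintro ⟨⟨x, hx⟩, rfl, rfl⟩
    exact ⟨_, ⟨⟨x, hx⟩, rfl, rfl⟩, rfl⟩
  · rintro ⟨b, ⟨⟨x, hx⟩, rfl, rfl⟩, rfl⟩
    exact ⟨⟨x, hx⟩, rfl, rfl⟩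

theorem mem_graph_idOp {v w : X} : (v, w) ∈ (idOp X).graph ↔ w = v := by
  simp only [LinearPMap.mem_graph_iff]
  constructor
  · rintro ⟨⟨x, hx⟩, rfl, rfl⟩
    rfl
  · rintro rfl
    exact ⟨⟨w, trivial⟩, rfl, rfl⟩

theorem mem_graph_natComp {g f : X →ₗ.[ℂ] X} {v w : X} :
    (v, w) ∈ (natComp g f).graph ↔ ∃ u, (v, u) ∈ f.graph ∧ (u, w) ∈ g.graph := by
  simp only [LinearPMap.mem_graph_iff]
  constructor
  · rintro ⟨⟨_, ⟨x, hx⟩, hy, rfl⟩, rfl, rfl⟩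
    exact ⟨_, ⟨⟨x, hx⟩, rfl, rfl⟩, ⟨⟨_, hy⟩, rfl, rfl⟩⟩
  · rintro ⟨u, ⟨⟨x, hx⟩, rfl, rfl⟩, ⟨⟨y, hy⟩, hxy, rfl⟩⟩
    obtain rfl : y = f ⟨x, hx⟩ := hxy
    exact ⟨⟨x, ⟨x, hx⟩, hy, rfl⟩, rfl, rfl⟩

/-- `v` and `q = (c - m - β k² D²) v` lie in `D(D²)` and
`f = z k D v - (γ v + k² D² q)`. -/
def IsSolution (D : X →ₗ.[ℂ] X) (m : X →L[ℂ] X) (γ β k c : ℝ) (z : ℂ) (v q f : X) : Prop :=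
  ∃ v1 v2 q1 q2, (v, v1) ∈ D.graph ∧ (v1, v2) ∈ D.graph ∧
    q = (c : ℂ) • v - m v - ((β : ℂ) * (k : ℂ) ^ 2) • v2 ∧
    (q, q1) ∈ D.graph ∧ (q1, q2) ∈ D.graph ∧
    f = (z * k) • v1 - (γ : ℂ) • v - ((k : ℂ) ^ 2) • q2

/-- When multiplication is bounded and everywhere defined, the natural domain of the fourth-order
operator amounts to two conditions, `v ∈ D(D²)` and `q ∈ D(D²)`. From here on every question about
the pencil is a question about `IsSolution`. -/
theorem mem_graph_pencil {D M : X →ₗ.[ℂ] X} {m : X →L[ℂ] X}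
    (hM : ∀ v w, (v, w) ∈ M.graph ↔ w = m v) (γ β k c : ℝ) (z : ℂ) (v f : X) :
    (v, f) ∈ (z • ((k : ℂ) • D) - linOp D M γ β k c).graph ↔
      ∃ q, IsSolution D m γ β k c z v q f := by
  simp only [mem_graph_sub, mem_graph_smul, linOp, mem_graph_add, mem_graph_natComp,
    mem_graph_idOp, hM, IsSolution]
  constructor
  · rintro ⟨_, _, ⟨_, ⟨v1, hv1, rfl⟩, rfl⟩, ⟨_, _, ⟨_, rfl, rfl⟩, ⟨q2, ⟨q, ⟨_, _, ⟨_, _, ⟨_, rfl, rfl⟩,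
      rfl, rfl⟩, ⟨v2, ⟨v1', hv1', hv2⟩, rfl⟩, rfl⟩, ⟨q1, hq1, hq2⟩⟩, rfl⟩, rfl⟩, rfl⟩
    obtain rfl := D.mem_graph_snd_inj hv1 hv1' rfl
    exact ⟨_, v1, v2, q1, q2, hv1, hv2, rfl, hq1, hq2, by rw [smul_smul]; abel⟩
  · rintro ⟨q, v1, v2, q1, q2, hv1, hv2, rfl, hq1, hq2, rfl⟩
    exact ⟨_, _, ⟨_, ⟨v1, hv1, rfl⟩, rfl⟩, ⟨_, _, ⟨_, rfl, rfl⟩, ⟨q2, ⟨_, ⟨_, _, ⟨_, _, ⟨_, rfl, rfl⟩,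
      rfl, rfl⟩, ⟨v2, ⟨v1, hv1, hv2⟩, rfl⟩, rfl⟩, ⟨q1, hq1, hq2⟩⟩, rfl⟩, rfl⟩,
      by rw [smul_smul]; abel⟩

theorem isEigenvalue_iff {A B : X →ₗ.[ℂ] X} {z : ℂ} :
    IsEigenvalue A B z ↔ ∃ v, v ≠ 0 ∧ (v, 0) ∈ (z • B - A).graph := by
  simp only [IsEigenvalue, mem_graph_sub, mem_graph_smul]
  refine exists_congr fun v => and_congr_right fun _ => ?_
  constructor
  · rintro ⟨hA, hB, h⟩
    exact ⟨_, _, ⟨_, B.mem_graph ⟨v, hB⟩, rfl⟩, A.mem_graph ⟨v, hA⟩, by rw [h, sub_self]⟩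
  · rintro ⟨_, a, ⟨b, hb, rfl⟩, ha, h⟩
    obtain ⟨⟨x, hx⟩, rfl, rfl⟩ := (LinearPMap.mem_graph_iff _).1 hb
    obtain ⟨⟨y, hy⟩, hxy, rfl⟩ := (LinearPMap.mem_graph_iff _).1 ha
    obtain rfl : y = x := hxy
    exact ⟨hy, hx, (sub_eq_zero.1 h.symm).symm⟩

theorem BoundedlyInvertible.eq_zero {T : X →ₗ.[ℂ] X} (h : BoundedlyInvertible T) {v : X}
    (hv : (v, 0) ∈ T.graph) : v = 0 := by
  obtain ⟨R, -, hR⟩ := h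
  obtain ⟨x, rfl, hx⟩ := (LinearPMap.mem_graph_iff _).1 hv
  rw [← hR x, hx]
  exact map_zero R

theorem IsEigenvalue.mem_spectrum {A B : X →ₗ.[ℂ] X} {z : ℂ} (h : IsEigenvalue A B z) :
    z ∈ spectrum A B := by
  obtain ⟨v, hv, h0⟩ := isEigenvalue_iff.1 h
  exact fun hz => hv (BoundedlyInvertible.eq_zero hz h0)

end Graphs

/-! ### Skew-symmetric operators and the fixed-point form of the pencil -/

section SkewResolvent

variable {X : Type*} [NormedAddCommGroup X] [InnerProductSpace ℂ X]

/-- `D` is skew-symmetric, and `Rp`, `Rm` are bounded right inverses of `D - 1`, `D + 1`. -/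
structure SkewResolvent (D : X →ₗ.[ℂ] X) (Rp Rm : X →L[ℂ] X) : Prop where
  skew : ∀ {v v' w w' : X}, (v, v') ∈ D.graph → (w, w') ∈ D.graph →
    inner ℂ v' w = -inner ℂ v w'
  Rp_mem : ∀ f, (Rp f, f + Rp f) ∈ D.graph
  Rm_mem : ∀ f, (Rm f, f - Rm f) ∈ D.graph

/-- The bounded operator `D (D² - 1)⁻¹`. -/
def derivInv (Rp Rm : X →L[ℂ] X) : X →L[ℂ] X := Rp ∘L Rm + Rm

theorem re_inner_eq_zero_of_skew {D : X →ₗ.[ℂ] X}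
    (h : ∀ {v v' w w' : X}, (v, v') ∈ D.graph → (w, w') ∈ D.graph →
      inner ℂ v' w = -inner ℂ v w') {v v' : X} (hv : (v, v') ∈ D.graph) :
    (inner ℂ v' v).re = 0 := by
  have h1 := congrArg Complex.re (h hv hv)
  have h2 : (inner ℂ v v').re = (inner ℂ v' v).re := by
    rw [← inner_conj_symm]; rfl
  rw [Complex.neg_re, h2] at h1
  linarith

namespace SkewResolvent

variable {D : X →ₗ.[ℂ] X} {Rp Rm : X →L[ℂ] X} (hD : SkewResolvent D Rp Rm)
include hD

theorem re_inner_eq_zero {v v' : X} (h : (v, v') ∈ D.graph) : (inner ℂ v' v).re = 0 :=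
  re_inner_eq_zero_of_skew hD.skew h

/-- Skewness makes `⟨Dv, v⟩` purely imaginary, so a nonzero real eigenvalue is impossible. This
makes `D ∓ 1` injective, and so the right inverses `Rp` and `Rm` are two-sided. -/
theorem eq_zero_of_mem_real {v : X} {a : ℝ} (ha : a ≠ 0) (h : (v, (a : ℂ) • v) ∈ D.graph) :
    v = 0 := by
  have h1 := hD.re_inner_eq_zero h
  rw [inner_smul_left, Complex.conj_ofReal, Complex.re_ofReal_mul, inner_self_eq_norm_sq_to_K] at h1
  have h2 : a * ‖v‖ ^ 2 = 0 := by exact_mod_cast h1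
  simpa [ha] using h2

theorem Rp_apply {v v' : X} (h : (v, v') ∈ D.graph) : Rp (v' - v) = v := by
  have h1 := D.graph.sub_mem (hD.Rp_mem (v' - v)) h
  have h2 : Rp (v' - v) - v = 0 := by
    refine hD.eq_zero_of_mem_real (a := 1) one_ne_zero ?_
    convert h1 using 1
    ext <;> simp
    abel
  exact sub_eq_zero.1 h2

theorem Rm_apply {v v' : X} (h : (v, v') ∈ D.graph) : Rm (v' + v) = v := by
  have h1 := D.graph.sub_mem (hD.Rm_mem (v' + v)) h
  have h2 : Rm (v' + v) - v = 0 := by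
    refine hD.eq_zero_of_mem_real (a := -1) (by norm_num) ?_
    convert h1 using 1
    ext <;> simp
    abel
  exact sub_eq_zero.1 h2

theorem inv_mem (f : X) : (Rp (Rm f), derivInv Rp Rm f) ∈ D.graph := by
  convert hD.Rp_mem (Rm f) using 2
  simp [derivInv, add_comm]

/-- Since `Rp Rm = (D² - 1)⁻¹`, this is `D²(D² - 1)⁻¹ = 1 + (D² - 1)⁻¹`. -/
theorem derivInv_mem (f : X) : (derivInv Rp Rm f, f + Rp (Rm f)) ∈ D.graph := by
  convert D.graph.add_mem (hD.Rp_mem (Rm f)) (hD.Rm_mem f) using 1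
  ext <;> simp [derivInv]
  abel

theorem Rm_apply_second {v v1 v2 : X} (h1 : (v, v1) ∈ D.graph) (h2 : (v1, v2) ∈ D.graph) :
    Rm (v2 - v) = v1 - v := by
  have h3 := D.graph.sub_mem h2 h1
  have := hD.Rm_apply (v := v1 - v) (v' := v2 - v1) (by simpa using h3)
  rwa [sub_add_sub_cancel] at this

theorem inv_apply {v v1 v2 : X} (h1 : (v, v1) ∈ D.graph) (h2 : (v1, v2) ∈ D.graph) :
    Rp (Rm (v2 - v)) = v := by
  rw [hD.Rm_apply_second h1 h2, hD.Rp_apply h1]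

theorem derivInv_apply {v v1 v2 : X} (h1 : (v, v1) ∈ D.graph) (h2 : (v1, v2) ∈ D.graph) :
    derivInv Rp Rm (v2 - v) = v1 := by
  simp [derivInv, hD.Rm_apply_second h1 h2, hD.Rp_apply h1]

end SkewResolvent

/-- The right hand side `(((c - m) v - q) / (β k²) - v)` of the equation `(D² - 1) v = …`. -/
def sourceV (m : X →L[ℂ] X) (β k c : ℝ) : X × X →L[ℂ] X :=
  ((β : ℂ) * (k : ℂ) ^ 2)⁻¹ • ((c : ℂ) • ContinuousLinearMap.fst ℂ X X -
    m ∘L ContinuousLinearMap.fst ℂ X X - ContinuousLinearMap.snd ℂ X X) -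
    ContinuousLinearMap.fst ℂ X X

theorem sourceV_apply (m : X →L[ℂ] X) (β k c : ℝ) (v q : X) :
    sourceV m β k c (v, q) =
      ((β : ℂ) * (k : ℂ) ^ 2)⁻¹ • ((c : ℂ) • v - m v - q) - v := rfl

/-- The right hand side `(z k D v - γ v) / k² - q` of the equation `(D² - 1) q = …`. -/
def sourceQ (Rp Rm m : X →L[ℂ] X) (γ β k c : ℝ) (z : ℂ) : X × X →L[ℂ] X :=
  ((k : ℂ) ^ 2)⁻¹ • ((z * k) • (derivInv Rp Rm ∘L sourceV m β k c) -
    (γ : ℂ) • ContinuousLinearMap.fst ℂ X X) - ContinuousLinearMap.snd ℂ X X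

theorem sourceQ_apply (Rp Rm m : X →L[ℂ] X) (γ β k c : ℝ) (z : ℂ) (v q : X) :
    sourceQ Rp Rm m γ β k c z (v, q) =
      ((k : ℂ) ^ 2)⁻¹ • ((z * k) • derivInv Rp Rm (sourceV m β k c (v, q)) - (γ : ℂ) • v) - q :=
  rfl

/-- The integrated form of the pencil as a fixed point operator for the pair `(v, q)`. -/
def fixedPointOp (Rp Rm m : X →L[ℂ] X) (γ β k c : ℝ) (z : ℂ) : X × X →L[ℂ] X × X :=
  (Rp ∘L Rm ∘L sourceV m β k c).prod (Rp ∘L Rm ∘L sourceQ Rp Rm m γ β k c z)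

/-- Both equations are solved for `D² - 1`: the sources are `D²v - v` and, up to `f / k²`, `D²q -
q`. The term `Dv` in the second source is rewritten as `D(D² - 1)⁻¹` of the first source, so that
everything on the right is bounded in `(v, q)`. -/
theorem SkewResolvent.isSolution_iff {D : X →ₗ.[ℂ] X} {Rp Rm : X →L[ℂ] X}
    (hD : SkewResolvent D Rp Rm) (m : X →L[ℂ] X) (γ c : ℝ) {β k : ℝ} (hβ : β ≠ 0) (hk : k ≠ 0)
    (z : ℂ) (v q f : X) :
    IsSolution D m γ β k c z v q f ↔
      (v, q) = fixedPointOp Rp Rm m γ β k c z (v, q) + (0, -(((k : ℂ) ^ 2)⁻¹ • Rp (Rm f))) := by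
  have hk2 : ((k : ℂ) ^ 2) ≠ 0 := by simpa using hk
  have hb : ((β : ℂ) * (k : ℂ) ^ 2) ≠ 0 := mul_ne_zero (by simpa using hβ) hk2
  constructor
  · rintro ⟨v1, v2, q1, q2, hv1, hv2, hq, hq1, hq2, rfl⟩
    have hs : sourceV m β k c (v, q) = v2 - v := by
      rw [sourceV_apply, hq, sub_sub_cancel, inv_smul_smul₀ hb]
    refine Prod.ext ?_ ?_
    · simp only [fixedPointOp, Prod.fst_add, ContinuousLinearMap.prod_apply,
        ContinuousLinearMap.comp_apply, hs, hD.inv_apply hv1 hv2, add_zero]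
    · simp only [fixedPointOp, Prod.snd_add, ContinuousLinearMap.prod_apply,
        ContinuousLinearMap.comp_apply, sourceQ_apply, hs, hD.derivInv_apply hv1 hv2]
      rw [← map_smul, ← map_smul, ← sub_eq_add_neg, ← map_sub, ← map_sub]
      rw [smul_sub (((k : ℂ) ^ 2)⁻¹) _ (((k : ℂ) ^ 2) • q2), inv_smul_smul₀ hk2]
      rw [← hD.inv_apply hq1 hq2]
      congr 2
      rw [hD.inv_apply hq1 hq2]
      abel
  · intro h
    set h0 := sourceV m β k c (v, q) with hh0
    set p := sourceQ Rp Rm m γ β k c z (v, q) - ((k : ℂ) ^ 2)⁻¹ • f with hp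
    have hv : v = Rp (Rm h0) := by simpa [fixedPointOp] using congrArg Prod.fst h
    have hq : q = Rp (Rm p) := by
      have := congrArg Prod.snd h
      simp only [fixedPointOp, Prod.snd_add, ContinuousLinearMap.prod_apply,
        ContinuousLinearMap.comp_apply] at this
      rw [hp, map_sub, map_sub, map_smul, map_smul, sub_eq_add_neg]
      exact this
    refine ⟨derivInv Rp Rm h0, h0 + v, derivInv Rp Rm p, p + q, ?_, ?_, ?_, ?_, ?_, ?_⟩
    · have := hD.inv_mem h0
      rwa [← hv] at this
    · have := hD.derivInv_mem h0
      rwa [← hv] at this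
    · have : h0 + v = ((β : ℂ) * (k : ℂ) ^ 2)⁻¹ • ((c : ℂ) • v - m v - q) := by
        simp [hh0, sourceV_apply]
      rw [this, smul_inv_smul₀ hb]
      abel
    · have := hD.inv_mem p
      rwa [← hq] at this
    · have := hD.derivInv_mem p
      rwa [← hq] at this
    · have : p + q = ((k : ℂ) ^ 2)⁻¹ • ((z * k) • derivInv Rp Rm h0 - (γ : ℂ) • v - f) := by
        rw [hp, sourceQ_apply, ← hh0, smul_sub _ _ f]
        abel
      rw [this, smul_inv_smul₀ hk2]
      abel

end SkewResolvent

/-! ### Solution operators, the energy estimate and symmetry of the inverse -/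

section Abstract

variable {X : Type*} [NormedAddCommGroup X] [InnerProductSpace ℂ X]

/-- The cross term vanishes in `‖(D - a)v‖² = ‖Dv‖² + ‖v‖²`, so `D - a` is bounded below on the
complete graph and has closed range. Dense range makes it an isomorphism from the graph onto `X`. -/
theorem exists_rightInverse_of_skew [CompleteSpace X] {D : X →ₗ.[ℂ] X}
    (hcl : IsClosed (D.graph : Set (X × X)))
    (hskew : ∀ {v v' w w' : X}, (v, v') ∈ D.graph → (w, w') ∈ D.graph →
      inner ℂ v' w = -inner ℂ v w') {a : ℝ} (ha : a ^ 2 = 1)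
    (hdense : ∀ g, (∀ v v', (v, v') ∈ D.graph → inner ℂ (v' - (a : ℂ) • v) g = 0) → g = 0) :
    ∃ R : X →L[ℂ] X, ∀ f, (R f, f + (a : ℂ) • R f) ∈ D.graph := by
  have : CompleteSpace D.graph := hcl.completeSpace_coe
  set L : D.graph →L[ℂ] X :=
    (ContinuousLinearMap.snd ℂ X X - (a : ℂ) • ContinuousLinearMap.fst ℂ X X) ∘L
      D.graph.subtypeL with hL
  have hLapp : ∀ p : D.graph, L p = p.1.2 - (a : ℂ) • p.1.1 := fun p => rfl
  have hbound : ∀ p : D.graph, ‖p‖ ≤ ‖L p‖ := by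
    rintro ⟨⟨v, v'⟩, hp⟩
    have h0 := re_inner_eq_zero_of_skew hskew hp
    have h1 : ‖v' - (a : ℂ) • v‖ ^ 2 = ‖v'‖ ^ 2 + ‖v‖ ^ 2 := by
      rw [@norm_sub_sq ℂ, inner_smul_right, norm_smul, mul_pow, Complex.norm_real,
        Real.norm_eq_abs, sq_abs, ha]
      have : RCLike.re ((a : ℂ) * inner ℂ v' v) = 0 := by
        change ((a : ℂ) * inner ℂ v' v).re = 0
        rw [Complex.re_ofReal_mul, h0, mul_zero]
      rw [this]
      ring
    rw [hLapp]
    refine max_le ?_ ?_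
    · refine abs_le_of_sq_le_sq' (b := ‖v' - (a : ℂ) • v‖) ?_ (norm_nonneg _) |>.2
      change ‖v‖ ^ 2 ≤ _
      rw [h1]
      nlinarith [sq_nonneg ‖v'‖]
    · refine abs_le_of_sq_le_sq' (b := ‖v' - (a : ℂ) • v‖) ?_ (norm_nonneg _) |>.2
      change ‖v'‖ ^ 2 ≤ _
      rw [h1]
      nlinarith [sq_nonneg ‖v‖]
  have hanti : AntilipschitzWith 1 L :=
    AddMonoidHomClass.antilipschitz_of_bound L (fun p => by simpa using hbound p)
  have hclosed : IsClosed (LinearMap.range (L : D.graph →ₗ[ℂ] X) : Set X) :=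
    hanti.isClosed_range L.uniformContinuous
  have hrange : LinearMap.range (L : D.graph →ₗ[ℂ] X) = ⊤ := by
    rw [← hclosed.submodule_topologicalClosure_eq, Submodule.topologicalClosure_eq_top_iff,
      Submodule.eq_bot_iff]
    intro g hg
    refine hdense g fun v v' h => ?_
    exact (Submodule.mem_orthogonal _ _).1 hg _ ⟨⟨(v, v'), h⟩, rfl⟩
  let e := ContinuousLinearEquiv.ofBijective L
    (LinearMap.ker_eq_bot.2 hanti.injective) hrange
  refine ⟨ContinuousLinearMap.fst ℂ X X ∘L D.graph.subtypeL ∘L e.symm.toContinuousLinearMap,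
    fun f => ?_⟩
  have h1 : L (e.symm f) = f := e.apply_symm_apply f
  have h2 : (e.symm f).1 ∈ D.graph := (e.symm f).2
  rw [hLapp] at h1
  have h3 : (e.symm f).1 = ((e.symm f).1.1, f + (a : ℂ) • (e.symm f).1.1) :=
    Prod.ext rfl (sub_eq_iff_eq_add.1 h1)
  rw [h3] at h2
  exact h2

/-- A vector `g` orthogonal to the range of `D - a` satisfies `Dg = -ag` by `hadj`, and a skew
operator has no nonzero real eigenvalue; so the ranges of `D ∓ 1` are dense. -/
theorem exists_skewResolvent [CompleteSpace X] {D : X →ₗ.[ℂ] X}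
    (hcl : IsClosed (D.graph : Set (X × X)))
    (hskew : ∀ {v v' w w' : X}, (v, v') ∈ D.graph → (w, w') ∈ D.graph →
      inner ℂ v' w = -inner ℂ v w')
    (hadj : ∀ w w', (∀ v v', (v, v') ∈ D.graph → inner ℂ v' w = -inner ℂ v w') →
      (w, w') ∈ D.graph) :
    ∃ Rp Rm : X →L[ℂ] X, SkewResolvent D Rp Rm := by
  have key : ∀ a : ℝ, a ^ 2 = 1 →
      ∃ R : X →L[ℂ] X, ∀ f, (R f, f + (a : ℂ) • R f) ∈ D.graph := by
    intro a ha
    refine exists_rightInverse_of_skew hcl hskew ha fun g hg => ?_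
    have h1 : (g, (-a : ℂ) • g) ∈ D.graph := by
      refine hadj _ _ fun v v' h => ?_
      have := hg v v' h
      rw [inner_sub_left, inner_smul_left, Complex.conj_ofReal, sub_eq_zero] at this
      rw [this, inner_smul_right]
      ring
    have h2 := re_inner_eq_zero_of_skew hskew h1
    rw [inner_smul_left, map_neg, Complex.conj_ofReal, ← Complex.ofReal_neg, Complex.re_ofReal_mul,
      inner_self_eq_norm_sq_to_K] at h2
    have h3 : -a * ‖g‖ ^ 2 = 0 := by exact_mod_cast h2
    have ha0 : a ≠ 0 := by rintro rfl; norm_num at ha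
    simpa [ha0] using h3
  obtain ⟨Rp, hp⟩ := key 1 (by norm_num)
  obtain ⟨Rm, hm⟩ := key (-1) (by norm_num)
  exact ⟨Rp, Rm, hskew, by simpa using hp, fun f => by simpa [sub_eq_add_neg] using hm f⟩

variable {D : X →ₗ.[ℂ] X} {Rp Rm : X →L[ℂ] X}

theorem IsSolution.snd_eq_zero {m : X →L[ℂ] X} {γ β k c : ℝ} {z : ℂ} {q f : X}
    (h : IsSolution D m γ β k c z 0 q f) : q = 0 := by
  obtain ⟨v1, v2, q1, q2, hv1, hv2, rfl, -⟩ := h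
  obtain rfl : v1 = 0 := D.graph_fst_eq_zero_snd hv1 rfl
  obtain rfl : v2 = 0 := D.graph_fst_eq_zero_snd hv2 rfl
  simp

theorem IsSolution.sub {m : X →L[ℂ] X} {γ β k c : ℝ} {z : ℂ} {v v' q q' f f' : X}
    (h : IsSolution D m γ β k c z v q f) (h' : IsSolution D m γ β k c z v' q' f') :
    IsSolution D m γ β k c z (v - v') (q - q') (f - f') := by
  obtain ⟨v1, v2, q1, q2, hv1, hv2, rfl, hq1, hq2, rfl⟩ := h
  obtain ⟨w1, w2, r1, r2, hw1, hw2, rfl, hr1, hr2, rfl⟩ := h'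
  refine ⟨v1 - w1, v2 - w2, q1 - r1, q2 - r2, D.graph.sub_mem hv1 hw1, D.graph.sub_mem hv2 hw2, ?_,
    D.graph.sub_mem hq1 hr1, D.graph.sub_mem hq2 hr2, ?_⟩
  · simp only [smul_sub, map_sub]; abel
  · simp only [smul_sub]; abel

variable [CompleteSpace X] (hD : SkewResolvent D Rp Rm)
include hD

/-- Thanks to the fixed-point form, the triples `(f, v, q)` of data and solutions form the kernel of
a bounded operator, hence a Banach space. Its projection to `f` is a continuous bijection, and the
open mapping theorem bounds both `v` and `q`. -/
theorem exists_solutionOp_of_bijective (m : X →L[ℂ] X) (γ c : ℝ) {β k : ℝ} (hβ : β ≠ 0)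
    (hk : k ≠ 0) (z : ℂ) (hker : ∀ v q, IsSolution D m γ β k c z v q 0 → v = 0)
    (hsurj : ∀ f, ∃ v q, IsSolution D m γ β k c z v q f) :
    ∃ S : X →L[ℂ] X × X, ∀ f, IsSolution D m γ β k c z (S f).1 (S f).2 f := by
  set Lm : X × X × X →L[ℂ] X × X :=
    (ContinuousLinearMap.id ℂ (X × X) - fixedPointOp Rp Rm m γ β k c z) ∘L
        ContinuousLinearMap.snd ℂ X (X × X) +
      ContinuousLinearMap.inr ℂ X X ∘L (((k : ℂ) ^ 2)⁻¹ • (Rp ∘L Rm)) ∘L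
        ContinuousLinearMap.fst ℂ X (X × X) with hLm
  have hmem : ∀ f v q, Lm (f, v, q) = 0 ↔ IsSolution D m γ β k c z v q f := by
    intro f v q
    rw [hD.isSolution_iff m γ c hβ hk]
    have : Lm (f, v, q) = (v, q) - (fixedPointOp Rp Rm m γ β k c z (v, q) +
        (0, -(((k : ℂ) ^ 2)⁻¹ • Rp (Rm f)))) := by
      have h1 : Lm (f, v, q) = ((v, q) - fixedPointOp Rp Rm m γ β k c z (v, q)) +
        (0, ((k : ℂ) ^ 2)⁻¹ • Rp (Rm f)) := rfl
      rw [h1]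
      refine Prod.ext ?_ ?_
      · simp
      · simp only [Prod.snd_add, Prod.snd_sub]; abel
    rw [this, sub_eq_zero]
  set P : Submodule ℂ (X × X × X) := LinearMap.ker (Lm : X × X × X →ₗ[ℂ] X × X) with hP
  have hPc : IsClosed (P : Set (X × X × X)) := Lm.isClosed_ker
  have : CompleteSpace P := hPc.completeSpace_coe
  set F : P →L[ℂ] X := ContinuousLinearMap.fst ℂ X (X × X) ∘L P.subtypeL with hF
  have hinj : LinearMap.ker (F : P →ₗ[ℂ] X) = ⊥ := by
    rw [LinearMap.ker_eq_bot']
    rintro ⟨⟨f, v, q⟩, hp⟩ h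
    obtain rfl : f = 0 := h
    have h1 := (hmem _ _ _).1 hp
    obtain rfl := hker _ _ h1
    obtain rfl := h1.snd_eq_zero
    rfl
  have hrange : LinearMap.range (F : P →ₗ[ℂ] X) = ⊤ := by
    rw [LinearMap.range_eq_top]
    intro f
    obtain ⟨v, q, h⟩ := hsurj f
    exact ⟨⟨(f, v, q), (hmem _ _ _).2 h⟩, rfl⟩
  let e := ContinuousLinearEquiv.ofBijective F hinj hrange
  refine ⟨ContinuousLinearMap.snd ℂ X (X × X) ∘L P.subtypeL ∘L e.symm.toContinuousLinearMap,
    fun f => ?_⟩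
  have h1 : (e.symm f).1.1 = f := e.apply_symm_apply f
  have h2 := (hmem _ _ _).1 (e.symm f).2
  rw [h1] at h2
  exact h2

omit hD [CompleteSpace X] in
theorem boundedlyInvertible_of_solutionOp {M : X →ₗ.[ℂ] X} {m : X →L[ℂ] X}
    (hM : ∀ v w, (v, w) ∈ M.graph ↔ w = m v) {γ β k c : ℝ} {z : ℂ}
    (hker : ∀ v q, IsSolution D m γ β k c z v q 0 → v = 0)
    (S : X →L[ℂ] X × X) (hS : ∀ f, IsSolution D m γ β k c z (S f).1 (S f).2 f) :
    BoundedlyInvertible (z • ((k : ℂ) • D) - linOp D M γ β k c) := by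
  refine ⟨ContinuousLinearMap.fst ℂ X X ∘L S,
    fun f => (mem_graph_pencil hM _ _ _ _ _ _ _).2 ⟨_, hS f⟩, fun x => ?_⟩
  obtain ⟨q, hq⟩ := (mem_graph_pencil hM _ _ _ _ _ _ _).1 (LinearPMap.mem_graph _ x)
  have h1 := (hS ((z • ((k : ℂ) • D) - linOp D M γ β k c) x)).sub hq
  rw [sub_self] at h1
  exact sub_eq_zero.1 (hker _ _ h1)

theorem boundedlyInvertible_of_bijective {M : X →ₗ.[ℂ] X} {m : X →L[ℂ] X}
    (hM : ∀ v w, (v, w) ∈ M.graph ↔ w = m v) (γ c : ℝ) {β k : ℝ} (hβ : β ≠ 0)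
    (hk : k ≠ 0) (z : ℂ) (hker : ∀ v q, IsSolution D m γ β k c z v q 0 → v = 0)
    (hsurj : ∀ f, ∃ v q, IsSolution D m γ β k c z v q f) :
    BoundedlyInvertible (z • ((k : ℂ) • D) - linOp D M γ β k c) := by
  obtain ⟨S, hS⟩ := exists_solutionOp_of_bijective hD m γ c hβ hk z hker hsurj
  exact boundedlyInvertible_of_solutionOp hM hker S hS

omit hD [CompleteSpace X] in
theorem isCompactOperator_prod {Y Z W : Type*} [NormedAddCommGroup Y] [NormedSpace ℂ Y]
    [NormedAddCommGroup Z] [NormedSpace ℂ Z] [NormedAddCommGroup W] [NormedSpace ℂ W]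
    {f : Y →L[ℂ] Z} {g : Y →L[ℂ] W} (hf : IsCompactOperator f) (hg : IsCompactOperator g) :
    IsCompactOperator (f.prod g) := by
  obtain ⟨K1, hK1, h1⟩ := hf
  obtain ⟨K2, hK2, h2⟩ := hg
  refine ⟨K1 ×ˢ K2, hK1.prod hK2, ?_⟩
  filter_upwards [h1, h2] with x hx1 hx2
  exact ⟨hx1, hx2⟩

/-- Both components of the fixed-point operator factor through `Rm`, so it is compact. A fixed
vector would be a solution with `f = 0`; hence 1 is not an eigenvalue and the Fredholm alternative
yields solvability for every `f`. -/
theorem exists_solutionOp_of_isCompactOperator (hc : IsCompactOperator Rm) (m : X →L[ℂ] X)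
    (γ c : ℝ) {β k : ℝ} (hβ : β ≠ 0) (hk : k ≠ 0) (z : ℂ)
    (hker : ∀ v q, IsSolution D m γ β k c z v q 0 → v = 0) :
    ∃ S : X →L[ℂ] X × X, ∀ f, IsSolution D m γ β k c z (S f).1 (S f).2 f := by
  refine exists_solutionOp_of_bijective hD m γ c hβ hk z hker fun f => ?_
  have hK : IsCompactOperator (fixedPointOp Rp Rm m γ β k c z) :=
    isCompactOperator_prod ((hc.comp_clm _).clm_comp Rp) ((hc.comp_clm _).clm_comp Rp)
  have h1 := (hK.hasEigenvalue_or_mem_resolventSet one_ne_zero).resolve_left (by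
    intro h
    obtain ⟨⟨v, q⟩, hvq⟩ := h.exists_hasEigenvector
    have h2 : IsSolution D m γ β k c z v q 0 := by
      rw [hD.isSolution_iff m γ c hβ hk]
      have h3 : (v, q) = fixedPointOp Rp Rm m γ β k c z (v, q) := by
        simpa using hvq.apply_eq_smul.symm
      rw [map_zero, map_zero, smul_zero, neg_zero, ← Prod.zero_eq_mk, add_zero]
      exact h3
    obtain rfl := hker _ _ h2
    obtain rfl := h2.snd_eq_zero
    exact hvq.2 rfl)
  rw [_root_.spectrum.mem_resolventSet_iff, map_one] at h1
  obtain ⟨u, hu⟩ := h1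
  set y : X × X := (0, -(((k : ℂ) ^ 2)⁻¹ • Rp (Rm f)))
  set x : X × X := (↑u⁻¹ : X × X →L[ℂ] X × X) y with hx
  have h3 : x - fixedPointOp Rp Rm m γ β k c z x = y := by
    have : (↑u * ↑u⁻¹ : X × X →L[ℂ] X × X) y = y := by rw [Units.mul_inv]; rfl
    rw [hu] at this
    exact this
  refine ⟨x.1, x.2, (hD.isSolution_iff m γ c hβ hk _ _ _ _).2 ?_⟩
  rw [Prod.mk.eta]
  exact sub_eq_iff_eq_add'.1 h3

omit [CompleteSpace X] hD in
theorem derivInv_isCompactOperator (hc : IsCompactOperator Rm) :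
    IsCompactOperator (derivInv Rp Rm) :=
  (hc.clm_comp Rp).add hc

omit [CompleteSpace X] hD in
-- For `p = zkv - k²Dq` the homogeneous equation reads `Dp = γv`, so `γ Re⟨v, p⟩ = 0`. Integration
-- by parts leaves `Re⟨Dq, v⟩ = -½ Re⟨φ'v, v⟩`, with `m1` in the role of `φ'`. Together, `k Re z
-- ‖v‖² = -(k²/2) Re⟨φ'v, v⟩`, which forces `Re z ≤ k‖m1‖/2` unless `v = 0`.
theorem eq_zero_of_re_large
    (hskew : ∀ {v v' w w' : X}, (v, v') ∈ D.graph → (w, w') ∈ D.graph →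
      inner ℂ v' w = -inner ℂ v w') {m m1 : X →L[ℂ] X}
    (hsa : ∀ u w, inner ℂ (m u) w = inner ℂ u (m w))
    (hleib : ∀ {v v'}, (v, v') ∈ D.graph → (m v, m v' + m1 v) ∈ D.graph)
    {γ β k c : ℝ} (hγ : γ ≠ 0) (hβ : β ≠ 0) (hk : 0 < k) {z : ℂ} (hz : k * ‖m1‖ / 2 < z.re)
    {v q : X} (h : IsSolution D m γ β k c z v q 0) : v = 0 := by
  obtain ⟨v1, v2, q1, q2, hv1, hv2, hq, hq1, hq2, h0⟩ := h
  have hre : ∀ {v v' : X}, (v, v') ∈ D.graph → (inner ℂ v' v).re = 0 :=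
    fun h => re_inner_eq_zero_of_skew hskew h
  have hsymm : ∀ a b : X, (inner ℂ a b).re = (inner ℂ b a).re := fun a b => by
    rw [← inner_conj_symm]; rfl
  have hb : ((β : ℂ) * (k : ℂ) ^ 2) ≠ 0 :=
    mul_ne_zero (by simpa using hβ) (by simpa using hk.ne')
  -- the third derivative
  have hv3 : (v2, ((β : ℂ) * (k : ℂ) ^ 2)⁻¹ • ((c : ℂ) • v1 - (m v1 + m1 v) - q1)) ∈ D.graph := by
    have h1 := D.graph.smul_mem (((β : ℂ) * (k : ℂ) ^ 2)⁻¹)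
      (D.graph.sub_mem (D.graph.sub_mem (D.graph.smul_mem (c : ℂ) hv1) (hleib hv1)) hq1)
    convert h1 using 1
    refine Prod.ext ?_ rfl
    change v2 = ((β : ℂ) * (k : ℂ) ^ 2)⁻¹ • ((c : ℂ) • v - m v - q)
    rw [hq, sub_sub_cancel, inv_smul_smul₀ hb]
  set v3 := ((β : ℂ) * (k : ℂ) ^ 2)⁻¹ • ((c : ℂ) • v1 - (m v1 + m1 v) - q1) with hv3def
  have hq1' : q1 = (c : ℂ) • v1 - (m v1 + m1 v) - ((β * k ^ 2 : ℝ) : ℂ) • v3 := by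
    rw [hv3def]
    push_cast
    rw [smul_inv_smul₀ hb]
    abel
  have e1 : (inner ℂ q1 v).re = -((inner ℂ (m1 v) v).re) / 2 := by
    have a1 : (inner ℂ v1 v).re = 0 := hre hv1
    have a2 : (inner ℂ v3 v).re = 0 := by
      rw [hskew hv3 hv1, Complex.neg_re, hre hv2, neg_zero]
    -- This is the integrated form of `2 Re(φ v' v̄) = (φ|v|²)' - φ'|v|²`.
    have a3 : 2 * (inner ℂ (m v1) v).re = -(inner ℂ (m1 v) v).re := by
      have b1 : inner ℂ (m v1) v = -inner ℂ v (m v1 + m1 v) := by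
        rw [hsa]; exact hskew hv1 (hleib hv1)
      have b2 := congrArg Complex.re b1
      rw [Complex.neg_re, inner_add_right, Complex.add_re, hsymm v (m v1), hsymm v (m1 v)] at b2
      linarith
    rw [hq1', inner_sub_left, inner_sub_left, inner_add_left, inner_smul_left, inner_smul_left,
      Complex.conj_ofReal, Complex.conj_ofReal, Complex.sub_re, Complex.sub_re,
      Complex.re_ofReal_mul, Complex.re_ofReal_mul, a1, a2, Complex.add_re]
    linarith
  have hp : ((z * k) • v - ((k ^ 2 : ℝ) : ℂ) • q1, (γ : ℂ) • v) ∈ D.graph := by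
    have h1 := D.graph.sub_mem (D.graph.smul_mem (z * k) hv1)
      (D.graph.smul_mem (((k ^ 2 : ℝ)) : ℂ) hq2)
    convert h1 using 1
    refine Prod.ext rfl ?_
    change (γ : ℂ) • v = (z * k) • v1 - ((k ^ 2 : ℝ) : ℂ) • q2
    push_cast
    rw [← sub_eq_zero, ← neg_eq_zero, h0]
    abel
  have e2 : (inner ℂ ((z * k) • v - ((k ^ 2 : ℝ) : ℂ) • q1) v).re = 0 := by
    have h1 := hre hp
    rw [inner_smul_left, Complex.conj_ofReal, Complex.re_ofReal_mul, hsymm] at h1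
    exact (mul_eq_zero.1 h1).resolve_left hγ
  rw [inner_sub_left, inner_smul_left, inner_smul_left, Complex.conj_ofReal, Complex.sub_re,
    Complex.re_ofReal_mul, e1, inner_self_eq_norm_sq_to_K] at e2
  have e3 : ((starRingEnd ℂ) (z * k) * ((‖v‖ : ℂ)) ^ 2).re = z.re * k * ‖v‖ ^ 2 := by
    rw [map_mul, Complex.conj_ofReal, mul_assoc, ← Complex.ofReal_pow, ← Complex.ofReal_mul]
    rw [mul_comm, Complex.re_ofReal_mul, Complex.conj_re]
    ring
  rw [show ((RCLike.ofReal ‖v‖ : ℂ)) = ((‖v‖ : ℝ) : ℂ) from rfl, e3] at e2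
  have e4 : |(inner ℂ (m1 v) v).re| ≤ ‖m1‖ * ‖v‖ ^ 2 := by
    refine (Complex.abs_re_le_norm _).trans ((norm_inner_le_norm _ _).trans ?_)
    calc ‖m1 v‖ * ‖v‖ ≤ (‖m1‖ * ‖v‖) * ‖v‖ := by gcongr; exact m1.le_opNorm v
      _ = _ := by ring
  have e5 := (abs_le.1 e4).1
  by_contra hv
  have hvp : 0 < ‖v‖ ^ 2 := by positivity
  have e6 : k * ‖m1‖ / 2 * (k * ‖v‖ ^ 2) < z.re * (k * ‖v‖ ^ 2) :=
    mul_lt_mul_of_pos_right hz (by positivity)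
  nlinarith [mul_le_mul_of_nonneg_left e5 (sq_nonneg k)]

omit [CompleteSpace X] in
-- The square of a skew operator is symmetric, so `(D² - 1)⁻¹` is too: two integrations by parts
-- move `D²` across.
theorem inner_inv_symm (y g : X) : inner ℂ (Rp (Rm y)) g = inner ℂ y (Rp (Rm g)) := by
  have h1 := hD.skew (hD.derivInv_mem y) (hD.inv_mem g)
  have h2 := hD.skew (hD.inv_mem y) (hD.derivInv_mem g)
  rw [inner_add_left] at h1
  rw [inner_add_right, ] at h2
  have h3 : inner ℂ y (Rp (Rm g)) + inner ℂ (Rp (Rm y)) (Rp (Rm g)) =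
      inner ℂ (Rp (Rm y)) g + inner ℂ (Rp (Rm y)) (Rp (Rm g)) := by
    rw [h1, h2, neg_neg]
  exact (add_right_cancel h3).symm

omit [CompleteSpace X] in
theorem inv_injective {a : X} (h : Rp (Rm a) = 0) : a = 0 := by
  have h1 := hD.inv_mem a
  have h2 := hD.derivInv_mem a
  rw [D.graph_fst_eq_zero_snd h1 h, h] at h2
  simpa using D.graph_fst_eq_zero_snd h2 rfl

end Abstract

/-! ### Density of the range by duality -/

section Density

variable {X : Type*} [NormedAddCommGroup X] [InnerProductSpace ℂ X] [CompleteSpace X]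
  {D : X →ₗ.[ℂ] X} {Rp Rm : X →L[ℂ] X}

omit [CompleteSpace X] in
/-- Test functions in the domain of the pencil: `v = (D² - 1)⁻² y`. -/
theorem isSolution_of_inv_sq (hD : SkewResolvent D Rp Rm) {m m1 m2 : X →L[ℂ] X}
    (hm : ∀ {v v'}, (v, v') ∈ D.graph → (m v, m v' + m1 v) ∈ D.graph)
    (hm1 : ∀ {v v'}, (v, v') ∈ D.graph → (m1 v, m1 v' + m2 v) ∈ D.graph)
    (β k c : ℝ) (y : X) :
    ∃ v1 v2 q1 q2 : X, v1 = derivInv Rp Rm (Rp (Rm y)) ∧ v2 = Rp (Rm y) + Rp (Rm (Rp (Rm y))) ∧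
      (Rp (Rm (Rp (Rm y))), v1) ∈ D.graph ∧ (v1, v2) ∈ D.graph ∧
      ((c : ℂ) • Rp (Rm (Rp (Rm y))) - m (Rp (Rm (Rp (Rm y)))) - ((β : ℂ) * (k : ℂ) ^ 2) • v2, q1)
        ∈ D.graph ∧ (q1, q2) ∈ D.graph ∧
      q2 = (c : ℂ) • v2 - (m v2 + m1 v1 + (m1 v1 + m2 (Rp (Rm (Rp (Rm y)))))) -
        ((β : ℂ) * (k : ℂ) ^ 2) • (y + Rp (Rm y) + v2) := by
  set u := Rp (Rm y) with hu
  set v := Rp (Rm u) with hv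
  have h1 := hD.inv_mem y
  have h2 := hD.derivInv_mem y
  have h3 := hD.inv_mem u
  have h4 := hD.derivInv_mem u
  have h5 := D.graph.add_mem h1 h3
  have h6 := D.graph.add_mem h2 h4
  refine ⟨_, _, _, _, rfl, rfl, h3, h4, D.graph.sub_mem (D.graph.sub_mem
    (D.graph.smul_mem (c : ℂ) h3) (hm h3)) (D.graph.smul_mem _ h5), D.graph.sub_mem
    (D.graph.sub_mem (D.graph.smul_mem (c : ℂ) h4) (D.graph.add_mem (hm h4) (hm1 h3)))
    (D.graph.smul_mem _ h6), ?_⟩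
  simp [← hv, ← hu]

/-- The range of the pencil at `z` is dense if the pencil is injective at `-conj z`. -/
theorem eq_zero_of_orthogonal_range (hD : SkewResolvent D Rp Rm) {m m1 m2 : X →L[ℂ] X}
    (hsa : ∀ u w, inner ℂ (m u) w = inner ℂ u (m w))
    (hm : ∀ {v v'}, (v, v') ∈ D.graph → (m v, m v' + m1 v) ∈ D.graph)
    (hm1 : ∀ {v v'}, (v, v') ∈ D.graph → (m1 v, m1 v' + m2 v) ∈ D.graph)
    {γ β k c : ℝ} (hγ : γ ≠ 0) (hβ : β ≠ 0) (hk : k ≠ 0) {z : ℂ}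
    (hker : ∀ v q, IsSolution D m γ β k c (-(starRingEnd ℂ z)) v q 0 → v = 0) {g : X}
    (hg : ∀ v q f, IsSolution D m γ β k c z v q f → inner ℂ f g = 0) : g = 0 := by
  have hk2 : ((k : ℂ) ^ 2) ≠ 0 := by simpa using hk
  have hb : ((β : ℂ) * (k : ℂ) ^ 2) ≠ 0 := mul_ne_zero (by simpa using hβ) hk2
  set G : X →L[ℂ] X := Rp ∘L Rm with hG
  have hGapp : ∀ x, Rp (Rm x) = G x := fun x => rfl
  have hGsymm : ∀ a b : X, inner ℂ (G a) b = inner ℂ a (G b) := inner_inv_symm hD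
  set b : ℂ := (β : ℂ) * (k : ℂ) ^ 2 * (k : ℂ) ^ 2 with hbdef
  have hb0 : b ≠ 0 := mul_ne_zero hb hk2
  have hbreal : (starRingEnd ℂ) b = b := by simp [hbdef]
  -- `g` lies in `D(D²)`
  obtain ⟨g0, hg0⟩ : ∃ g0, g = G g0 := by
    -- On test vectors `v = G²y`, with `G = (D² - 1)⁻¹`, the pencil equals `by + F(Gy)`, where `b =
    -- βk⁴` and `F` is bounded. Orthogonality then says `bg + GF*g = 0`, which exhibits `g` as an
    -- element of `ran G = D(D²)`.
    set F : X →L[ℂ] X := (z * k) • derivInv Rp Rm - (γ : ℂ) • G - ((k : ℂ) ^ 2) •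
      ((c : ℂ) • (1 + G) - (m ∘L (1 + G) + m1 ∘L derivInv Rp Rm +
        (m1 ∘L derivInv Rp Rm + m2 ∘L G))) + b • (1 + 1 + G) with hF
    refine ⟨-(b⁻¹ • ContinuousLinearMap.adjoint F g), ?_⟩
    have h1 : ∀ y, inner ℂ y (b • g + G (ContinuousLinearMap.adjoint F g)) = 0 := by
      intro y
      obtain ⟨v1, v2, q1, q2, hv1, hv2, h1, h2, h3, h4, hq2⟩ :=
        isSolution_of_inv_sq hD hm hm1 β k c y
      have h5 := hg _ _ _ ⟨v1, v2, q1, q2, h1, h2, rfl, h3, h4, rfl⟩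
      have h6 : (z * k) • v1 - (γ : ℂ) • Rp (Rm (Rp (Rm y))) - ((k : ℂ) ^ 2) • q2 =
          b • y + F (G y) := by
        have h7 : F (G y) = (z * k) • derivInv Rp Rm (G y) - (γ : ℂ) • G (G y) - ((k : ℂ) ^ 2) •
          ((c : ℂ) • (G y + G (G y)) - (m (G y + G (G y)) + m1 (derivInv Rp Rm (G y)) +
          (m1 (derivInv Rp Rm (G y)) + m2 (G (G y))))) + b • (G y + G y + G (G y)) := rfl
        rw [h7, hq2, hv1, hv2]
        simp only [hGapp, hbdef]
        module
      rw [h6, inner_add_left, inner_smul_left, hbreal] at h5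
      rw [inner_add_right, inner_smul_right, ← hGsymm,
        ContinuousLinearMap.adjoint_inner_right, h5]
    have h2 : b • g + G (ContinuousLinearMap.adjoint F g) = 0 := by
      have := h1 (b • g + G (ContinuousLinearMap.adjoint F g))
      exact inner_self_eq_zero.1 this
    rw [map_neg, map_smul, eq_neg_of_add_eq_zero_right h2, smul_neg, neg_neg, inv_smul_smul₀ hb0]
  set g1 := derivInv Rp Rm g0 with hg1
  set w := g0 + g with hw
  have hgg1 : (g, g1) ∈ D.graph := by rw [hg0]; exact hD.inv_mem g0
  have hg1w : (g1, w) ∈ D.graph := by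
    have := hD.derivInv_mem g0; rwa [hGapp, ← hg0] at this
  -- `w = D² g` lies in `D(D²)`
  set s : X := -((starRingEnd ℂ z * k) • g1) - (γ : ℂ) • g -
    ((k : ℂ) ^ 2) • ((c : ℂ) • w - m w) + b • w with hs
  have hws : b • w + G s = 0 := by
    refine inv_injective hD ?_
    change G _ = 0
    have h1 : ∀ y, inner ℂ y (G (b • w + G s)) = 0 := by
      intro y
      obtain ⟨v1, v2, q1, q2, hv1, hv2, h1, h2, h3, h4, -⟩ :=
        isSolution_of_inv_sq hD hm hm1 β k c y
      have h5 := hg _ _ _ ⟨v1, v2, q1, q2, h1, h2, rfl, h3, h4, rfl⟩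
      rw [hGapp, hGapp] at *
      set v := G (G y) with hv
      have e1 : inner ℂ v1 g = -inner ℂ v g1 := hD.skew h1 hgg1
      have e2 : inner ℂ q2 g = inner ℂ ((c : ℂ) • v - m v - ((β : ℂ) * (k : ℂ) ^ 2) • v2) w := by
        rw [hD.skew h4 hgg1, hD.skew h3 hg1w, neg_neg]
      rw [inner_sub_left, inner_sub_left, inner_smul_left, inner_smul_left, inner_smul_left, e1, e2,
        inner_sub_left, inner_sub_left, inner_smul_left, inner_smul_left, hsa, hv2, inner_add_left] at h5
      rw [← hGsymm, inner_add_right, ← hGsymm, ← hv, hs, inner_smul_right]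
      simp only [inner_add_right, inner_sub_right, inner_neg_right, inner_smul_right]
      simp only [map_mul, map_pow, Complex.conj_ofReal] at h5
      rw [← h5, hbdef]
      ring
    exact inner_self_eq_zero.1 (h1 (G (b • w + G s)))
  have hwG : w = G (-(b⁻¹ • s)) := by
    rw [map_neg, map_smul, eq_neg_of_add_eq_zero_right hws, smul_neg, neg_neg, inv_smul_smul₀ hb0]
  set w1 := derivInv Rp Rm (-(b⁻¹ • s)) with hw1
  set w2 := -(b⁻¹ • s) + w with hw2
  have hww1 : (w, w1) ∈ D.graph := by
    have := hD.inv_mem (-(b⁻¹ • s)); rwa [hGapp, ← hwG] at this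
  have hw1w2 : (w1, w2) ∈ D.graph := by
    have := hD.derivInv_mem (-(b⁻¹ • s)); rwa [hGapp, ← hwG] at this
  have hq : (c : ℂ) • w - m w - ((β : ℂ) * (k : ℂ) ^ 2) • w2 =
      -(((k : ℂ) ^ 2)⁻¹ • ((starRingEnd ℂ z * k) • g1 + (γ : ℂ) • g)) := by
    have h1 : ((k : ℂ) ^ 2) • (((β : ℂ) * (k : ℂ) ^ 2) • w2) = b • w - s := by
      rw [smul_smul, mul_comm, ← hbdef, hw2, smul_add, smul_neg, smul_inv_smul₀ hb0]
      abel
    have h2 : ((β : ℂ) * (k : ℂ) ^ 2) • w2 = ((k : ℂ) ^ 2)⁻¹ • (b • w - s) := by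
      rw [← h1, inv_smul_smul₀ hk2]
    have h3 : (c : ℂ) • w - m w = ((k : ℂ) ^ 2)⁻¹ • (((k : ℂ) ^ 2) • ((c : ℂ) • w - m w)) := by
      rw [inv_smul_smul₀ hk2]
    rw [h2, h3, ← smul_sub, ← smul_neg, hs]
    congr 1
    abel
  -- The adjoint equation is `k²(c - m - βk²D²)D²g = -(z̄kDg + γg)`. Applying `D²` to it gives the
  -- pencil equation at `-z̄` for `w = D²g`.
  have hsol : IsSolution D m γ β k c (-(starRingEnd ℂ z)) w
      (-(((k : ℂ) ^ 2)⁻¹ • ((starRingEnd ℂ z * k) • g1 + (γ : ℂ) • g))) 0 := by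
    refine ⟨w1, w2, _, _, hww1, hw1w2, hq.symm, D.graph.neg_mem (D.graph.smul_mem _
      (D.graph.add_mem (D.graph.smul_mem _ hg1w) (D.graph.smul_mem _ hgg1))),
      D.graph.neg_mem (D.graph.smul_mem _
      (D.graph.add_mem (D.graph.smul_mem _ hww1) (D.graph.smul_mem _ hg1w))), ?_⟩
    change (0 : X) = (-(starRingEnd ℂ z) * k) • w1 - (γ : ℂ) • w - ((k : ℂ) ^ 2) •
      -(((k : ℂ) ^ 2)⁻¹ • ((starRingEnd ℂ z * k) • w1 + (γ : ℂ) • w))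
    rw [smul_neg, smul_inv_smul₀ hk2, neg_mul, neg_smul]
    abel
  have hw0 : w = 0 := hker _ _ hsol
  -- From `w = 0` one gets `‖Dg‖² = -⟨D²g, g⟩ = 0`; the adjoint equation then reduces to `γg = 0`.
  have hg10 : g1 = 0 := by
    have h1 := hD.skew hgg1 hgg1
    have h2 := hD.skew hg1w hgg1
    rw [hw0, inner_zero_left, eq_comm, neg_eq_zero] at h2
    exact inner_self_eq_zero.1 h2
  have hs0 : s = 0 := by
    have h1 := hws
    rw [hw0, smul_zero, zero_add] at h1
    exact inv_injective hD h1
  rw [hs, hw0, hg10] at hs0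
  simpa [hγ] using hs0

end Density

open Module Module.End

/-! ### Riesz theory: generalized eigenspaces of compact operators -/

section Compact

variable {X : Type*} [NormedAddCommGroup X] [InnerProductSpace ℂ X]

/-- Triangularization of `C` on `V`: for an eigenvalue `μ`, the range of `C - μ` lies in a
hyperplane `V'`, which is therefore invariant. If `e` is a unit vector of `V` orthogonal to `V'`,
then `⟨e, Ce - Cb⟩ = μ` for all `b ∈ V'`, whence `‖Ce - Cb‖ ≥ |μ| ≥ r`. The remaining vectors come
from `V'` by induction. -/
theorem exists_separated_finset {C : X →L[ℂ] X} {r : ℝ} (n : ℕ) :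
    ∀ V : Submodule ℂ X, FiniteDimensional ℂ V → finrank ℂ V = n → (∀ x ∈ V, C x ∈ V) →
      (∀ (μ : ℂ) (x : X), x ∈ V → x ≠ 0 → C x = μ • x → r ≤ ‖μ‖) →
      ∃ s : Finset X, s.card = n ∧ (∀ e ∈ s, e ∈ V ∧ ‖e‖ = 1) ∧
        ∀ a ∈ s, ∀ b ∈ s, a ≠ b → r ≤ ‖C a - C b‖ := by
  classical
  induction n with
  | zero =>
    intro V _ _ _ _
    exact ⟨∅, by simp⟩
  | succ n ih =>
    intro V hV hn hinv heig
    have : Nontrivial V := Module.nontrivial_of_finrank_pos (R := ℂ) (by omega)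
    set T : End ℂ V := (C : X →ₗ[ℂ] X).restrict hinv with hT
    obtain ⟨μ, hμ⟩ := Module.End.exists_eigenvalue T
    have hr : r ≤ ‖μ‖ := by
      obtain ⟨x, hx⟩ := hμ.exists_hasEigenvector
      exact heig μ x x.2 (by simpa using hx.2) (congrArg Subtype.val hx.apply_eq_smul)
    have hlt : LinearMap.range (T - μ • (1 : End ℂ V)) < ⊤ := by
      rw [lt_top_iff_ne_top]
      intro htop
      have hinj := LinearMap.injective_iff_surjective.2 (LinearMap.range_eq_top.1 htop)
      obtain ⟨x, hx⟩ := hμ.exists_hasEigenvector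
      refine hx.2 (hinj ?_)
      simp [hx.apply_eq_smul]
    obtain ⟨l, hl0, hl⟩ := Submodule.exists_le_ker_of_lt_top _ hlt
    have hdim : finrank ℂ (LinearMap.ker l) = n := by
      have h1 := Module.Dual.finrank_ker_add_one_of_ne_zero (f := l) hl0
      omega
    set V' : Submodule ℂ X := (LinearMap.ker l).map V.subtype with hV'
    have hV'fd : FiniteDimensional ℂ V' := by rw [hV']; infer_instance
    have hV'dim : finrank ℂ V' = n := by
      rw [← hdim]
      exact (Submodule.equivMapOfInjective V.subtype V.injective_subtype _).finrank_eq.symm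
    have hstep : ∀ x : V, C x - μ • (x : X) ∈ V' := fun x =>
      ⟨(T - μ • (1 : End ℂ V)) x, hl ⟨x, rfl⟩, rfl⟩
    have hle : V' ≤ V := by
      rintro _ ⟨x, -, rfl⟩
      exact x.2
    have hinv' : ∀ x ∈ V', C x ∈ V' := by
      intro x hx
      have h1 := V'.add_mem (hstep ⟨x, hle hx⟩) (V'.smul_mem μ hx)
      simpa using h1
    obtain ⟨s, hs, hs1, hs2⟩ := ih V' hV'fd hV'dim hinv'
      fun μ x hx => heig μ x (hle hx)
    obtain ⟨e, heV, he1, heo⟩ : ∃ e ∈ V, ‖e‖ = 1 ∧ ∀ y ∈ V', inner ℂ y e = 0 := by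
      obtain ⟨x, hx⟩ : ∃ x : V, l x ≠ 0 := by
        by_contra! h
        exact hl0 (LinearMap.ext h)
      have hxV' : (x : X) ∉ V' := by
        rintro ⟨y, hy, hyx⟩
        obtain rfl : y = x := Subtype.ext hyx
        exact hx hy
      set p : X := x - V'.starProjection x with hp
      have hp0 : p ≠ 0 := by
        intro h
        apply hxV'
        rw [sub_eq_zero.1 h]
        exact V'.starProjection_apply_mem _
      have hpV : p ∈ V := V.sub_mem x.2 (hle (V'.starProjection_apply_mem _))
      refine ⟨((‖p‖ : ℂ)⁻¹) • p, V.smul_mem _ hpV, ?_, fun y hy => ?_⟩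
      · rw [norm_smul, norm_inv, Complex.norm_real, norm_norm, inv_mul_cancel₀ (by simpa using hp0)]
      · rw [inner_smul_right, (Submodule.mem_orthogonal _ _).1
          (V'.sub_starProjection_mem_orthogonal (x : X)) y hy, mul_zero]
    have hes : e ∉ s := by
      intro h
      have h1 := heo e (hs1 e h).1
      rw [inner_self_eq_zero] at h1
      rw [h1, norm_zero] at he1
      exact zero_ne_one he1
    have hsep : ∀ b ∈ V', r ≤ ‖C e - C b‖ := by
      intro b hb
      have h1 : C e - C b - μ • e ∈ V' := by
        have := V'.sub_mem (hstep ⟨e, heV⟩) (hinv' b hb)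
        convert this using 1
        simp only
        abel
      have h2 : inner ℂ e (C e - C b - μ • e) = 0 := by
        rw [← inner_conj_symm, heo _ h1, map_zero]
      rw [inner_sub_right, inner_smul_right, inner_self_eq_norm_sq_to_K, he1, sub_eq_zero] at h2
      simp only [RCLike.ofReal_one, one_pow, mul_one] at h2
      calc r ≤ ‖μ‖ := hr
        _ = ‖inner ℂ e (C e - C b)‖ := by rw [h2]
        _ ≤ ‖e‖ * ‖C e - C b‖ := norm_inner_le_norm _ _
        _ = _ := by rw [he1, one_mul]
    refine ⟨insert e s, by rw [Finset.card_insert_of_notMem hes, hs], ?_, ?_⟩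
    · intro x hx
      rcases Finset.mem_insert.1 hx with rfl | hx
      · exact ⟨heV, he1⟩
      · exact ⟨hle (hs1 x hx).1, (hs1 x hx).2⟩
    · intro a ha b hb hab
      rcases Finset.mem_insert.1 ha with rfl | ha' <;> rcases Finset.mem_insert.1 hb with rfl | hb'
      · exact absurd rfl hab
      · exact hsep b (hs1 b hb').1
      · rw [norm_sub_rev]; exact hsep a (hs1 a ha').1
      · exact hs2 a ha' b hb' hab

/-- The dimension of an invariant subspace on which all eigenvalues of a compact operator are at
least `r` in modulus is bounded. -/
theorem exists_finrank_bound {C : X →L[ℂ] X} (hC : IsCompactOperator C) {r : ℝ} (hr : 0 < r) :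
    ∃ N : ℕ, ∀ V : Submodule ℂ X, FiniteDimensional ℂ V → (∀ x ∈ V, C x ∈ V) →
      (∀ (μ : ℂ) (x : X), x ∈ V → x ≠ 0 → C x = μ • x → r ≤ ‖μ‖) → finrank ℂ V ≤ N := by
  obtain ⟨K, hK, hKs⟩ := IsCompactOperator.image_closedBall_subset_compact (𝕜₁ := ℂ)
    (f := (C : X →ₗ[ℂ] X)) hC 1
  -- Images that are `r` apart cannot share a ball of radius `r / 2`, so the number of balls bounds
  -- the dimension.
  obtain ⟨t, -, htf, htc⟩ := hK.finite_cover_balls (e := r / 2) (by positivity)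
  refine ⟨htf.toFinset.card, fun V hV hinv heig => ?_⟩
  obtain ⟨s, hs, hs1, hs2⟩ := exists_separated_finset (C := C) (r := r) _ V hV rfl hinv heig
  rw [← hs]
  have h1 : ∀ e ∈ s, ∃ c ∈ t, C e ∈ Metric.ball c (r / 2) := by
    intro e he
    have h2 : C e ∈ K := hKs ⟨e, by simp [(hs1 e he).2], rfl⟩
    simpa using htc h2
  choose! f hf hf' using h1
  refine Finset.card_le_card_of_injOn f (fun e he => by simpa using hf e he) ?_
  intro a ha b hb hab
  by_contra hne
  have h3 := hs2 a ha b hb hne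
  have h4 := hf' a ha
  have h5 := hf' b hb
  rw [hab] at h4
  rw [Metric.mem_ball] at h4 h5
  have h6 := dist_triangle_right (C a) (C b) (f b)
  rw [dist_eq_norm] at h6
  linarith

theorem pow_apply_of_apply_eq_smul {T : End ℂ X} {a : ℂ} {x : X} (h : T x = a • x) (n : ℕ) :
    (T ^ n) x = a ^ n • x := by
  induction n with
  | zero => simp
  | succ n ih => rw [pow_succ', Module.End.mul_apply, ih, map_smul, h, smul_smul, pow_succ]

/-- A finite independent family in the generalized eigenspace is killed by one power `(C - μ)^k`.
The vectors `(C - μ)^j x` with `j < k` span a finite-dimensional invariant subspace on which `μ` is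
the only possible eigenvalue, so `exists_finrank_bound` limits the size of the family uniformly. -/
theorem finiteDimensional_maxGenEigenspace {C : X →L[ℂ] X} (hC : IsCompactOperator C) {μ : ℂ}
    (hμ : μ ≠ 0) : FiniteDimensional ℂ (maxGenEigenspace (C : End ℂ X) μ) := by
  classical
  obtain ⟨N, hN⟩ := exists_finrank_bound hC (norm_pos_iff.2 hμ)
  set T : End ℂ X := (C : End ℂ X) - μ • 1 with hT
  refine Module.rank_lt_aleph0_iff.1 (lt_of_le_of_lt (rank_le (n := N) ?_) Cardinal.natCast_lt_aleph0)
  intro s hs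
  obtain ⟨k, hk⟩ : ∃ k : ℕ, ∀ x ∈ s, (T ^ k) (x : X) = 0 := by
    have h1 : ∀ x : maxGenEigenspace (C : End ℂ X) μ, ∃ k : ℕ, (T ^ k) (x : X) = 0 := fun x =>
      (mem_maxGenEigenspace _ _ _).1 x.2
    choose f hf using h1
    refine ⟨s.sup f, fun x hx => ?_⟩
    obtain ⟨j, hj⟩ := Nat.exists_eq_add_of_le (Finset.le_sup (f := f) hx)
    rw [hj, add_comm, pow_add, Module.End.mul_apply, hf, map_zero]
  set S : Set X := Set.range (fun p : s × Fin k => (T ^ (p.2 : ℕ)) ((p.1 : _) : X)) with hS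
  have hSfin : S.Finite := Set.finite_range _
  set V := Submodule.span ℂ S with hV
  have hVfd : FiniteDimensional ℂ V := FiniteDimensional.span_of_finite ℂ hSfin
  have hkill : ∀ x ∈ V, (T ^ k) x = 0 := by
    intro x hx
    refine Submodule.span_induction ?_ (map_zero _) (fun x y _ _ h1 h2 => by rw [map_add, h1, h2,
      add_zero]) (fun a x _ h => by rw [map_smul, h, smul_zero]) hx
    rintro _ ⟨⟨x, j⟩, rfl⟩
    rw [← Module.End.mul_apply, ← pow_add, add_comm, pow_add, Module.End.mul_apply, hk _ x.2, map_zero]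
  have hTinv : ∀ x ∈ V, T x ∈ V := by
    intro x hx
    refine Submodule.span_induction ?_ (by rw [map_zero]; exact V.zero_mem)
      (fun x y _ _ h1 h2 => by rw [map_add]; exact V.add_mem h1 h2)
      (fun a x _ h => by rw [map_smul]; exact V.smul_mem _ h) hx
    rintro _ ⟨⟨x, j⟩, rfl⟩
    rw [← Module.End.mul_apply, ← pow_succ']
    by_cases hj : (j : ℕ) + 1 < k
    · exact Submodule.subset_span ⟨⟨x, ⟨j + 1, hj⟩⟩, rfl⟩
    · have : (j : ℕ) + 1 = k := by omega
      rw [this, hk _ x.2]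
      exact V.zero_mem
  have hCT : ∀ x, C x = T x + μ • x := fun x => by simp [hT]
  have hfin := hN V hVfd (fun x hx => by
    rw [hCT]; exact V.add_mem (hTinv x hx) (V.smul_mem _ hx)) (by
    intro ν x hx hx0 hν
    have h1 : T x = (ν - μ) • x := by
      rw [sub_smul, ← hν, hCT]; abel
    have h2 := hkill x hx
    rw [pow_apply_of_apply_eq_smul h1] at h2
    have h3 : (ν - μ) ^ k = 0 := (smul_eq_zero.1 h2).resolve_right hx0
    have h4 : ν = μ := by
      by_contra h
      exact pow_ne_zero k (sub_ne_zero.2 h) h3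
    rw [h4])
  refine le_trans ?_ hfin
  have hli : LinearIndependent ℂ (fun i : s => ((i : maxGenEigenspace (C : End ℂ X) μ) : X)) :=
    hs.map' (Submodule.subtype _) (Submodule.ker_subtype _)
  have hmem : ∀ i : s, ((i : maxGenEigenspace (C : End ℂ X) μ) : X) ∈ V := by
    intro i
    rcases Nat.eq_zero_or_pos k with hk0 | hk0
    · have := hk _ i.2
      rw [hk0, pow_zero] at this
      rw [show ((i : maxGenEigenspace (C : End ℂ X) μ) : X) = 0 from this]
      exact V.zero_mem
    · exact Submodule.subset_span ⟨⟨i, ⟨0, hk0⟩⟩, by simp⟩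
  have hli' : LinearIndependent ℂ (fun i : s => (⟨_, hmem i⟩ : V)) :=
    LinearIndependent.of_comp V.subtype hli
  simpa using hli'.fintype_card_le_finrank

/-- A preimage of a generalized eigenvector is again one. So `C - μ` maps the finite-dimensional
generalized eigenspace onto itself, hence injectively, and the kernel is contained in that space. -/
theorem injective_of_surjective {C : X →L[ℂ] X} (hC : IsCompactOperator C) {μ : ℂ}
    (hμ : μ ≠ 0) (hs : Function.Surjective ((C : End ℂ X) - μ • (1 : End ℂ X))) :
    Function.Injective ((C : End ℂ X) - μ • (1 : End ℂ X)) := by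
  have := finiteDimensional_maxGenEigenspace hC hμ
  set T : End ℂ X := (C : End ℂ X) - μ • 1 with hT
  set G := maxGenEigenspace (C : End ℂ X) μ with hG
  have hmem : ∀ x, x ∈ G ↔ ∃ k : ℕ, (T ^ k) x = 0 := fun x => mem_maxGenEigenspace _ _ _
  have hGinv : ∀ x ∈ G, T x ∈ G := by
    intro x hx
    obtain ⟨k, hk⟩ := (hmem x).1 hx
    exact (hmem _).2 ⟨k, by rw [← Module.End.mul_apply, ← pow_succ, pow_succ', Module.End.mul_apply, hk,
      map_zero]⟩
  have hsurj : Function.Surjective (T.restrict hGinv) := by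
    rintro ⟨y, hy⟩
    obtain ⟨x, rfl⟩ := hs y
    obtain ⟨k, hk⟩ := (hmem _).1 hy
    exact ⟨⟨x, (hmem _).2 ⟨k + 1, by rw [pow_succ, Module.End.mul_apply, hk]⟩⟩, rfl⟩
  have hinj := LinearMap.injective_iff_surjective.2 hsurj
  rw [injective_iff_map_eq_zero]
  intro x hx
  have hxG : x ∈ G := (hmem x).2 ⟨1, by simpa using hx⟩
  have h1 : (⟨x, hxG⟩ : G) = 0 := hinj (by rw [map_zero]; exact Subtype.ext hx)
  exact congrArg Subtype.val h1

/-- Eigenvectors for `N + 1` such eigenvalues would span an invariant subspace of dimension `N + 1`.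
The polynomial `∏ (X - μ)` annihilates that span, so no other eigenvalue occurs there, contradicting
`exists_finrank_bound`. -/
theorem finite_eigenvalues {C : X →L[ℂ] X} (hC : IsCompactOperator C) {r : ℝ} (hr : 0 < r) :
    {μ : ℂ | r ≤ ‖μ‖ ∧ ∃ x, x ≠ 0 ∧ C x = μ • x}.Finite := by
  classical
  obtain ⟨N, hN⟩ := exists_finrank_bound hC hr
  by_contra hinf
  obtain ⟨s, hsS, hsc⟩ := Set.Infinite.exists_subset_card_eq hinf (N + 1)
  have h1 : ∀ μ : s, ∃ x, x ≠ 0 ∧ C x = (μ : ℂ) • x := fun μ => (hsS μ.2).2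
  choose x hx0 hx using h1
  have hli : LinearIndependent ℂ x :=
    eigenvectors_linearIndependent' (C : End ℂ X) (fun μ : s => (μ : ℂ)) Subtype.val_injective x
      fun μ => hasEigenvector_iff.2 ⟨mem_eigenspace_iff.2 (hx μ), hx0 μ⟩
  set V := Submodule.span ℂ (Set.range x) with hV
  have hfin := hN V (FiniteDimensional.span_of_finite ℂ (Set.finite_range x)) (by
    intro y hy
    refine Submodule.span_induction ?_ (by rw [map_zero]; exact V.zero_mem)
      (fun x y _ _ h1 h2 => by rw [map_add]; exact V.add_mem h1 h2)
      (fun a x _ h => by rw [map_smul]; exact V.smul_mem _ h) hy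
    rintro _ ⟨μ, rfl⟩
    rw [hx]
    exact V.smul_mem _ (Submodule.subset_span ⟨μ, rfl⟩)) (by
    intro ν y hy hy0 hν
    set p : Polynomial ℂ := ∏ μ : s, (Polynomial.X - Polynomial.C (μ : ℂ)) with hp
    have hkill : ∀ y ∈ V, (Polynomial.aeval (C : End ℂ X) p) y = 0 := by
      intro y hy
      refine Submodule.span_induction ?_ (map_zero _) (fun x y _ _ h1 h2 => by rw [map_add, h1, h2,
        add_zero]) (fun a x _ h => by rw [map_smul, h, smul_zero]) hy
      rintro _ ⟨μ, rfl⟩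
      rw [aeval_apply_of_hasEigenvector
        (hasEigenvector_iff.2 ⟨mem_eigenspace_iff.2 (hx μ), hx0 μ⟩)]
      have : p.eval (μ : ℂ) = 0 := by
        rw [hp, Polynomial.eval_prod]
        exact Finset.prod_eq_zero (Finset.mem_univ μ) (by simp)
      rw [this, zero_smul]
    have h2 := hkill y hy
    rw [aeval_apply_of_hasEigenvector
        (hasEigenvector_iff.2 ⟨mem_eigenspace_iff.2 hν, hy0⟩)] at h2
    have h3 := (smul_eq_zero.1 h2).resolve_right hy0
    rw [hp, Polynomial.eval_prod, Finset.prod_eq_zero_iff] at h3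
    obtain ⟨μ, -, h4⟩ := h3
    simp only [Polynomial.eval_sub, Polynomial.eval_X, Polynomial.eval_C, sub_eq_zero] at h4
    rw [h4]
    exact (hsS μ.2).1)
  rw [hV, finrank_span_eq_card hli, Fintype.card_coe, hsc] at hfin
  omega

end Compact

open Module Module.End

/-! ### Fredholm index zero for compact perturbations of scalars -/

section Index

variable {X : Type*} [NormedAddCommGroup X] [InnerProductSpace ℂ X] [CompleteSpace X]

theorem surjective_of_injective_sub {C : X →L[ℂ] X} (hC : IsCompactOperator C) {μ : ℂ}
    (hμ : μ ≠ 0) (h : ∀ x, C x = μ • x → x = 0) (y : X) : ∃ x, C x - μ • x = y := by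
  have h1 := (hC.hasEigenvalue_or_mem_resolventSet hμ).resolve_left (by
    intro h2
    obtain ⟨x, hx⟩ := h2.exists_hasEigenvector
    exact hx.2 (h x hx.apply_eq_smul))
  rw [_root_.spectrum.mem_resolventSet_iff] at h1
  obtain ⟨u, hu⟩ := h1
  refine ⟨-((↑u⁻¹ : X →L[ℂ] X) y), ?_⟩
  have h3 : (↑u * ↑u⁻¹ : X →L[ℂ] X) y = y := by rw [Units.mul_inv]; rfl
  rw [hu] at h3
  have h4 : μ • ((↑u⁻¹ : X →L[ℂ] X) y) - C ((↑u⁻¹ : X →L[ℂ] X) y) = y := h3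
  rw [map_neg, smul_neg, neg_sub_neg]
  exact h4

omit [CompleteSpace X] in
theorem isCompactOperator_sub_finiteRank {C : X →L[ℂ] X} (hC : IsCompactOperator C)
    {N W : Submodule ℂ X} [FiniteDimensional ℂ N] [FiniteDimensional ℂ W] (P : X →L[ℂ] N)
    (j : N →ₗ[ℂ] W) :
    IsCompactOperator (C - W.subtypeL ∘L j.toContinuousLinearMap ∘L P : X →L[ℂ] X) := by
  have : ProperSpace W := FiniteDimensional.proper ℂ W
  have h1 : IsCompactOperator (j.toContinuousLinearMap ∘L P : X →L[ℂ] W) :=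
    isCompactOperator_of_locallyCompactSpace_dom (j.toContinuousLinearMap ∘L P)
  exact hC.sub (h1.clm_comp W.subtypeL)

/-- A compact perturbation of a nonzero multiple of the identity is Fredholm of index zero. -/
theorem fredholm_index_zero {C : X →L[ℂ] X} (hC : IsCompactOperator C) {μ : ℂ} (hμ : μ ≠ 0)
    {T : X →ₗ[ℂ] X} (hT : ∀ x, T x = C x - μ • x) :
    FiniteDimensional ℂ (LinearMap.ker T) ∧ IsClosed (LinearMap.range T : Set X) ∧
      FiniteDimensional ℂ (X ⧸ LinearMap.range T) ∧
      finrank ℂ (LinearMap.ker T) = finrank ℂ (X ⧸ LinearMap.range T) := by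
  have := finiteDimensional_maxGenEigenspace hC hμ
  set N := LinearMap.ker T with hN
  have hTeq : T = (C : End ℂ X) - μ • (1 : End ℂ X) := LinearMap.ext fun x => by simp [hT]
  have hNfd : FiniteDimensional ℂ N := by
    refine Submodule.finiteDimensional_of_le (S₂ := maxGenEigenspace (C : End ℂ X) μ) ?_
    intro x hx
    refine (mem_maxGenEigenspace _ _ _).2 ⟨1, ?_⟩
    rw [pow_one, ← hTeq]
    exact hx
  set P : X →L[ℂ] N := N.orthogonalProjectionOnto with hP
  have hPN : ∀ x : N, P x = x := fun x => N.orthogonalProjectionOnto_mem_subspace_eq_self x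
  have hmod : ∀ (W : Submodule ℂ X) [FiniteDimensional ℂ W] (j : N →ₗ[ℂ] W) (x : X),
      (C - W.subtypeL ∘L j.toContinuousLinearMap ∘L P : X →L[ℂ] X) x - μ • x =
        T x - j (P x) := by
    intro W _ j x
    rw [hT]
    change C x - (j (P x) : X) - μ • x = _
    abel
  -- The modified operator `T - jP` is again compact minus `μ`. When `W` misses the range of `T`, an
  -- injective `j` sends the kernel `N` injectively outside that range and makes the modified
  -- operator injective.
  have hzero : ∀ (W : Submodule ℂ X), Disjoint W (LinearMap.range T) → ∀ (j : N →ₗ[ℂ] W),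
      Function.Injective j → ∀ x, T x - j (P x) = 0 → x = 0 := by
    intro W hW j hj x hx
    have h1 : T x = 0 := by
      refine Submodule.disjoint_def.1 hW _ ?_ ⟨x, rfl⟩
      rw [sub_eq_zero.1 hx]
      exact (j (P x)).2
    rw [h1, zero_sub, neg_eq_zero] at hx
    have h2 : P x = 0 := hj (by rw [map_zero]; exact Subtype.ext hx)
    have h3 := hPN ⟨x, h1⟩
    simp only at h3
    rw [h2] at h3
    exact (congrArg Subtype.val h3).symm
  have hle : ∀ (W : Submodule ℂ X), FiniteDimensional ℂ W → Disjoint W (LinearMap.range T) →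
      finrank ℂ W ≤ finrank ℂ N := by
    intro W _ hW
    by_contra! hlt
    obtain ⟨j, hj⟩ := Module.Free.exists_linearMap_injective_of_rank_lt (R := ℂ) (M := N) (N := W) (by
      rw [← finrank_eq_rank, ← finrank_eq_rank]; exact_mod_cast hlt)
    -- If `dim W > dim N`, then `T - jP` is injective, hence surjective. Solving `Tx - jPx = w` with
    -- `w ∈ W` forces `Tx = 0`, so `j` would be onto `W`, which is impossible by dimension.
    have hsub : LinearMap.range j = ⊤ := by
      rw [eq_top_iff]
      rintro w -
      obtain ⟨x, hx⟩ := surjective_of_injective_sub (isCompactOperator_sub_finiteRank hC P j) hμ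
        (fun x hx => hzero W hW j hj x (by rw [← hmod, hx, sub_self])) (w : X)
      rw [hmod] at hx
      have h1 : T x = 0 := by
        refine Submodule.disjoint_def.1 hW _ ?_ ⟨x, rfl⟩
        rw [sub_eq_iff_eq_add.1 hx]
        exact W.add_mem w.2 (j (P x)).2
      rw [h1, zero_sub] at hx
      exact ⟨-P x, Subtype.ext (by simpa using hx)⟩
    have h2 := LinearMap.finrank_range_of_inj hj
    rw [hsub, finrank_top] at h2
    omega
  obtain ⟨W, hW⟩ := Submodule.exists_isCompl (LinearMap.range T)
  have hWfd : FiniteDimensional ℂ W := by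
    refine Module.rank_lt_aleph0_iff.1
      (lt_of_le_of_lt (rank_le (n := finrank ℂ N) ?_) Cardinal.natCast_lt_aleph0)
    intro s hs
    set W' : Submodule ℂ X := (Submodule.span ℂ (Set.range fun i : s => (i : W))).map W.subtype
    have hfd1 : FiniteDimensional ℂ (Submodule.span ℂ (Set.range fun i : s => (i : W))) :=
      FiniteDimensional.span_of_finite ℂ (Set.finite_range _)
    have h1 : finrank ℂ W' = s.card := by
      rw [← (Submodule.equivMapOfInjective W.subtype W.injective_subtype _).finrank_eq,
        finrank_span_eq_card hs, Fintype.card_coe]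
    rw [← h1]
    refine hle W' (by infer_instance) (hW.disjoint.symm.mono_left ?_)
    rintro _ ⟨x, -, rfl⟩
    exact x.2
  have hWle := hle W hWfd hW.disjoint.symm
  have heq : finrank ℂ N = finrank ℂ W := by
    by_contra hne
    obtain ⟨i, hi⟩ := Module.Free.exists_linearMap_injective_of_rank_lt (R := ℂ) (M := W) (N := N) (by
      rw [← finrank_eq_rank, ← finrank_eq_rank]
      exact_mod_cast lt_of_le_of_ne hWle (Ne.symm hne))
    -- If `dim W < dim N`, take a surjective `j : N → W`. As `W` complements the range of `T`, the
    -- operator `T - jP` is surjective, hence injective; but on `N` it equals `-j`, so `j` would be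
    -- injective as well.
    obtain ⟨j, hj⟩ := LinearMap.exists_leftInverse_of_injective i (LinearMap.ker_eq_bot.2 hi)
    have hjs : Function.Surjective j := fun w => ⟨i w, LinearMap.congr_fun hj w⟩
    have hinj := injective_of_surjective (isCompactOperator_sub_finiteRank hC P j) hμ (by
      intro y
      obtain ⟨_, ⟨x, rfl⟩, w, hw, hxw⟩ := Submodule.mem_sup.1
        (show y ∈ LinearMap.range T ⊔ W by rw [hW.sup_eq_top]; trivial)
      obtain ⟨ν, hν⟩ := hjs (-⟨w, hw⟩ - j (P x))
      refine ⟨x + ν, ?_⟩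
      have h1 := hmod W j (x + ν)
      have h2 : T (ν : X) = 0 := ν.2
      rw [map_add T, h2, map_add P, hPN, map_add j, hν] at h1
      refine h1.trans ?_
      rw [← hxw]
      simp)
    have hjinj : Function.Injective j := by
      rw [injective_iff_map_eq_zero]
      intro ν hν
      refine Subtype.ext (hinj ?_)
      have h1 := hmod W j (ν : X)
      have h2 : T (ν : X) = 0 := ν.2
      rw [h2, hPN, hν] at h1
      refine h1.trans ?_
      simp
    have := LinearMap.finrank_le_finrank_of_injective hjinj
    omega
  refine ⟨hNfd, ?_, ?_, ?_⟩
  · let j := LinearEquiv.ofFinrankEq N W heq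
    set L : X →L[ℂ] X := C - W.subtypeL ∘L (j : N →ₗ[ℂ] W).toContinuousLinearMap ∘L P -
      μ • ContinuousLinearMap.id ℂ X with hL
    have hLapp : ∀ x, L x = T x - j (P x) := fun x => hmod W j x
    have hLinj : LinearMap.ker (L : X →ₗ[ℂ] X) = ⊥ := by
      rw [LinearMap.ker_eq_bot']
      intro x hx
      exact hzero W hW.disjoint.symm j j.injective x ((hLapp x).symm.trans hx)
    have hLsurj : LinearMap.range (L : X →ₗ[ℂ] X) = ⊤ := by
      rw [LinearMap.range_eq_top]
      exact surjective_of_injective_sub (isCompactOperator_sub_finiteRank hC P (j : N →ₗ[ℂ] W)) hμ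
        (fun x hx => hzero W hW.disjoint.symm j j.injective x
          ((hmod W j x).symm.trans (by rw [hx, sub_self])))
    let e := ContinuousLinearEquiv.ofBijective L hLinj hLsurj
    -- `T` and the isomorphism `e = T - jP` agree on `Nᗮ`, and `T` already attains its whole range
    -- there; so the range is the homeomorphic image of a closed subspace.
    have himg : (LinearMap.range T : Set X) = e '' (Nᗮ : Set X) := by
      have hPo : ∀ x ∈ Nᗮ, P x = 0 := fun x hx =>
        N.orthogonalProjectionOnto_apply_of_mem_orthogonal hx
      ext y
      constructor
      · rintro ⟨x, rfl⟩
        refine ⟨x - P x, N.sub_starProjection_mem_orthogonal x, ?_⟩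
        change L _ = _
        have h2 : T (P x : X) = 0 := (P x).2
        have h3 : P (x - (P x : X)) = 0 := by rw [map_sub, hPN, sub_self]
        rw [hLapp, h3, map_sub, h2]
        simp
      · rintro ⟨x, hx, rfl⟩
        refine ⟨x, ?_⟩
        change _ = L x
        rw [hLapp, hPo x hx]
        simp
    rw [himg]
    exact e.toHomeomorph.isClosedMap _ N.isClosed_orthogonal
  · exact (Submodule.quotientEquivOfIsCompl _ _ hW).symm.finiteDimensional
  · rw [heq]
    exact (Submodule.quotientEquivOfIsCompl _ _ hW).symm.finrank_eq

end Index

open Module Module.End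

/-! ### Pencils with a compact resolvent -/

section CompactPencil

variable {X : Type*} [NormedAddCommGroup X] [InnerProductSpace ℂ X]

/-- `R` is the inverse of `z₀ B - A`, and `K = B R` is compact. -/
structure IsCompactResolvent (A B : X →ₗ.[ℂ] X) (z0 : ℂ) (R K : X →L[ℂ] X) : Prop where
  mem_graph_iff : ∀ v f, (v, f) ∈ (z0 • B - A).graph ↔ v = R f
  mem_graph : ∀ f, (R f, K f) ∈ B.graph
  isCompactOperator : IsCompactOperator K

namespace IsCompactResolvent

variable {A B : X →ₗ.[ℂ] X} {z0 : ℂ} {R K : X →L[ℂ] X} (h : IsCompactResolvent A B z0 R K)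
include h

theorem injective {u : X} (hu : R u = 0) : u = 0 := by
  have h1 := (h.mem_graph_iff (R u) u).2 rfl
  rw [hu] at h1
  exact LinearPMap.graph_fst_eq_zero_snd _ h1 rfl

/-- `zB - A = (z₀B - A) + (z - z₀)B`, and applying this to `v = Ru` gives `u + (z - z₀)Ku`. The
parametrization by `u` replaces the unbounded pencil by `1 + (z - z₀)K`. -/
theorem mem_graph_sub_iff {z : ℂ} {v f : X} :
    (v, f) ∈ (z • B - A).graph ↔ ∃ u, v = R u ∧ f = u + (z - z0) • K u := by
  constructor
  · intro hv
    obtain ⟨_, a, hb', ha, rfl⟩ := mem_graph_sub.1 hv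
    obtain ⟨b, hb, rfl⟩ := mem_graph_smul.1 hb'
    have h1 : (v, z0 • b - a) ∈ (z0 • B - A).graph :=
      mem_graph_sub.2 ⟨_, _, mem_graph_smul.2 ⟨b, hb, rfl⟩, ha, rfl⟩
    have h2 := (h.mem_graph_iff _ _).1 h1
    have h3 : K (z0 • b - a) = b := B.mem_graph_snd_inj (h.mem_graph _) hb h2.symm
    refine ⟨_, h2, ?_⟩
    rw [h3, sub_smul]
    abel
  · rintro ⟨u, rfl, rfl⟩
    have h1 := (h.mem_graph_iff (R u) u).2 rfl
    obtain ⟨_, a, hb', ha, h2⟩ := mem_graph_sub.1 h1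
    obtain ⟨b, hb, rfl⟩ := mem_graph_smul.1 hb'
    have h3 : K u = b := B.mem_graph_snd_inj (h.mem_graph _) hb rfl
    refine mem_graph_sub.2 ⟨_, _, mem_graph_smul.2 ⟨b, hb, rfl⟩, ha, ?_⟩
    rw [h3, sub_smul]
    nth_rw 1 [h2]
    abel

omit h in
/-- The operator `1 + (z - z₀) K`. -/
def shifted (K : X →L[ℂ] X) (s : ℂ) : X →ₗ[ℂ] X := LinearMap.id + s • (K : X →ₗ[ℂ] X)

omit h in
theorem shifted_apply (K : X →L[ℂ] X) (s : ℂ) (u : X) : shifted K s u = u + s • K u := rfl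

theorem index_zero [CompleteSpace X] (s : ℂ) :
    FiniteDimensional ℂ (LinearMap.ker (shifted K s)) ∧
      IsClosed (LinearMap.range (shifted K s) : Set X) ∧
      FiniteDimensional ℂ (X ⧸ LinearMap.range (shifted K s)) ∧
      finrank ℂ (LinearMap.ker (shifted K s)) = finrank ℂ (X ⧸ LinearMap.range (shifted K s)) := by
  have h1 : IsCompactOperator (s • K : X →L[ℂ] X) := h.isCompactOperator.smul s
  refine fredholm_index_zero h1 (μ := -1) (by norm_num) fun x => ?_
  rw [shifted_apply]
  simp [add_comm]

/-- The pencil has the same range as `1 + (z - z₀)K`, and `R` identifies the two kernels, so the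
index is inherited. -/
theorem isFredholm [CompleteSpace X] (z : ℂ) :
    IsFredholm (z • B - A) ∧ fredholmIndex (z • B - A) = 0 := by
  obtain ⟨h1, h2, h3, h4⟩ := h.index_zero (z - z0)
  have hrange : LinearMap.range (z • B - A).toFun = LinearMap.range (shifted K (z - z0)) := by
    ext f
    constructor
    · rintro ⟨x, rfl⟩
      obtain ⟨u, -, hu⟩ := h.mem_graph_sub_iff.1 ((z • B - A).mem_graph x)
      exact ⟨u, hu.symm⟩
    · rintro ⟨u, rfl⟩
      obtain ⟨x, -, hx⟩ := (LinearPMap.mem_graph_iff _).1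
        ((h.mem_graph_sub_iff (z := z)).2 ⟨u, rfl, rfl⟩)
      exact ⟨x, hx⟩
  have hdom : ∀ u, R u ∈ (z • B - A).domain := fun u =>
    LinearPMap.mem_domain_of_mem_graph ((h.mem_graph_sub_iff (z := z)).2 ⟨u, rfl, rfl⟩)
  have happ : ∀ u, (z • B - A) ⟨R u, hdom u⟩ = shifted K (z - z0) u := fun u =>
    LinearPMap.mem_graph_snd_inj _ ((z • B - A).mem_graph ⟨R u, hdom u⟩)
      ((h.mem_graph_sub_iff (z := z)).2 ⟨u, rfl, rfl⟩) rfl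
  let F : LinearMap.ker (shifted K (z - z0)) →ₗ[ℂ] LinearMap.ker (z • B - A).toFun :=
    { toFun := fun u => ⟨⟨R u, hdom u⟩, (happ u).trans u.2⟩
      map_add' := fun u w => Subtype.ext (Subtype.ext (map_add R _ _))
      map_smul' := fun a u => Subtype.ext (Subtype.ext (map_smul R _ _)) }
  have hF : Function.Bijective F := by
    constructor
    · rw [injective_iff_map_eq_zero]
      intro u hu
      exact Subtype.ext (h.injective (congrArg (fun x => (x.1 : X)) hu))
    · rintro ⟨x, hx⟩
      have h5 := (z • B - A).mem_graph x
      rw [show (z • B - A) x = 0 from hx] at h5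
      obtain ⟨u, hu, hu0⟩ := h.mem_graph_sub_iff.1 h5
      exact ⟨⟨u, hu0.symm⟩, Subtype.ext (Subtype.ext hu.symm)⟩
  let e := LinearEquiv.ofBijective F hF
  refine ⟨⟨e.finiteDimensional, ?_, ?_⟩, ?_⟩
  · rw [hrange]; exact h2
  · rw [hrange]; exact h3
  · rw [fredholmIndex, hrange, ← e.finrank_eq, h4, sub_self]

theorem spectrum_eq_pointSpectrum [CompleteSpace X] : spectrum A B = pointSpectrum A B := by
  have : essentialSpectrum A B = ∅ := by
    ext z
    simp [essentialSpectrum, h.isFredholm z]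
  rw [pointSpectrum, this, Set.sdiff_empty]

/-- The map `z ↦ -(z - z₀)⁻¹` transfers eigenvalues of the pencil to nonzero eigenvalues of `K`. -/
theorem exists_eigenvector_of_isEigenvalue {z : ℂ} (hz : IsEigenvalue A B z) :
    z ≠ z0 ∧ ∃ u, u ≠ 0 ∧ K u = (-(z - z0)⁻¹) • u := by
  obtain ⟨v, hv, h0⟩ := isEigenvalue_iff.1 hz
  obtain ⟨u, rfl, hu⟩ := h.mem_graph_sub_iff.1 h0
  have hu0 : u ≠ 0 := by
    rintro rfl
    exact hv (map_zero R)
  have hne : z ≠ z0 := by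
    rintro rfl
    rw [sub_self, zero_smul, add_zero] at hu
    exact hu0 hu.symm
  refine ⟨hne, u, hu0, ?_⟩
  have h1 : (z - z0) • K u = -u := eq_neg_of_add_eq_zero_right hu.symm
  rw [neg_smul, ← smul_neg, ← h1, inv_smul_smul₀ (sub_ne_zero.2 hne)]

/-- Eigenvalues of the pencil within distance 1 of `z` correspond injectively to eigenvalues of `K`
of modulus at least `1 / (‖z - z₀‖ + 1)`, and a compact operator has only finitely many of these. -/
theorem not_accPt (hs : ∀ z ∈ spectrum A B, IsEigenvalue A B z) (z : ℂ) :
    ¬ AccPt z (Filter.principal (spectrum A B)) := by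
  intro hacc
  have h1 := Set.Infinite.of_accPt (hacc.nhds_inter (Metric.ball_mem_nhds z one_pos))
  apply h1
  set ρ : ℝ := ‖z - z0‖ + 1 with hρ
  have hρ0 : 0 < ρ := by positivity
  have h2 := finite_eigenvalues h.isCompactOperator (inv_pos.2 hρ0)
  refine Set.Finite.of_finite_image (f := fun w => -(w - z0)⁻¹) (h2.subset ?_) ?_
  · rintro _ ⟨w, ⟨hw1, hw2⟩, rfl⟩
    obtain ⟨hne, u, hu0, hu⟩ := h.exists_eigenvector_of_isEigenvalue (hs w hw2)
    refine ⟨?_, u, hu0, hu⟩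
    rw [norm_neg, norm_inv]
    refine inv_anti₀ (norm_pos_iff.2 (sub_ne_zero.2 hne)) ?_
    rw [Metric.mem_ball, dist_eq_norm] at hw1
    calc ‖w - z0‖ = ‖(w - z) + (z - z0)‖ := by congr 1; ring
      _ ≤ ‖w - z‖ + ‖z - z0‖ := norm_add_le _ _
      _ ≤ ρ := by linarith
  · intro a _ b _ hab
    exact sub_left_injective (_root_.inv_injective (neg_injective hab))

omit h in
-- `1 + sK` commutes with `K`, so each application to a chain vector lowers its level by one at the
-- price of a factor `K`.
theorem pow_shifted_chain {s : ℂ} {ℓ : ℕ} {u : ℕ → X} (h0 : shifted K s (u 0) = 0)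
    (h1 : ∀ j, j + 1 < ℓ → shifted K s (u (j + 1)) = K (u j)) :
    ∀ j, j < ℓ → (shifted K s ^ j) (u j) = ((K : End ℂ X) ^ j) (u 0) ∧
      (shifted K s ^ (j + 1)) (u j) = 0 := by
  have hcomm : ∀ n, Commute (shifted K s ^ n) (K : End ℂ X) := by
    intro n
    refine Commute.pow_left ?_ n
    exact LinearMap.ext fun x => by simp [shifted_apply, Module.End.mul_apply]
  intro j
  induction j with
  | zero => exact fun _ => ⟨by simp, by simpa using h0⟩
  | succ j ih =>
    intro hj
    obtain ⟨ih1, ih2⟩ := ih (by omega)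
    have hc : ∀ n x, (shifted K s ^ n) (K x) = K ((shifted K s ^ n) x) := fun n x =>
      LinearMap.congr_fun (hcomm n) x
    constructor
    · rw [pow_succ, Module.End.mul_apply, h1 j hj, hc, ih1, pow_succ', Module.End.mul_apply]
      rfl
    · rw [pow_succ, Module.End.mul_apply, h1 j hj, hc, ih2, map_zero]

/-- Pulled back through `R`, Jordan chains of the pencil become chains of `T = 1 + sK` with links
through `K`, and all their vectors lie in the generalized eigenspace of `K` at `-1/s`. It remains to
see that independent leading vectors make the whole system independent; `K` acts on `ker T` as the
nonzero scalar `-1/s`, so the factors `K` in the links do no harm. -/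
theorem sum_length_le [CompleteSpace X] {z : ℂ} (hz : z ≠ z0) {m : ℕ} {ℓ : Fin m → ℕ}
    {w : Fin m → ℕ → X} (hw : ∀ i, IsJordanChain A B z (ℓ i) (w i)) (hli : LinearIndependent ℂ (fun i => w i 0)) :
    ∑ i, ℓ i ≤ finrank ℂ (maxGenEigenspace (K : End ℂ X) (-(z - z0)⁻¹)) := by
  classical
  set s := z - z0 with hs
  have hs0 : s ≠ 0 := sub_ne_zero.2 hz
  set μ : ℂ := -s⁻¹ with hμ
  have hμ0 : μ ≠ 0 := neg_ne_zero.2 (inv_ne_zero hs0)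
  have hfd := finiteDimensional_maxGenEigenspace h.isCompactOperator hμ0
  set G := maxGenEigenspace (K : End ℂ X) μ with hG
  set T : End ℂ X := shifted K s with hT
  have hTeq : T = s • ((K : End ℂ X) - μ • (1 : End ℂ X)) := by
    refine LinearMap.ext fun x => ?_
    rw [hT, shifted_apply]
    simp [hμ, smul_smul, hs0, add_comm]
  have hTpow : ∀ n, T ^ n = s ^ n • ((K : End ℂ X) - μ • (1 : End ℂ X)) ^ n := fun n => by
    rw [hTeq, smul_pow]
  have hmem : ∀ x n, (T ^ n) x = 0 → x ∈ G := by
    intro x n hx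
    refine (mem_maxGenEigenspace _ _ _).2 ⟨n, ?_⟩
    rw [hTpow, LinearMap.smul_apply] at hx
    exact (smul_eq_zero.1 hx).resolve_left (pow_ne_zero _ hs0)
  have hchain : ∀ i, ∃ u : ℕ → X, (∀ j, j < ℓ i → w i j = R (u j)) ∧ T (u 0) = 0 ∧
      ∀ j, j + 1 < ℓ i → T (u (j + 1)) = K (u j) := by
    intro i
    obtain ⟨hpos, -, hw0, hws⟩ := hw i
    have hex : ∀ j, ∃ u, j < ℓ i → w i j = R u ∧ (j = 0 → T u = 0) := by
      intro j
      rcases j with _ | j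
      · obtain ⟨u, hu, hu0⟩ := h.mem_graph_sub_iff.1 hw0
        exact ⟨u, fun _ => ⟨hu, fun _ => hu0.symm⟩⟩
      · by_cases hj : j + 1 < ℓ i
        · obtain ⟨y, -, hy⟩ := hws j hj
          obtain ⟨u, hu, -⟩ := h.mem_graph_sub_iff.1 hy
          exact ⟨u, fun _ => ⟨hu, fun h0 => by omega⟩⟩
        · exact ⟨0, fun h0 => absurd h0 hj⟩
    choose u hu using hex
    refine ⟨u, fun j hj => (hu j hj).1, (hu 0 hpos).2 rfl, fun j hj => ?_⟩
    obtain ⟨y, hy1, hy2⟩ := hws j hj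
    obtain ⟨u', hu', hy'⟩ := h.mem_graph_sub_iff.1 hy2
    have h1 : u' = u (j + 1) := by
      have h2 : R (u' - u (j + 1)) = 0 := by
        rw [map_sub, ← hu', ← (hu (j + 1) hj).1, sub_self]
      exact sub_eq_zero.1 (h.injective h2)
    have h3 : K (u j) = y := B.mem_graph_snd_inj (h.mem_graph (u j)) hy1
      (hu j (by omega)).1.symm
    rw [h3, hy', ← h1]
    rfl
  choose u hu1 hu2 hu3 using hchain
  have hpow : ∀ i j, j < ℓ i → (T ^ j) (u i j) = ((K : End ℂ X) ^ j) (u i 0) ∧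
      (T ^ (j + 1)) (u i j) = 0 := fun i => pow_shifted_chain (hu2 i) (hu3 i)
  have hKinj : ∀ n x, T x = 0 → ((K : End ℂ X) ^ n) x = 0 → x = 0 := by
    intro n x hx hn
    have h1 : K x = μ • x := by
      have h2 : x + s • K x = 0 := hx
      rw [hμ, neg_smul, ← smul_neg, ← eq_neg_of_add_eq_zero_right h2, inv_smul_smul₀ hs0]
    rw [pow_apply_of_apply_eq_smul (T := (K : End ℂ X)) h1] at hn
    exact (smul_eq_zero.1 hn).resolve_left (pow_ne_zero _ hμ0)
  have huli : ∀ c : Fin m → ℂ, ∑ i, c i • u i 0 = 0 → ∀ i, c i = 0 := by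
    intro c hc
    refine Fintype.linearIndependent_iff.1 hli c ?_
    have h1 : ∑ i, c i • w i 0 = R (∑ i, c i • u i 0) := by
      rw [map_sum]
      exact Finset.sum_congr rfl fun i _ => by rw [map_smul, hu1 i 0 (hw i).1]
    rw [h1, hc, map_zero]
  have hbig : LinearIndependent ℂ (fun p : (Σ i, Fin (ℓ i)) => u p.1 p.2) := by
    rw [Fintype.linearIndependent_iff]
    intro g hg
    -- Coefficients are eliminated from the highest level downwards. Once those above level `J`
    -- vanish, `T^J` kills the lower levels and sends level `J` to `K^J u₀`, leaving a relation
    -- among leading vectors only.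
    have key : ∀ d J : ℕ, (∀ p : (Σ i, Fin (ℓ i)), (p.2 : ℕ) < J + d) →
        ∀ p : (Σ i, Fin (ℓ i)), J ≤ (p.2 : ℕ) → g p = 0 := by
      intro d
      induction d with
      | zero => exact fun J hJ p hp => absurd (hJ p) (by omega)
      | succ d ih =>
        intro J hJ
        have ih' := ih (J + 1) (fun p => by have := hJ p; omega)
        have h1 : ∑ p : (Σ i, Fin (ℓ i)), (if (p.2 : ℕ) = J then g p else 0) •
            ((K : End ℂ X) ^ J) (u p.1 0) = 0 := by
          have h2 := congrArg (T ^ J) hg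
          rw [map_sum, map_zero] at h2
          rw [← h2]
          refine Finset.sum_congr rfl fun p _ => ?_
          rw [map_smul]
          rcases lt_trichotomy (p.2 : ℕ) J with hlt | heq | hgt
          · rw [if_neg hlt.ne, zero_smul]
            obtain ⟨d', hd'⟩ := Nat.exists_eq_add_of_le (Nat.succ_le_of_lt hlt)
            rw [hd', add_comm, pow_add, Module.End.mul_apply, Nat.succ_eq_add_one,
              (hpow p.1 p.2 p.2.2).2, map_zero, smul_zero]
          · rw [if_pos heq, ← (hpow p.1 J (heq ▸ p.2.2)).1, heq]
          · rw [if_neg hgt.ne', zero_smul, ih' p hgt, zero_smul]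
        rw [Fintype.sum_sigma] at h1
        set c : Fin m → ℂ := fun i => ∑ j : Fin (ℓ i), if (j : ℕ) = J then g ⟨i, j⟩ else 0 with hc
        have h3 : ∑ i, c i • u i 0 = 0 := by
          refine hKinj J _ ?_ ?_
          · rw [map_sum]
            exact Finset.sum_eq_zero fun i _ => by rw [map_smul, hu2, smul_zero]
          · rw [map_sum, ← h1]
            exact Finset.sum_congr rfl fun i _ => by rw [map_smul, hc, Finset.sum_smul]
        have h4 := huli c h3
        intro p hp
        rcases hp.lt_or_eq with hlt | heq
        · exact ih' p hlt
        · have h5 := h4 p.1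
          rw [hc] at h5
          simp only at h5
          rw [Finset.sum_eq_single p.2 (fun j _ hj => if_neg fun hjJ => hj (Fin.ext (by omega)))
            (fun hp => absurd (Finset.mem_univ _) hp), if_pos heq.symm] at h5
          exact h5
    intro p
    refine key (∑ i, ℓ i) 0 (fun p => ?_) p (Nat.zero_le _)
    have := Finset.single_le_sum (f := ℓ) (fun i _ => Nat.zero_le _) (Finset.mem_univ p.1)
    have := p.2.2
    omega
  have hmemG : ∀ p : (Σ i, Fin (ℓ i)), u p.1 p.2 ∈ G := fun p =>
    hmem _ _ (hpow p.1 p.2 p.2.2).2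
  have hli' : LinearIndependent ℂ (fun p : (Σ i, Fin (ℓ i)) => (⟨_, hmemG p⟩ : G)) :=
    LinearIndependent.of_comp G.subtype hbig
  simpa using hli'.fintype_card_le_finrank

theorem algebraicMultiplicity_lt_top [CompleteSpace X] {z : ℂ} (hz : z ≠ z0) :
    algebraicMultiplicity A B z < ⊤ := by
  refine lt_of_le_of_lt (sSup_le ?_) (ENat.natCast_lt_top
    (finrank ℂ (maxGenEigenspace (K : End ℂ X) (-(z - z0)⁻¹))))
  rintro _ ⟨m, ℓ, w, hw, hli, rfl⟩
  exact_mod_cast h.sum_length_le hz hw hli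

end IsCompactResolvent

end CompactPencil

/-! ### Bounded multiplication operators -/

section Multiplication

variable {α : Type*} [MeasurableSpace α] {μ : Measure α}

theorem memLp_mul_of_bounded {g : α → ℂ} (hg : AEStronglyMeasurable g μ) {C : ℝ}
    (hC : ∀ x, ‖g x‖ ≤ C) (f : Lp ℂ 2 μ) : MemLp (fun x => g x * f x) 2 μ := by
  refine (Lp.memLp f).of_le_mul (c := C) (hg.mul (Lp.aestronglyMeasurable f)) ?_
  refine Filter.Eventually.of_forall fun x => ?_
  rw [norm_mul]
  exact mul_le_mul_of_nonneg_right (hC x) (norm_nonneg _)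

/-- Multiplication by a bounded measurable function, as a bounded operator in `L²(μ)`. -/
def mulL {g : α → ℂ} (hg : AEStronglyMeasurable g μ) {C : ℝ} (hC : ∀ x, ‖g x‖ ≤ C) :
    Lp ℂ 2 μ →L[ℂ] Lp ℂ 2 μ :=
  LinearMap.mkContinuous
    { toFun := fun f => (memLp_mul_of_bounded hg hC f).toLp (fun x => g x * f x)
      map_add' := by
        intro f h
        refine Lp.ext ?_
        filter_upwards [MemLp.coeFn_toLp (memLp_mul_of_bounded hg hC (f + h)),
          MemLp.coeFn_toLp (memLp_mul_of_bounded hg hC f),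
          MemLp.coeFn_toLp (memLp_mul_of_bounded hg hC h), Lp.coeFn_add f h,
          Lp.coeFn_add ((memLp_mul_of_bounded hg hC f).toLp _) ((memLp_mul_of_bounded hg hC h).toLp _)]
          with x h1 h2 h3 h4 h5
        rw [h1, h5, h4, Pi.add_apply, Pi.add_apply, h2, h3, mul_add]
      map_smul' := by
        intro a f
        refine Lp.ext ?_
        filter_upwards [MemLp.coeFn_toLp (memLp_mul_of_bounded hg hC (a • f)),
          MemLp.coeFn_toLp (memLp_mul_of_bounded hg hC f), Lp.coeFn_smul a f,
          Lp.coeFn_smul a ((memLp_mul_of_bounded hg hC f).toLp _)]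
          with x h1 h2 h4 h5
        rw [h1, RingHom.id_apply, h5, h4, Pi.smul_apply, Pi.smul_apply, h2, smul_eq_mul,
          smul_eq_mul, mul_left_comm] }
    C (by
      intro f
      refine Lp.norm_le_mul_norm_of_ae_le_mul ?_
      filter_upwards [MemLp.coeFn_toLp (memLp_mul_of_bounded hg hC f)] with x h1
      change ‖(memLp_mul_of_bounded hg hC f).toLp _ x‖ ≤ _
      rw [h1, norm_mul]
      exact mul_le_mul_of_nonneg_right (hC x) (norm_nonneg _))

theorem coeFn_mulL {g : α → ℂ} (hg : AEStronglyMeasurable g μ) {C : ℝ} (hC : ∀ x, ‖g x‖ ≤ C)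
    (f : Lp ℂ 2 μ) : mulL hg hC f =ᵐ[μ] fun x => g x * f x :=
  MemLp.coeFn_toLp (memLp_mul_of_bounded hg hC f)

theorem mem_graph_mulOp {g : α → ℂ} (hg : AEStronglyMeasurable g μ) {C : ℝ}
    (hC : ∀ x, ‖g x‖ ≤ C) (v w : Lp ℂ 2 μ) :
    (v, w) ∈ (mulOp μ g).graph ↔ w = mulL hg hC v := by
  rw [mulOp, Submodule.toLinearPMap_graph_eq]
  · change (∀ᵐ x ∂μ, w x = g x * v x) ↔ _
    constructor
    · intro h
      refine Lp.ext ?_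
      filter_upwards [h, coeFn_mulL hg hC v] with x h1 h2
      rw [h1, h2]
    · rintro rfl
      exact coeFn_mulL hg hC v
  · rintro ⟨p, q⟩ (hpq : ∀ᵐ x ∂μ, q x = g x * p x) (rfl : p = 0)
    refine Lp.ext ?_
    filter_upwards [hpq, Lp.coeFn_zero ℂ 2 μ] with x h1 h2
    simp only [h1, h2]
    simp

theorem inner_mulL_comm {g : α → ℝ} (hg : AEStronglyMeasurable (fun x => (g x : ℂ)) μ) {C : ℝ}
    (hC : ∀ x, ‖(g x : ℂ)‖ ≤ C) (u w : Lp ℂ 2 μ) :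
    inner ℂ (mulL hg hC u) w = inner ℂ u (mulL hg hC w) := by
  rw [L2.inner_def, L2.inner_def]
  refine integral_congr_ae ?_
  filter_upwards [coeFn_mulL hg hC u, coeFn_mulL hg hC w] with x h1 h2
  rw [h1, h2]
  simp only [RCLike.inner_apply, map_mul, Complex.conj_ofReal]
  ring

end Multiplication

theorem mem_graph_derivR {v w : L2R} : (v, w) ∈ derivR.graph ↔ IsWeakDerivR v w := by
  rw [derivR, Submodule.toLinearPMap_graph_eq _ weakDerivGraphR_functional]
  rfl

theorem mem_graph_derivPer {v w : L2per} : (v, w) ∈ derivPer.graph ↔ IsWeakDerivPer v w := by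
  rw [derivPer, Submodule.toLinearPMap_graph_eq _ weakDerivGraphPer_functional]
  rfl

/-! ### Finite-rank operators are compact -/

section FiniteRank

variable {X Y : Type*} [NormedAddCommGroup X] [NormedSpace ℂ X] [NormedAddCommGroup Y]
  [NormedSpace ℂ Y]

theorem isCompactOperator_smulRight (g : X →L[ℂ] ℂ) (y : Y) :
    IsCompactOperator (g.smulRight y) :=
  (isCompactOperator_of_locallyCompactSpace_dom g).clm_comp
    (ContinuousLinearMap.toSpanSingleton ℂ y)

theorem isCompactOperator_sum {ι : Type*} (s : Finset ι) {F : ι → X →L[ℂ] Y}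
    (hF : ∀ n, IsCompactOperator (F n)) : IsCompactOperator (∑ n ∈ s, F n : X →L[ℂ] Y) := by
  classical
  induction s using Finset.induction_on with
  | empty => simpa using isCompactOperator_zero
  | insert a s ha ih => rw [Finset.sum_insert ha]; exact (hF a).add ih

end FiniteRank

/-! ### Diagonal operators with imaginary entries -/

section DiagonalOperator

variable {X : Type*} [NormedAddCommGroup X] [InnerProductSpace ℂ X] [CompleteSpace X]
  {ι : Type*} (b : HilbertBasis ι ℂ X) {D : X →ₗ.[ℂ] X} {τ : ι → ℝ}
  (hD : ∀ v w, (v, w) ∈ D.graph ↔ ∀ n, b.repr w n = Complex.I * τ n * b.repr v n)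
include hD

/-- A maximal diagonal operator with imaginary spectrum has bounded resolvents at `±1`. -/
theorem exists_skewResolvent_of_diagonal : ∃ Rp Rm : X →L[ℂ] X, SkewResolvent D Rp Rm := by
  classical
  have hrepr : ∀ n, Continuous fun v : X => b.repr v n := fun n => by
    simp only [b.repr_apply_apply]
    fun_prop
  refine exists_skewResolvent ?_ ?_ ?_
  · have : (D.graph : Set (X × X)) =
        ⋂ n, {p | b.repr p.2 n = Complex.I * τ n * b.repr p.1 n} := by
      ext ⟨v, w⟩
      simpa using hD v w
    rw [this]
    exact isClosed_iInter fun n => isClosed_eq ((hrepr n).comp continuous_snd)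
      (continuous_const.mul ((hrepr n).comp continuous_fst))
  · intro v v' w w' hv hw
    rw [← b.repr.inner_map_map, ← b.repr.inner_map_map v, lp.inner_eq_tsum, lp.inner_eq_tsum,
      ← tsum_neg]
    refine tsum_congr fun n => ?_
    rw [(hD _ _).1 hv n, (hD _ _).1 hw n]
    simp only [RCLike.inner_apply, map_mul, Complex.conj_I, Complex.conj_ofReal]
    ring
  · intro w w' h
    rw [hD]
    intro n
    -- Testing the adjoint relation on a basis vector reads off one coefficient, so the adjoint is
    -- diagonal too.
    have h1 := h (b n) ((Complex.I * τ n) • b n) (by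
      rw [hD]
      intro j
      by_cases hj : n = j
      · simp [hj]
      · simp [b.repr_self, Ne.symm hj])
    rw [inner_smul_left, map_mul, Complex.conj_I, Complex.conj_ofReal] at h1
    rw [b.repr_apply_apply, b.repr_apply_apply]
    linear_combination h1

/-- Such a resolvent is compact when the diagonal entries tend to infinity. -/
theorem isCompactOperator_of_diagonal {Rp Rm : X →L[ℂ] X} (hR : SkewResolvent D Rp Rm)
    (hτ : Filter.Tendsto (fun n => |τ n|) Filter.cofinite Filter.atTop) :
    IsCompactOperator Rm := by
  classical
  have hcoef : ∀ f n, b.repr (Rm f) n = (1 + Complex.I * τ n)⁻¹ * b.repr f n := by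
    intro f n
    have h1 := (hD _ _).1 (hR.Rm_mem f) n
    rw [map_sub] at h1
    have h2 : b.repr f n - b.repr (Rm f) n = Complex.I * τ n * b.repr (Rm f) n := h1
    have h3 : (1 + Complex.I * τ n : ℂ) ≠ 0 := by
      intro h0
      simpa using congrArg Complex.re h0
    field_simp
    linear_combination -h2
  let P : Finset ι → X →L[ℂ] X := fun s =>
    ∑ n ∈ s, ((1 + Complex.I * τ n)⁻¹ : ℂ) • (innerSL ℂ (b n)).smulRight (b n)
  have hP : ∀ s f n, b.repr (P s f) n =
      if n ∈ s then (1 + Complex.I * τ n : ℂ)⁻¹ * b.repr f n else 0 := by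
    intro s f n
    rw [b.repr_apply_apply]
    simp only [P, sum_apply, smul_apply,
      ContinuousLinearMap.smulRight_apply, innerSL_apply_apply, inner_sum, inner_smul_right,
      orthonormal_iff_ite.1 b.orthonormal, b.repr_apply_apply]
    simp
  refine isCompactOperator_of_tendsto (F := P) (l := Filter.atTop) ?_
    (Filter.Eventually.of_forall fun s => ?_)
  · rw [Metric.tendsto_nhds]
    intro ε hε
    -- Outside a finite set `|1 + iτ|⁻¹ ≤ |τ|⁻¹ ≤ ε / 2`, so the diagonal truncations converge to
    -- `Rm` in operator norm.
    have h1 := hτ.eventually_gt_atTop (2 / ε)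
    have h2 : {n | ¬ 2 / ε < |τ n|}.Finite := h1
    filter_upwards [Filter.eventually_ge_atTop h2.toFinset] with s hs
    rw [dist_eq_norm]
    refine lt_of_le_of_lt (ContinuousLinearMap.opNorm_le_bound _ (half_pos hε).le fun f => ?_)
      (half_lt_self hε)
    rw [← b.repr.norm_map, ← b.repr.norm_map f]
    have hle : ∀ n, ‖b.repr ((P s - Rm) f) n‖ ≤ ‖((ε / 2 : ℂ) • b.repr f) n‖ := by
      intro n
      have h3 : b.repr ((P s - Rm) f) n = b.repr (P s f) n - b.repr (Rm f) n := by
        rw [sub_apply, map_sub]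
        rfl
      rw [h3, hP, hcoef, lp.coeFn_smul, Pi.smul_apply, norm_smul]
      by_cases hn : n ∈ s
      · rw [if_pos hn, sub_self, norm_zero]
        positivity
      · rw [if_neg hn, zero_sub, norm_neg, norm_mul, norm_inv]
        refine mul_le_mul_of_nonneg_right ?_ (norm_nonneg _)
        have h4 : 2 / ε < |τ n| := by
          by_contra h5
          exact hn (hs (h2.mem_toFinset.2 h5))
        have h5 : |τ n| ≤ ‖(1 + Complex.I * τ n : ℂ)‖ := by
          simpa using Complex.abs_im_le_norm (1 + Complex.I * τ n : ℂ)
        have h6 : ‖(ε / 2 : ℂ)‖ = ε / 2 := by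
          rw [← Complex.ofReal_ofNat, ← Complex.ofReal_div, Complex.norm_of_nonneg (half_pos hε).le]
        rw [h6]
        have h7 : (2 / ε)⁻¹ = ε / 2 := by rw [inv_div]
        rw [← h7]
        exact inv_anti₀ (by positivity) (h4.le.trans h5)
    calc ‖b.repr ((P s - Rm) f)‖ ≤ ‖(ε / 2 : ℂ) • b.repr f‖ :=
          lp.norm_mono (by norm_num) hle
      _ = ε / 2 * ‖b.repr f‖ := by
          rw [norm_smul, ← Complex.ofReal_ofNat, ← Complex.ofReal_div,
            Complex.norm_of_nonneg (half_pos hε).le]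
  · exact isCompactOperator_sum s
      (F := fun n => ((1 + Complex.I * τ n)⁻¹ : ℂ) • (innerSL ℂ (b n)).smulRight (b n)) fun n =>
      (isCompactOperator_smulRight (innerSL ℂ (b n)) (b n)).smul ((1 + Complex.I * τ n)⁻¹ : ℂ)

end DiagonalOperator

/-! ### The Bloch derivative in Fourier coordinates -/

section Circle

theorem integral_coe_eq (f : AddCircle (1 : ℝ) → ℂ) :
    ∫ x in (0 : ℝ)..1, f (x : AddCircle (1 : ℝ)) = ∫ x, f x ∂AddCircle.haarAddCircle := by
  rw [haarAddCircle_eq_volume]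
  simpa using AddCircle.intervalIntegral_preimage (1 : ℝ) 0 f

theorem contDiff_fourier (n : ℤ) :
    ContDiff ℝ ∞ (fun x : ℝ => fourier n (x : AddCircle (1 : ℝ))) := by
  simp only [fourier_coe_apply]
  exact ((contDiff_const.mul Complex.ofRealCLM.contDiff).div_const _).cexp

theorem periodic_fourier (n : ℤ) :
    Function.Periodic (fun x : ℝ => fourier n (x : AddCircle (1 : ℝ))) 1 := fun x => by
  simp only
  rw [AddCircle.coe_add_period]

theorem fourierCoeff_eq_integral (v : L2per) (n : ℤ) :
    fourierBasis.repr v n =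
      ∫ x in (0 : ℝ)..1, v (x : AddCircle (1 : ℝ)) * fourier (-n) (x : AddCircle (1 : ℝ)) := by
  rw [fourierBasis_repr, fourierCoeff_eq_intervalIntegral v n 0]
  simp [mul_comm]

/-- The weak derivative on the circle multiplies the `n`-th Fourier coefficient by `2 π i n`. -/
theorem isWeakDerivPer_iff {v w : L2per} : IsWeakDerivPer v w ↔
    ∀ n : ℤ, fourierBasis.repr w n =
      Complex.I * ((2 * Real.pi * n : ℝ) : ℂ) * fourierBasis.repr v n := by
  constructor
  · intro h n
    have h1 := h _ (contDiff_fourier (-n)) (periodic_fourier (-n))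
    have h2 : ∀ x : ℝ, deriv (fun x : ℝ => fourier (-n) (x : AddCircle (1 : ℝ))) x =
        -(Complex.I * ((2 * Real.pi * n : ℝ) : ℂ)) * fourier (-n) (x : AddCircle (1 : ℝ)) := by
      intro x
      rw [(hasDerivAt_fourier_neg 1 n x).deriv]
      push_cast
      ring
    simp only [h2] at h1
    rw [fourierCoeff_eq_integral, fourierCoeff_eq_integral]
    have h3 : ∫ x in (0 : ℝ)..1, v (x : AddCircle (1 : ℝ)) *
        (-(Complex.I * ((2 * Real.pi * n : ℝ) : ℂ)) * fourier (-n) (x : AddCircle (1 : ℝ))) =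
        -(Complex.I * ((2 * Real.pi * n : ℝ) : ℂ)) *
          ∫ x in (0 : ℝ)..1, v (x : AddCircle (1 : ℝ)) * fourier (-n) (x : AddCircle (1 : ℝ)) := by
      rw [← intervalIntegral.integral_const_mul]
      exact intervalIntegral.integral_congr fun x _ => mul_left_comm _ _ _
    rw [h3] at h1
    linear_combination h1
  · intro h η hη hper
    have hcη : Continuous η := hη.continuous
    have hcη' : Continuous (deriv η) := hη.continuous_deriv (by simp)
    have hper' : Function.Periodic (deriv η) 1 := fun x => by
      have : deriv (fun y => η (y + 1)) x = deriv η (x + 1) := deriv_comp_add_const _ _ _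
      rw [← this]
      exact congrArg (fun g => deriv g x) (funext hper)
    have hconj : Continuous (starRingEnd ℂ) := Complex.continuous_conj
    -- With the test function and its derivative conjugated, both sides of the weak identity are
    -- `L²` inner products, and Parseval reduces the claim to coefficients.
    let a : C(AddCircle (1 : ℝ), ℂ) := ⟨fun x => starRingEnd ℂ (hper.lift x),
      hconj.comp (continuous_coinduced_dom.2 hcη)⟩
    let b : C(AddCircle (1 : ℝ), ℂ) := ⟨fun x => starRingEnd ℂ (hper'.lift x),
      hconj.comp (continuous_coinduced_dom.2 hcη')⟩
    let A : L2per := ContinuousMap.toLp 2 AddCircle.haarAddCircle ℂ a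
    let B : L2per := ContinuousMap.toLp 2 AddCircle.haarAddCircle ℂ b
    have hA : ∀ u : L2per, inner ℂ A u = ∫ x in (0 : ℝ)..1, u (x : AddCircle (1 : ℝ)) * η x := by
      intro u
      rw [L2.inner_def, ← integral_coe_eq]
      refine intervalIntegral.integral_congr_ae ?_
      filter_upwards [ae_coe (ContinuousMap.coeFn_toLp (𝕜 := ℂ) (p := 2) AddCircle.haarAddCircle a)]
        with x hx hx1
      simp only [RCLike.inner_apply]
      rw [hx hx1]
      simp [a]
    have hB : ∀ u : L2per, inner ℂ B u =
        ∫ x in (0 : ℝ)..1, u (x : AddCircle (1 : ℝ)) * deriv η x := by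
      intro u
      rw [L2.inner_def, ← integral_coe_eq]
      refine intervalIntegral.integral_congr_ae ?_
      filter_upwards [ae_coe (ContinuousMap.coeFn_toLp (𝕜 := ℂ) (p := 2) AddCircle.haarAddCircle b)]
        with x hx hx1
      simp only [RCLike.inner_apply]
      rw [hx hx1]
      simp [b]
    rw [← hA, ← hB, ← fourierBasis.repr.inner_map_map, ← fourierBasis.repr.inner_map_map A,
      lp.inner_eq_tsum, lp.inner_eq_tsum, ← tsum_neg]
    refine tsum_congr fun n => ?_
    have hcoef : fourierBasis.repr B n =
        Complex.I * ((2 * Real.pi * n : ℝ) : ℂ) * fourierBasis.repr A n := by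
      rw [fourierBasis.repr_apply_apply, fourierBasis.repr_apply_apply, ← inner_conj_symm, hB,
        ← inner_conj_symm (fourierBasis n : L2per), hA]
      -- Integration by parts; the boundary terms cancel by periodicity.
      have hint : ∫ x in (0 : ℝ)..1, fourier n (x : AddCircle (1 : ℝ)) * deriv η x =
          -∫ x in (0 : ℝ)..1, (Complex.I * ((2 * Real.pi * n : ℝ) : ℂ)) *
            (fourier n (x : AddCircle (1 : ℝ)) * η x) := by
        have hd : ∀ x : ℝ, HasDerivAt (fun x : ℝ => fourier n (x : AddCircle (1 : ℝ)))
            (Complex.I * ((2 * Real.pi * n : ℝ) : ℂ) * fourier n (x : AddCircle (1 : ℝ))) x := by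
          intro x
          convert hasDerivAt_fourier 1 n x using 1
          push_cast
          ring
        rw [intervalIntegral.integral_mul_deriv_eq_deriv_mul (fun x _ => hd x)
          (fun x _ => ((hη.differentiable (by simp)) x).hasDerivAt)
          ((continuous_const.mul (contDiff_fourier n).continuous).intervalIntegrable _ _)
          (hcη'.intervalIntegrable _ _)]
        have h1 := periodic_fourier n 0
        have h2 := hper 0
        rw [zero_add] at h1 h2
        simp only at h1
        rw [h1, h2, sub_self, zero_sub]
        simp only [mul_assoc]
      have hbas : ∀ g : ℝ → ℂ,
          ∫ x in (0 : ℝ)..1, (fourierBasis n : L2per) (x : AddCircle (1 : ℝ)) * g x =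
            ∫ x in (0 : ℝ)..1, fourier n (x : AddCircle (1 : ℝ)) * g x := by
        intro g
        refine intervalIntegral.integral_congr_ae ?_
        rw [coe_fourierBasis]
        filter_upwards [ae_coe (coeFn_fourierLp 2 n)] with x hx hx1
        rw [hx hx1]
      rw [hbas, hbas, hint, intervalIntegral.integral_const_mul, map_neg, map_mul,
        map_mul, Complex.conj_I, Complex.conj_ofReal]
      ring
    rw [h n, hcoef]
    simp only [RCLike.inner_apply, map_mul, Complex.conj_I, Complex.conj_ofReal]
    ring

theorem mem_graph_blochDeriv {ξ : ℝ} {v w : L2per} :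
    (v, w) ∈ (blochDeriv ξ).graph ↔ ∃ w0, IsWeakDerivPer v w0 ∧ w = w0 + (Complex.I * ξ) • v := by
  rw [blochDeriv, mem_graph_add]
  simp only [mem_graph_smul, mem_graph_idOp, mem_graph_derivPer]
  constructor
  · rintro ⟨a, _, ha, ⟨_, rfl, rfl⟩, rfl⟩
    exact ⟨a, ha, rfl⟩
  · rintro ⟨a, ha, rfl⟩
    exact ⟨a, _, ha, ⟨_, rfl, rfl⟩, rfl⟩

theorem mem_graph_blochDeriv_iff_repr {ξ : ℝ} (v w : L2per) :
    (v, w) ∈ (blochDeriv ξ).graph ↔ ∀ n : ℤ, fourierBasis.repr w n =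
      Complex.I * ((2 * Real.pi * n + ξ : ℝ) : ℂ) * fourierBasis.repr v n := by
  have key : ∀ w0 : L2per, ∀ n : ℤ, fourierBasis.repr (w0 + (Complex.I * ξ) • v) n =
      fourierBasis.repr w0 n + Complex.I * ξ * fourierBasis.repr v n := fun w0 n => by
    rw [map_add, map_smul]
    rfl
  rw [mem_graph_blochDeriv]
  constructor
  · rintro ⟨w0, h, rfl⟩ n
    rw [key, isWeakDerivPer_iff.1 h n]
    push_cast
    ring
  · intro h
    refine ⟨w - (Complex.I * ξ) • v, isWeakDerivPer_iff.2 fun n => ?_, by abel⟩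
    have h1 := key (w - (Complex.I * ξ) • v) n
    rw [sub_add_cancel, h n] at h1
    push_cast at h1 ⊢
    linear_combination -h1

theorem tendsto_abs_cofinite (ξ : ℝ) :
    Filter.Tendsto (fun n : ℤ => |2 * Real.pi * n + ξ|) Filter.cofinite Filter.atTop := by
  have h1 : Filter.Tendsto (fun n : ℤ => |(n : ℝ)|) Filter.cofinite Filter.atTop := by
    have := tendsto_norm_cocompact_atTop.comp Int.tendsto_coe_cofinite
    exact this
  refine Filter.tendsto_atTop_mono (fun n => ?_)
    (Filter.tendsto_atTop_add_const_right _ (-|ξ|)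
      (h1.const_mul_atTop (by positivity : (0 : ℝ) < 2 * Real.pi)))
  have h2 : |2 * Real.pi * (n : ℝ)| = 2 * Real.pi * |(n : ℝ)| := by
    rw [abs_mul, abs_of_pos (by positivity : (0 : ℝ) < 2 * Real.pi)]
  have h3 := abs_sub_abs_le_abs_sub (2 * Real.pi * (n : ℝ)) (-ξ)
  rw [abs_neg, sub_neg_eq_add, h2] at h3
  linarith

/-- `∂ + iξ` is diagonal in the Fourier basis with entries `i(2πn + ξ)`, which tend to infinity in
modulus; this is the source of all compactness on the circle. -/
theorem exists_skewResolvent_blochDeriv (ξ : ℝ) : ∃ Rp Rm : L2per →L[ℂ] L2per,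
    SkewResolvent (blochDeriv ξ) Rp Rm ∧ IsCompactOperator Rm := by
  obtain ⟨Rp, Rm, h⟩ := exists_skewResolvent_of_diagonal fourierBasis
    (mem_graph_blochDeriv_iff_repr (ξ := ξ))
  exact ⟨Rp, Rm, h, isCompactOperator_of_diagonal fourierBasis
    (mem_graph_blochDeriv_iff_repr (ξ := ξ)) h (tendsto_abs_cofinite ξ)⟩

end Circle

/-! ### Multiplication by smooth periodic functions and the Leibniz rule -/

section PeriodicMultiplication

theorem exists_bound_of_periodic {g : ℝ → ℝ} (hg : Continuous g) (hper : Function.Periodic g 1) :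
    ∃ C, ∀ x, ‖(g x : ℂ)‖ ≤ C := by
  obtain ⟨C, hC⟩ := isCompact_Icc.exists_bound_of_continuousOn (s := Set.Icc (0 : ℝ) 1)
    hg.continuousOn
  refine ⟨C, fun x => ?_⟩
  obtain ⟨y, hy, hxy⟩ := hper.exists_mem_Ico₀ one_pos x
  rw [hxy, Complex.norm_real]
  exact hC y ⟨hy.1, hy.2.le⟩

theorem exists_bound_lift {g : ℝ → ℝ} (hg : Continuous g) (hper : Function.Periodic g 1) :
    ∃ C, ∀ x, ‖(hper.lift x : ℂ)‖ ≤ C := by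
  obtain ⟨C, hC⟩ := exists_bound_of_periodic hg hper
  refine ⟨C, fun x => ?_⟩
  induction x using QuotientAddGroup.induction_on with
  | H y => exact hC y

theorem continuous_lift {E : Type*} [TopologicalSpace E] {g : ℝ → E} (hg : Continuous g)
    (hper : Function.Periodic g 1) : Continuous hper.lift :=
  continuous_coinduced_dom.2 hg

theorem aestronglyMeasurable_lift {g : ℝ → ℝ} (hg : Continuous g)
    (hper : Function.Periodic g 1) :
    AEStronglyMeasurable (fun x => (hper.lift x : ℂ)) (AddCircle.haarAddCircle (T := (1 : ℝ))) :=
  (Complex.continuous_ofReal.comp (continuous_lift hg hper)).aestronglyMeasurable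

/-- Multiplication by a continuous periodic function in `L²_per(0,1)`. -/
def mulPer {g : ℝ → ℝ} (hg : Continuous g) (hper : Function.Periodic g 1) : L2per →L[ℂ] L2per :=
  mulL (aestronglyMeasurable_lift hg hper) (exists_bound_lift hg hper).choose_spec

/-- Multiplication by a continuous periodic function in `L²(ℝ)`. -/
def mulR {g : ℝ → ℝ} (hg : Continuous g) (hper : Function.Periodic g 1) : L2R →L[ℂ] L2R :=
  mulL (Complex.continuous_ofReal.comp hg).aestronglyMeasurable
    (exists_bound_of_periodic hg hper).choose_spec

theorem coeFn_mulPer {g : ℝ → ℝ} (hg : Continuous g) (hper : Function.Periodic g 1) (v : L2per) :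
    mulPer hg hper v =ᵐ[AddCircle.haarAddCircle] fun x => (hper.lift x : ℂ) * v x :=
  coeFn_mulL _ _ v

theorem coeFn_mulR {g : ℝ → ℝ} (hg : Continuous g) (hper : Function.Periodic g 1) (v : L2R) :
    mulR hg hper v =ᵐ[volume] fun x => (g x : ℂ) * v x :=
  coeFn_mulL _ _ v

theorem periodic_deriv {E : Type*} [NormedAddCommGroup E] [NormedSpace ℝ E] {g : ℝ → E}
    (hper : Function.Periodic g 1) : Function.Periodic (deriv g) 1 := fun x => by
  have : deriv (fun y => g (y + 1)) x = deriv g (x + 1) := deriv_comp_add_const _ _ _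
  rw [← this]
  exact congrArg (fun g => deriv g x) (funext hper)

theorem deriv_ofReal_mul {g : ℝ → ℝ} {η : ℝ → ℂ} (hg : ContDiff ℝ ∞ g) (hη : ContDiff ℝ ∞ η)
    (x : ℝ) : deriv (fun x => (g x : ℂ) * η x) x =
      ((deriv g x : ℝ) : ℂ) * η x + (g x : ℂ) * deriv η x :=
  ((hg.differentiable (by simp) x).hasDerivAt.ofReal_comp.mul
    (hη.differentiable (by simp) x).hasDerivAt).deriv

/-- Apply the weak identity for `v` to the test function `gη` and expand `(gη)' = g'η + gη'`. The
version on the line is the same. -/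
theorem leibniz_per {g : ℝ → ℝ} (hg : ContDiff ℝ ∞ g) (hper : Function.Periodic g 1)
    (hg' : Continuous (deriv g)) {v w : L2per} (h : IsWeakDerivPer v w) :
    IsWeakDerivPer (mulPer hg.continuous hper v)
      (mulPer hg.continuous hper w + mulPer hg' (periodic_deriv hper) v) := by
  intro η hη hηper
  have h1 : ContDiff ℝ ∞ (fun x => (g x : ℂ) * η x) :=
    (Complex.ofRealCLM.contDiff.comp hg).mul hη
  have h2 := h _ h1 (fun x => by simp only [hper x, hηper x])
  simp only [deriv_ofReal_mul hg hη] at h2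
  have hcη' : Continuous (deriv η) := hη.continuous_deriv (by simp)
  have hcg : Continuous fun x => (g x : ℂ) := Complex.continuous_ofReal.comp hg.continuous
  have hcg' : Continuous fun x => ((deriv g x : ℝ) : ℂ) := Complex.continuous_ofReal.comp hg'
  have e1 : ∫ x in (0 : ℝ)..1, mulPer hg.continuous hper v (x : AddCircle (1 : ℝ)) * deriv η x =
      ∫ x in (0 : ℝ)..1, v (x : AddCircle (1 : ℝ)) * ((g x : ℂ) * deriv η x) := by
    refine intervalIntegral.integral_congr_ae ?_
    filter_upwards [ae_coe (coeFn_mulPer hg.continuous hper v)] with x hx hx1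
    rw [hx hx1, Function.Periodic.lift_coe]
    ring
  have e2 : ∫ x in (0 : ℝ)..1, (mulPer hg.continuous hper w + mulPer hg' (periodic_deriv hper) v :
        L2per) (x : AddCircle (1 : ℝ)) * η x =
      (∫ x in (0 : ℝ)..1, w (x : AddCircle (1 : ℝ)) * ((g x : ℂ) * η x)) +
        ∫ x in (0 : ℝ)..1, v (x : AddCircle (1 : ℝ)) * (((deriv g x : ℝ) : ℂ) * η x) := by
    rw [← intervalIntegral.integral_add (intervalIntegrable_mul w
      (η := fun x => (g x : ℂ) * η x) (hcg.mul hη.continuous))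
      (intervalIntegrable_mul v
      (η := fun x => ((deriv g x : ℝ) : ℂ) * η x) (hcg'.mul hη.continuous))]
    refine intervalIntegral.integral_congr_ae ?_
    filter_upwards [ae_coe (coeFn_mulPer hg.continuous hper w),
      ae_coe (coeFn_mulPer hg' (periodic_deriv hper) v), ae_coe (Lp.coeFn_add
        (mulPer hg.continuous hper w) (mulPer hg' (periodic_deriv hper) v))] with x hx hx' hx'' hx1
    rw [hx'' hx1, Pi.add_apply, hx hx1, hx' hx1, Function.Periodic.lift_coe,
      Function.Periodic.lift_coe]
    ring
  simp only [mul_add] at h2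
  rw [intervalIntegral.integral_add (intervalIntegrable_mul v
      (η := fun x => ((deriv g x : ℝ) : ℂ) * η x) (hcg'.mul hη.continuous))
    (intervalIntegrable_mul v
      (η := fun x => (g x : ℂ) * deriv η x) (hcg.mul hcη'))] at h2
  rw [e1, e2]
  linear_combination h2

theorem leibniz_blochDeriv {g : ℝ → ℝ} (hg : ContDiff ℝ ∞ g) (hper : Function.Periodic g 1)
    (hg' : Continuous (deriv g)) {ξ : ℝ} {v w : L2per} (h : (v, w) ∈ (blochDeriv ξ).graph) :
    (mulPer hg.continuous hper v, mulPer hg.continuous hper w +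
      mulPer hg' (periodic_deriv hper) v) ∈ (blochDeriv ξ).graph := by
  obtain ⟨w0, h0, rfl⟩ := mem_graph_blochDeriv.1 h
  refine mem_graph_blochDeriv.2 ⟨_, leibniz_per hg hper hg' h0, ?_⟩
  rw [map_add, map_smul]
  abel

theorem leibniz_derivR {g : ℝ → ℝ} (hg : ContDiff ℝ ∞ g) (hper : Function.Periodic g 1)
    (hg' : Continuous (deriv g)) {v w : L2R} (h : (v, w) ∈ derivR.graph) :
    (mulR hg.continuous hper v, mulR hg.continuous hper w +
      mulR hg' (periodic_deriv hper) v) ∈ derivR.graph := by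
  rw [mem_graph_derivR] at h ⊢
  intro η hη hc
  have h1 : ContDiff ℝ ∞ (fun x => (g x : ℂ) * η x) :=
    (Complex.ofRealCLM.contDiff.comp hg).mul hη
  have h2 := h _ h1 hc.mul_left
  simp only [deriv_ofReal_mul hg hη] at h2
  have hcη' : Continuous (deriv η) := hη.continuous_deriv (by simp)
  have hcg : Continuous fun x => (g x : ℂ) := Complex.continuous_ofReal.comp hg.continuous
  have hcg' : Continuous fun x => ((deriv g x : ℝ) : ℂ) := Complex.continuous_ofReal.comp hg'
  have e1 : ∫ x, mulR hg.continuous hper v x * deriv η x =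
      ∫ x, v x * ((g x : ℂ) * deriv η x) := by
    refine integral_congr_ae ?_
    filter_upwards [coeFn_mulR hg.continuous hper v] with x hx
    rw [hx]
    ring
  have e2 : ∫ x, (mulR hg.continuous hper w + mulR hg' (periodic_deriv hper) v : L2R) x * η x =
      (∫ x, w x * ((g x : ℂ) * η x)) + ∫ x, v x * (((deriv g x : ℝ) : ℂ) * η x) := by
    rw [← integral_add (integrable_mul_of_hasCompactSupport w
      (η := fun x => (g x : ℂ) * η x) (hcg.mul hη.continuous) hc.mul_left)
      (integrable_mul_of_hasCompactSupport v
      (η := fun x => ((deriv g x : ℝ) : ℂ) * η x) (hcg'.mul hη.continuous) hc.mul_left)]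
    refine integral_congr_ae ?_
    filter_upwards [coeFn_mulR hg.continuous hper w, coeFn_mulR hg' (periodic_deriv hper) v,
      Lp.coeFn_add (mulR hg.continuous hper w) (mulR hg' (periodic_deriv hper) v)] with x hx hx' hx''
    rw [hx'', Pi.add_apply, hx, hx']
    ring
  simp only [mul_add] at h2
  rw [integral_add (integrable_mul_of_hasCompactSupport v
      (η := fun x => ((deriv g x : ℝ) : ℂ) * η x) (hcg'.mul hη.continuous) hc.mul_left)
    (integrable_mul_of_hasCompactSupport v
      (η := fun x => (g x : ℂ) * deriv η x) (hcg.mul hcη') hc.deriv.mul_left)] at h2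
  rw [e1, e2]
  linear_combination h2

end PeriodicMultiplication

/-! ### Discreteness of the Bloch spectra -/

section BlochSpectrum

variable {γ β k c : ℝ} (hγ : 0 < γ) (hβ : β ≠ 0) (hk : 0 < k)
  {φ : ℝ → ℝ} (hφ : ContDiff ℝ ∞ φ) (hper : Function.Periodic φ 1)

include hφ in
theorem mem_graph_blochPencil (ξ : ℝ) (z : ℂ) (v f : L2per) :
    (v, f) ∈ (z • blochH k ξ - blochL hper γ β k c ξ).graph ↔
      ∃ q, IsSolution (blochDeriv ξ) (mulPer hφ.continuous hper) γ β k c z v q f :=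
  mem_graph_pencil (mem_graph_mulOp _ _) γ β k c z v f

include hφ in
theorem isEigenvalue_bloch_iff (ξ : ℝ) (z : ℂ) :
    IsEigenvalue (blochL hper γ β k c ξ) (blochH k ξ) z ↔
      ∃ v q, v ≠ 0 ∧ IsSolution (blochDeriv ξ) (mulPer hφ.continuous hper) γ β k c z v q 0 := by
  rw [isEigenvalue_iff]
  simp only [mem_graph_blochPencil hφ hper]
  exact ⟨fun ⟨v, hv, q, h⟩ => ⟨v, q, hv, h⟩, fun ⟨v, q, hv, h⟩ => ⟨v, hv, q, h⟩⟩

include hβ hk hφ in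
-- Fredholm alternative: without an eigenvector the homogeneous equation has only `v = 0`, and
-- compactness of `Rm` then supplies a bounded inverse.
theorem isEigenvalue_of_mem_spectrum_bloch {ξ : ℝ} {z : ℂ}
    (hz : z ∈ spectrum (blochL hper γ β k c ξ) (blochH k ξ)) :
    IsEigenvalue (blochL hper γ β k c ξ) (blochH k ξ) z := by
  by_contra hne
  rw [isEigenvalue_bloch_iff hφ hper] at hne
  push Not at hne
  have hker : ∀ v q, IsSolution (blochDeriv ξ) (mulPer hφ.continuous hper) γ β k c z v q 0 →
      v = 0 := fun v q h => by
    by_contra hv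
    exact hne v q hv h
  obtain ⟨Rp, Rm, hD, hc⟩ := exists_skewResolvent_blochDeriv ξ
  obtain ⟨S, hS⟩ := exists_solutionOp_of_isCompactOperator hD hc (mulPer hφ.continuous hper) γ c hβ
    hk.ne' z hker
  exact hz (boundedlyInvertible_of_solutionOp (mem_graph_mulOp _ _) hker S hS)

include hγ hβ hk hφ in
theorem exists_isCompactResolvent_bloch (ξ : ℝ) : ∃ (z0 : ℂ) (R K : L2per →L[ℂ] L2per),
    IsCompactResolvent (blochL hper γ β k c ξ) (blochH k ξ) z0 R K := by
  obtain ⟨Rp, Rm, hD, hc⟩ := exists_skewResolvent_blochDeriv ξ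
  set m := mulPer hφ.continuous hper with hm
  have hg' : Continuous (deriv φ) := hφ.continuous_deriv (by simp)
  set m1 := mulPer hg' (periodic_deriv hper) with hm1
  -- Any point with real part beyond the threshold `k‖m1‖/2` of `eq_zero_of_re_large` would do.
  set z0 : ℂ := ((k * ‖m1‖ / 2 + 1 : ℝ) : ℂ) with hz0
  have hker : ∀ v q, IsSolution (blochDeriv ξ) m γ β k c z0 v q 0 → v = 0 := fun v q h =>
    eq_zero_of_re_large (m := m) (m1 := m1) hD.skew (inner_mulL_comm _ _)
      (fun h => leibniz_blochDeriv hφ hper hg' h) hγ.ne' hβ hk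
      (by rw [hz0, Complex.ofReal_re]; linarith) h
  obtain ⟨S, hS⟩ := exists_solutionOp_of_isCompactOperator hD hc m γ c hβ hk.ne' z0 hker
  -- `K = kDR` is computed through `Dv = D(D² - 1)⁻¹` of the source of `v`, which displays the
  -- compact factor.
  refine ⟨z0, ContinuousLinearMap.fst ℂ _ _ ∘L S,
    (k : ℂ) • (derivInv Rp Rm ∘L sourceV m β k c ∘L S), ?_, ?_, ?_⟩
  · intro v f
    rw [mem_graph_blochPencil hφ hper]
    constructor
    · rintro ⟨q, h⟩
      have h1 := h.sub (hS f)
      rw [sub_self] at h1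
      exact sub_eq_zero.1 (hker _ _ h1)
    · rintro rfl
      exact ⟨_, hS f⟩
  · intro f
    have h1 := (hD.isSolution_iff m γ c hβ hk.ne' z0 _ _ f).1 (hS f)
    have h2 : (S f).1 = Rp (Rm (sourceV m β k c (S f))) := by
      have := congrArg Prod.fst h1
      simpa [fixedPointOp] using this
    refine mem_graph_smul.2 ⟨_, ?_, rfl⟩
    change ((S f).1, derivInv Rp Rm (sourceV m β k c (S f))) ∈ _
    nth_rw 1 [h2]
    exact hD.inv_mem _
  · have h1 : IsCompactOperator (derivInv Rp Rm ∘L (sourceV m β k c ∘L S)) :=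
      (derivInv_isCompactOperator hc).comp_clm _
    exact h1.smul (k : ℂ)

include hγ hβ hk hφ in
/-- The Bloch spectra are discrete and consist of eigenvalues of finite algebraic multiplicity. -/
theorem bloch_spectrum_discrete (ξ : ℝ) :
    spectrum (blochL hper γ β k c ξ) (blochH k ξ) =
      pointSpectrum (blochL hper γ β k c ξ) (blochH k ξ) ∧
    (∀ z ∈ spectrum (blochL hper γ β k c ξ) (blochH k ξ),
      IsEigenvalue (blochL hper γ β k c ξ) (blochH k ξ) z ∧
        algebraicMultiplicity (blochL hper γ β k c ξ) (blochH k ξ) z < ⊤) ∧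
    ∀ z : ℂ, ¬ AccPt z (Filter.principal (spectrum (blochL hper γ β k c ξ) (blochH k ξ))) := by
  obtain ⟨z0, R, K, h⟩ := exists_isCompactResolvent_bloch (c := c) hγ hβ hk hφ hper ξ
  have hs : ∀ z ∈ spectrum (blochL hper γ β k c ξ) (blochH k ξ),
      IsEigenvalue (blochL hper γ β k c ξ) (blochH k ξ) z := fun z hz =>
    isEigenvalue_of_mem_spectrum_bloch hβ hk hφ hper hz
  exact ⟨h.spectrum_eq_pointSpectrum, fun z hz => ⟨hs z hz, h.algebraicMultiplicity_lt_top
    (h.exists_eigenvector_of_isEigenvalue (hs z hz)).1⟩, h.not_accPt hs⟩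

end BlochSpectrum

/-! ### Absolutely continuous primitives and the lemma of du Bois-Reymond -/

section Primitives

theorem absolutelyContinuousOnInterval_of_dist_le {E F : Type*} [PseudoMetricSpace E]
    [PseudoMetricSpace F] {f : ℝ → E} {g : ℝ → F} {a b : ℝ}
    (hg : AbsolutelyContinuousOnInterval g a b)
    (h : ∀ x ∈ Set.uIcc a b, ∀ y ∈ Set.uIcc a b, dist (f x) (f y) ≤ dist (g x) (g y)) :
    AbsolutelyContinuousOnInterval f a b := by
  rw [absolutelyContinuousOnInterval_iff] at hg ⊢
  intro ε hε
  obtain ⟨δ, hδ, hd⟩ := hg ε hε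
  refine ⟨δ, hδ, fun E hE hE' => lt_of_le_of_lt (Finset.sum_le_sum fun i hi => ?_) (hd E hE hE')⟩
  exact h _ (hE.left i hi).left _ (hE.left i hi).right

/-- `V` is a primitive of the locally integrable function `w`. -/
structure IsPrimitive (V w : ℝ → ℂ) : Prop where
  locallyIntegrable : LocallyIntegrable w
  sub_eq : ∀ a b, V b - V a = ∫ x in a..b, w x

theorem intervalIntegrable_of_locallyIntegrable {E : Type*} [NormedAddCommGroup E] {w : ℝ → E}
    (h : LocallyIntegrable w) (a b : ℝ) : IntervalIntegrable w volume a b :=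
  intervalIntegrable_iff.2 ((h.integrableOn_isCompact isCompact_uIcc).mono_set
    Set.uIoc_subset_uIcc)

namespace IsPrimitive

theorem intervalIntegrable {V w : ℝ → ℂ} (h : IsPrimitive V w) (a b : ℝ) :
    IntervalIntegrable w volume a b :=
  intervalIntegrable_of_locallyIntegrable h.locallyIntegrable a b

theorem eq_add {V w : ℝ → ℂ} (h : IsPrimitive V w) (a : ℝ) :
    V = fun x => V a + ∫ t in a..x, w t := funext fun x => by rw [← h.sub_eq]; ring

/-- Increments of `V` are dominated by those of the indefinite integral of `‖w‖`, which is
absolutely continuous. -/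
theorem absolutelyContinuousOnInterval {V w : ℝ → ℂ} (h : IsPrimitive V w) (a b : ℝ) :
    AbsolutelyContinuousOnInterval V a b := by
  refine absolutelyContinuousOnInterval_of_dist_le
    ((h.intervalIntegrable a b).norm.absolutelyContinuousOnInterval_intervalIntegral
      (c := a) Set.left_mem_uIcc) fun x _ y _ => ?_
  have hn : ∀ s t, IntervalIntegrable (fun u => ‖w u‖) volume s t := fun s t =>
    (h.intervalIntegrable s t).norm
  rw [dist_comm, dist_comm (∫ u in a..x, ‖w u‖), dist_eq_norm, h.sub_eq, Real.dist_eq,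
    intervalIntegral.integral_interval_sub_left (hn _ _) (hn _ _)]
  exact intervalIntegral.norm_integral_le_abs_integral_norm

theorem ae_hasDerivAt {V w : ℝ → ℂ} (h : IsPrimitive V w) : ∀ᵐ x, HasDerivAt V (w x) x := by
  filter_upwards [_root_.LocallyIntegrable.ae_hasDerivAt_integral h.locallyIntegrable] with x hx
  rw [h.eq_add 0]
  exact (hx 0).const_add _

theorem continuous {V w : ℝ → ℂ} (h : IsPrimitive V w) : Continuous V := by
  rw [h.eq_add 0]
  exact continuous_const.add
    (intervalIntegral.continuous_primitive (fun a b => h.intervalIntegrable a b) 0)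

theorem hasDerivAt {V w : ℝ → ℂ} (h : IsPrimitive V w) (hw : Continuous w) (x : ℝ) :
    HasDerivAt V (w x) x := by
  rw [h.eq_add 0]
  exact (hw.integral_hasStrictDerivAt 0 x).hasDerivAt.const_add _

theorem of_hasDerivAt {V w : ℝ → ℂ} (h : ∀ x, HasDerivAt V (w x) x) (hw : Continuous w) :
    IsPrimitive V w where
  locallyIntegrable := hw.locallyIntegrable
  sub_eq _ _ := (intervalIntegral.integral_eq_sub_of_hasDerivAt (fun x _ => h x)
    (hw.intervalIntegrable _ _)).symm

theorem congr {V w w' : ℝ → ℂ} (h : IsPrimitive V w) (hw : w =ᵐ[volume] w') :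
    IsPrimitive V w' where
  locallyIntegrable := h.locallyIntegrable.congr hw
  sub_eq a b := by
    rw [h.sub_eq, intervalIntegral.integral_congr_ae (hw.mono fun x hx _ => hx)]

theorem locallyIntegrable_mul {w U : ℝ → ℂ} (h : LocallyIntegrable w) (hU : Continuous U) :
    LocallyIntegrable fun x => w x * U x := by
  intro x
  obtain ⟨s, hs, hc, -⟩ := exists_compact_subset (isOpen_univ (X := ℝ)) (Set.mem_univ x)
  exact ⟨s, mem_interior_iff_mem_nhds.1 hc,
    (h.integrableOn_isCompact hs).mul_continuousOn hU.continuousOn hs⟩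

/-- The product rule. -/
theorem mul {V w U u : ℝ → ℂ} (h : IsPrimitive V w) (h' : IsPrimitive U u) :
    IsPrimitive (fun x => V x * U x) (fun x => w x * U x + V x * u x) := by
  have hl : LocallyIntegrable (fun x => w x * U x + V x * u x) := by
    have h1 := locallyIntegrable_mul h'.locallyIntegrable h.continuous
    simp only [mul_comm (u _)] at h1
    exact (locallyIntegrable_mul h.locallyIntegrable h'.continuous).add h1
  refine ⟨hl, fun a b => ?_⟩
  have h0 : IsPrimitive (fun x => ∫ t in a..x, (w t * U t + V t * u t))
      (fun x => w x * U x + V x * u x) := by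
    refine ⟨hl, fun s t => ?_⟩
    exact intervalIntegral.integral_interval_sub_left (intervalIntegrable_of_locallyIntegrable hl _ _)
      (intervalIntegrable_of_locallyIntegrable hl _ _)
  -- The product minus the integral of its candidate derivative is absolutely continuous with zero
  -- derivative almost everywhere, hence constant.
  have hac := ((h.absolutelyContinuousOnInterval a b).smul
    (h'.absolutelyContinuousOnInterval a b)).sub (h0.absolutelyContinuousOnInterval a b)
  obtain ⟨C, hC⟩ := hac.const_of_ae_hasDerivAt_zero (by
    filter_upwards [h.ae_hasDerivAt, h'.ae_hasDerivAt, h0.ae_hasDerivAt] with x h1 h2 h3 _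
    have := (h1.mul h2).sub h3
    rw [sub_self] at this
    exact this)
  have h1 := hC a Set.left_mem_uIcc
  have h2 := hC b Set.right_mem_uIcc
  simp only [Pi.sub_apply, smul_eq_mul, Pi.mul_apply, intervalIntegral.integral_same] at h1 h2
  linear_combination h2 - h1

theorem conj {V w : ℝ → ℂ} (h : IsPrimitive V w) :
    IsPrimitive (fun x => starRingEnd ℂ (V x)) (fun x => starRingEnd ℂ (w x)) where
  locallyIntegrable x := by
    obtain ⟨s, hs, hi⟩ := h.locallyIntegrable x
    exact ⟨s, hs, (LinearIsometryEquiv.integrable_comp_iff Complex.conjLIE).2 hi⟩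
  sub_eq a b := by
    rw [← map_sub, h.sub_eq, intervalIntegral.intervalIntegral_eq_integral_uIoc,
      intervalIntegral.intervalIntegral_eq_integral_uIoc, integral_conj]
    simp only [RCLike.real_smul_eq_coe_mul, map_mul]
    split_ifs <;> simp

end IsPrimitive

/-- The lemma of du Bois-Reymond. -/
theorem ae_eq_const_of_integral_mul_deriv_eq_zero {u : ℝ → ℂ} (hu : LocallyIntegrable u)
    (h : ∀ η : ℝ → ℂ, ContDiff ℝ ∞ η → HasCompactSupport η → ∫ x, u x * deriv η x = 0) :
    ∃ C : ℂ, ∀ᵐ x, u x = C := by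
  let b : ContDiffBump (0 : ℝ) := ⟨1, 2, one_pos, one_lt_two⟩
  set ρ : ℝ → ℝ := b.normed volume with hρ
  have hρs : ContDiff ℝ ∞ ρ := b.contDiff_normed
  have hρc : HasCompactSupport ρ := b.hasCompactSupport_normed
  have hρ1 : ∫ x, ρ x = 1 := b.integral_normed
  have hint : ∀ ψ : ℝ → ℝ, Continuous ψ → HasCompactSupport ψ →
      Integrable fun x => ψ x • u x := fun ψ h1 h2 =>
    hu.integrable_smul_left_of_hasCompactSupport h1 h2
  refine ⟨∫ x, ρ x • u x, ?_⟩
  set C := ∫ x, ρ x • u x with hC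
  have hz : ∀ᵐ x, u x - C = 0 := by
    refine ae_eq_zero_of_integral_contDiff_smul_eq_zero
      (hu.sub (locallyIntegrable_const C)) fun ψ hψ hψc => ?_
    set I := ∫ x, ψ x with hI
    -- Subtracting `Iρ` makes the mean zero, so that the primitive `H` of `θ` has compact support
    -- and is an admissible test function. The hypothesis for `H` then reads `∫ ψu = I·C`.
    set θ : ℝ → ℝ := fun x => ψ x - I * ρ x with hθ
    have hψi : Integrable ψ := hψ.continuous.integrable_of_hasCompactSupport hψc
    have hρi : Integrable ρ := hρs.continuous.integrable_of_hasCompactSupport hρc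
    have hθs : ContDiff ℝ ∞ θ := hψ.sub (contDiff_const.mul hρs)
    have hθc : HasCompactSupport θ := hψc.sub hρc.mul_left
    have hθi : Integrable θ := hψi.sub (hρi.const_mul I)
    have hθ0 : ∫ x, θ x = 0 := by
      rw [hθ, integral_sub hψi (hρi.const_mul I), integral_const_mul, hρ1, mul_one, sub_self]
    obtain ⟨R, hR⟩ := hθc.isCompact.isBounded.subset_closedBall (0 : ℝ)
    have hθz : ∀ x, R < |x| → θ x = 0 := fun x hx => by
      by_contra h0
      have := hR (subset_tsupport _ (Function.mem_support.2 h0))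
      rw [Metric.mem_closedBall, dist_zero_right, Real.norm_eq_abs] at this
      linarith
    set H : ℝ → ℝ := fun x => ∫ t in Set.Iic x, θ t with hH
    have hHd : ∀ x, HasDerivAt H (θ x) x := by
      intro x
      have h1 : H = fun y => (∫ t in Set.Iic 0, θ t) + ∫ t in (0 : ℝ)..y, θ t := by
        funext y
        rw [← intervalIntegral.integral_Iic_sub_Iic hθi.integrableOn hθi.integrableOn]
        simp only [hH]
        ring
      rw [h1]
      exact (hθs.continuous.integral_hasStrictDerivAt 0 x).hasDerivAt.const_add _
    have hHs : ContDiff ℝ ∞ H := by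
      rw [contDiff_infty_iff_deriv]
      refine ⟨fun x => (hHd x).differentiableAt, ?_⟩
      rwa [funext fun x => (hHd x).deriv]
    have hHc : HasCompactSupport H := by
      refine HasCompactSupport.intro (isCompact_closedBall (0 : ℝ) (max R 0)) fun x hx => ?_
      rw [Metric.mem_closedBall, dist_zero_right, Real.norm_eq_abs, not_le] at hx
      have hxR : R < |x| := lt_of_le_of_lt (le_max_left _ _) hx
      have hx0 : 0 ≤ |x| := abs_nonneg x
      rcases le_total 0 x with h0 | h0
      · rw [abs_of_nonneg h0] at hx hxR
        have h2 : ∫ t in Set.Ioi x, θ t = 0 := by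
          refine setIntegral_eq_zero_of_forall_eq_zero fun t ht => hθz t ?_
          rw [Set.mem_Ioi] at ht
          exact lt_of_lt_of_le (hxR.trans ht) (le_abs_self t)
        have h3 := intervalIntegral.integral_Iic_add_Ioi (b := x) hθi.integrableOn hθi.integrableOn
        rw [h2, hθ0, add_zero] at h3
        exact h3
      · rw [abs_of_nonpos h0] at hx hxR
        refine setIntegral_eq_zero_of_forall_eq_zero fun t ht => hθz t ?_
        rw [Set.mem_Iic] at ht
        have := neg_le_abs t
        linarith
    have h1 := h (fun x => (H x : ℂ)) (Complex.ofRealCLM.contDiff.comp hHs)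
      (hHc.comp_left (g := Complex.ofReal) (by simp))
    have h2 : ∀ x, u x * deriv (fun x => (H x : ℂ)) x = ψ x • u x - I • (ρ x • u x) := by
      intro x
      rw [((hHd x).ofReal_comp).deriv, hθ]
      simp only [Complex.real_smul]
      push_cast
      ring
    simp only [h2] at h1
    have hIρ : Integrable fun x => I • (ρ x • u x) := (hint ρ hρs.continuous hρc).smul I
    rw [integral_sub (hint ψ hψ.continuous hψc) hIρ,
      integral_smul, ← hC, sub_eq_zero] at h1
    simp only [smul_sub]
    rw [integral_sub (hint ψ hψ.continuous hψc) (hψi.smul_const C), h1, integral_smul_const,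
      sub_self]
  filter_upwards [hz] with x hx
  exact sub_eq_zero.1 hx

end Primitives

/-! ### The derivative on the line is skew-adjoint -/

section LineDerivative

open Filter Topology

theorem IsPrimitive.integral_mul_deriv {V w η : ℝ → ℂ} (h : IsPrimitive V w)
    (hη : ContDiff ℝ ∞ η) (hc : HasCompactSupport η) :
    ∫ x, V x * deriv η x = -∫ x, w x * η x := by
  have hcη' : Continuous (deriv η) := hη.continuous_deriv (by simp)
  have h1 : IsPrimitive η (deriv η) := IsPrimitive.of_hasDerivAt
    (fun x => (hη.differentiable (by simp) x).hasDerivAt) hcη'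
  have hi1 : Integrable fun x => w x * η x :=
    h.locallyIntegrable.integrable_smul_right_of_hasCompactSupport hη.continuous hc
  have hi2 : Integrable fun x => V x * deriv η x :=
    h.continuous.locallyIntegrable.integrable_smul_right_of_hasCompactSupport hcη' hc.deriv
  have hi : Integrable fun x => w x * η x + V x * deriv η x := hi1.add hi2
  have h2 := intervalIntegral_tendsto_integral hi tendsto_neg_atTop_atBot tendsto_id
  obtain ⟨R, hR⟩ := hc.isCompact.isBounded.subset_closedBall (0 : ℝ)
  have hz : ∀ x, R < |x| → η x = 0 := fun x hx => by
    by_contra h0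
    have := hR (subset_tsupport _ (Function.mem_support.2 h0))
    rw [Metric.mem_closedBall, dist_zero_right, Real.norm_eq_abs] at this
    linarith
  have h3 : Tendsto (fun R : ℝ => ∫ x in -R..id R, (w x * η x + V x * deriv η x)) atTop (𝓝 0) := by
    refine tendsto_const_nhds.congr' ?_
    filter_upwards [eventually_gt_atTop R, eventually_ge_atTop 0] with S hS hS0
    rw [← (h.mul h1).sub_eq, id, hz S (by rwa [abs_of_nonneg hS0]),
      hz (-S) (by rwa [abs_neg, abs_of_nonneg hS0])]
    simp
  have h4 := tendsto_nhds_unique h2 h3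
  rw [integral_add hi1 hi2] at h4
  linear_combination h4

/-- Weak derivatives in `L²(ℝ)` are derivatives of absolutely continuous representatives. -/
theorem isWeakDerivR_iff {v w : L2R} : IsWeakDerivR v w ↔ ∃ V, IsPrimitive V w ∧ v =ᵐ[volume] V := by
  have hl : ∀ u : L2R, LocallyIntegrable u := fun u =>
    (Lp.memLp u).locallyIntegrable (by norm_num)
  constructor
  · intro h
    have h0 : IsPrimitive (fun x => ∫ t in (0 : ℝ)..x, w t) w :=
      ⟨hl w, fun a b => intervalIntegral.integral_interval_sub_left
        (intervalIntegrable_of_locallyIntegrable (hl w) _ _)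
        (intervalIntegrable_of_locallyIntegrable (hl w) _ _)⟩
    obtain ⟨C, hC⟩ := ae_eq_const_of_integral_mul_deriv_eq_zero
      (u := fun x => v x - ∫ t in (0 : ℝ)..x, w t)
      ((hl v).sub h0.continuous.locallyIntegrable) (fun η hη hc => by
        have hcη' : Continuous (deriv η) := hη.continuous_deriv (by simp)
        have hi : Integrable fun x => (∫ t in (0 : ℝ)..x, w t) * deriv η x :=
          h0.continuous.locallyIntegrable.integrable_smul_right_of_hasCompactSupport hcη' hc.deriv
        simp only [sub_mul]
        rw [integral_sub (integrable_mul_of_hasCompactSupport v hcη' hc.deriv) hi,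
          h η hη hc, h0.integral_mul_deriv hη hc, sub_self])
    refine ⟨fun x => C + ∫ t in (0 : ℝ)..x, w t, ⟨hl w, fun a b => ?_⟩, ?_⟩
    · have := h0.sub_eq a b
      linear_combination this
    · filter_upwards [hC] with x hx
      rw [← hx]
      ring
  · rintro ⟨V, hV, hv⟩ η hη hc
    rw [← hV.integral_mul_deriv hη hc]
    refine integral_congr_ae ?_
    filter_upwards [hv] with x hx
    rw [hx]

theorem IsPrimitive.mem_graph_derivR {V w : ℝ → ℂ} (h : IsPrimitive V w) (hV : MemLp V 2 volume)
    (hw : MemLp w 2 volume) : (hV.toLp V, hw.toLp w) ∈ derivR.graph := by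
  rw [Ostrovsky.mem_graph_derivR, isWeakDerivR_iff]
  exact ⟨V, h.congr hw.coeFn_toLp.symm, hV.coeFn_toLp⟩

/-- `g(R) - g(-R)` converges to `∫ g'` as `R → ∞` and is integrable in `R`; an integrable function
with a limit at infinity has limit zero. -/
theorem integral_eq_zero_of_isPrimitive {g g' : ℝ → ℂ} (h : IsPrimitive g g') (hg : Integrable g)
    (hg' : Integrable g') : ∫ x, g' x = 0 := by
  have h1 : Tendsto (fun R : ℝ => g R - g (-R)) atTop (𝓝 (∫ x, g' x)) := by
    have := intervalIntegral_tendsto_integral hg' tendsto_neg_atTop_atBot tendsto_id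
    simp only [← h.sub_eq] at this
    exact this
  have h2 : Integrable fun R : ℝ => g R - g (-R) := hg.sub hg.comp_neg
  refine (h2.integrableAtFilter atTop).eq_zero_of_tendsto (fun s hs => ?_) h1
  obtain ⟨a, ha⟩ := mem_atTop_sets.1 hs
  rw [← top_le_iff, ← Real.volume_Ici (a := a)]
  exact measure_mono ha

/-- `w v̄` has an absolutely continuous representative and is integrable together with its
derivative, so the integral of the derivative vanishes. -/
theorem skew_derivR {v v' w w' : L2R} (hv : (v, v') ∈ derivR.graph) (hw : (w, w') ∈ derivR.graph) :
    inner ℂ v' w = -inner ℂ v w' := by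
  rw [mem_graph_derivR, isWeakDerivR_iff] at hv hw
  obtain ⟨V, hV, hv⟩ := hv
  obtain ⟨W, hW, hw⟩ := hw
  have hi : ∀ a b : L2R, Integrable fun x => inner ℂ (a x) (b x) := fun a b =>
    L2.integrable_inner a b
  have h1 := hW.mul hV.conj
  have e1 : (fun x => inner ℂ (v x) (w x)) =ᵐ[volume] fun x => W x * starRingEnd ℂ (V x) := by
    filter_upwards [hv, hw] with x h1 h2
    rw [h1, h2, RCLike.inner_apply]
  have e2 : (fun x => inner ℂ (v x) (w' x) + inner ℂ (v' x) (w x)) =ᵐ[volume]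
      fun x => w' x * starRingEnd ℂ (V x) + W x * starRingEnd ℂ (v' x) := by
    filter_upwards [hv, hw] with x h1 h2
    rw [h1, h2, RCLike.inner_apply, RCLike.inner_apply]
  have h2 := integral_eq_zero_of_isPrimitive h1 ((hi v w).congr e1)
    (((hi v w').add (hi v' w)).congr e2)
  rw [← integral_congr_ae e2, integral_add (hi v w') (hi v' w)] at h2
  rw [L2.inner_def, L2.inner_def]
  linear_combination h2

/-- Conjugates of test functions belong to the domain, and on them the adjoint relation is the
definition of the weak derivative. -/
theorem mem_graph_derivR_of_adjoint {w w' : L2R}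
    (h : ∀ v v', (v, v') ∈ derivR.graph → inner ℂ v' w = -inner ℂ v w') :
    (w, w') ∈ derivR.graph := by
  rw [mem_graph_derivR]
  intro η hη hc
  have hcη' : Continuous (deriv η) := hη.continuous_deriv (by simp)
  have h1 : IsPrimitive η (deriv η) := IsPrimitive.of_hasDerivAt
    (fun x => (hη.differentiable (by simp) x).hasDerivAt) hcη'
  have hm1 : MemLp (fun x => starRingEnd ℂ (η x)) 2 :=
    (Complex.continuous_conj.comp hη.continuous).memLp_of_hasCompactSupport
      (hc.comp_left (g := starRingEnd ℂ) (map_zero _))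
  have hm2 : MemLp (fun x => starRingEnd ℂ (deriv η x)) 2 :=
    (Complex.continuous_conj.comp hcη').memLp_of_hasCompactSupport
      (hc.deriv.comp_left (g := starRingEnd ℂ) (map_zero _))
  have h2 := h _ _ (h1.conj.mem_graph_derivR hm1 hm2)
  rw [L2.inner_def, L2.inner_def] at h2
  have e1 : ∫ x, inner ℂ (hm2.toLp _ x) (w x) = ∫ x, w x * deriv η x := by
    refine integral_congr_ae ?_
    filter_upwards [hm2.coeFn_toLp] with x hx
    rw [hx, RCLike.inner_apply, RingHomCompTriple.comp_apply, RingHom.id_apply]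
  have e2 : ∫ x, inner ℂ (hm1.toLp _ x) (w' x) = ∫ x, w' x * η x := by
    refine integral_congr_ae ?_
    filter_upwards [hm1.coeFn_toLp] with x hx
    rw [hx, RCLike.inner_apply, RingHomCompTriple.comp_apply, RingHom.id_apply]
  rw [← e1, ← e2, h2]

theorem exists_skewResolvent_derivR : ∃ Rp Rm : L2R →L[ℂ] L2R, SkewResolvent derivR Rp Rm := by
  refine exists_skewResolvent ?_ skew_derivR fun w w' h => mem_graph_derivR_of_adjoint h
  -- Skew-adjointness presents the graph as an intersection of closed conditions, so it is closed.
  have : (derivR.graph : Set (L2R × L2R)) = ⋂ p : derivR.graph,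
      {q | inner ℂ p.1.2 q.1 = -inner ℂ p.1.1 q.2} := by
    ext ⟨w, w'⟩
    simp only [Set.mem_iInter, SetLike.mem_coe]
    exact ⟨fun h p => skew_derivR p.2 h,
      fun h => mem_graph_derivR_of_adjoint fun v v' hv => h ⟨_, hv⟩⟩
  rw [this]
  exact isClosed_iInter fun p => isClosed_eq (by fun_prop) (by fun_prop)

end LineDerivative

/-! ### Linear differential equations with bounded continuous coefficients -/

section LinearODE

variable {E : Type*} [NormedAddCommGroup E] [NormedSpace ℂ E] [CompleteSpace E]

/-- The Picard iterates of the linear equation `Φ' = A Φ`, `Φ(0) = 1`. -/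
def picardIterate (A : ℝ → E →L[ℂ] E) : ℕ → ℝ → E →L[ℂ] E
  | 0 => fun _ => 1
  | n + 1 => fun t => ∫ s in (0 : ℝ)..t, A s * picardIterate A n s

variable {A : ℝ → E →L[ℂ] E}

omit [CompleteSpace E] in
theorem continuous_picardIterate (hA : Continuous A) (n : ℕ) : Continuous (picardIterate A n) := by
  induction n with
  | zero => exact continuous_const
  | succ n ih =>
    exact intervalIntegral.continuous_primitive
      (fun a b => (hA.mul ih).intervalIntegrable a b) 0

theorem hasDerivAt_picardIterate (hA : Continuous A) (n : ℕ) (t : ℝ) :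
    HasDerivAt (picardIterate A (n + 1)) (A t * picardIterate A n t) t :=
  ((hA.mul (continuous_picardIterate hA n)).integral_hasStrictDerivAt 0 t).hasDerivAt

omit [CompleteSpace E] in
theorem norm_picardIterate_le (hA : Continuous A) {K : ℝ} (hK : ∀ t, ‖A t‖ ≤ K) (n : ℕ) (t : ℝ) :
    ‖picardIterate A n t‖ ≤ (K * |t|) ^ n / n.factorial := by
  have hK0 : 0 ≤ K := (norm_nonneg _).trans (hK 0)
  induction n generalizing t with
  | zero =>
    rw [pow_zero, Nat.factorial_zero, Nat.cast_one, div_one]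
    exact ContinuousLinearMap.norm_id_le
  | succ n ih =>
    have hc : Continuous fun s => A s * picardIterate A n s :=
      hA.mul (continuous_picardIterate hA n)
    calc ‖picardIterate A (n + 1) t‖
        ≤ ∫ s in Set.uIoc 0 t, ‖A s * picardIterate A n s‖ :=
          intervalIntegral.norm_integral_le_integral_norm_uIoc
      _ ≤ ∫ s in Set.uIoc 0 t, K ^ (n + 1) / n.factorial * |s - 0| ^ n := by
          refine setIntegral_mono_on (intervalIntegrable_iff.1 (hc.norm.intervalIntegrable 0 t))
            (intervalIntegrable_iff.1 (Continuous.intervalIntegrable (by fun_prop) 0 t))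
            measurableSet_uIoc fun s _ => ?_
          refine (norm_mul_le _ _).trans ((mul_le_mul (hK s) (ih s) (norm_nonneg _) hK0).trans
            (le_of_eq ?_))
          rw [sub_zero, mul_pow, pow_succ]
          ring
      _ = (K * |t|) ^ (n + 1) / (n + 1).factorial := by
          rw [integral_const_mul, integral_pow_abs_sub_uIoc, sub_zero, Nat.factorial_succ, mul_pow]
          push_cast
          field_simp

/-- The fundamental solution of a linear equation with bounded continuous coefficients. -/
theorem exists_flow (hA : Continuous A) {K : ℝ} (hK : ∀ t, ‖A t‖ ≤ K) :
    ∃ Φ : ℝ → E →L[ℂ] E, Φ 0 = 1 ∧ ∀ t, HasDerivAt Φ (A t * Φ t) t := by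
  have hK0 : 0 ≤ K := (norm_nonneg _).trans (hK 0)
  have hsum : ∀ t, Summable fun n => picardIterate A n t := fun t =>
    Summable.of_norm_bounded (Real.summable_pow_div_factorial (K * |t|))
      fun n => norm_picardIterate_le hA hK n t
  have h0 : ∀ n, picardIterate A (n + 1) 0 = 0 := fun n => intervalIntegral.integral_same
  refine ⟨fun t => ∑' n, picardIterate A n t, ?_, fun t => ?_⟩
  · simp only [(hsum 0).tsum_eq_zero_add, h0, tsum_zero, add_zero]
    rfl
  · have h1 : (fun t => ∑' n, picardIterate A n t) =
        fun t => 1 + ∑' n, picardIterate A (n + 1) t := by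
      funext s
      rw [(hsum s).tsum_eq_zero_add]
      rfl
    simp only
    rw [h1, ← (hsum t).tsum_mul_left]
    refine HasDerivAt.const_add _ ?_
    -- A ball containing both 0 and `t`, on which the differentiated series is dominated by an
    -- exponential series.
    set R := |t| + 1 with hR
    have hb : ∀ n, ∀ y ∈ Metric.ball (0 : ℝ) R,
        ‖A y * picardIterate A n y‖ ≤ K * ((K * R) ^ n / n.factorial) := fun n y hy => by
      rw [mem_ball_zero_iff, Real.norm_eq_abs] at hy
      have h2 : (K * |y|) ^ n / n.factorial ≤ (K * R) ^ n / n.factorial := by gcongr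
      exact (norm_mul_le _ _).trans (mul_le_mul (hK y)
        ((norm_picardIterate_le hA hK n y).trans h2) (norm_nonneg _) hK0)
    have h3 : Summable fun n => picardIterate A (n + 1) 0 := by
      simp only [h0]
      exact summable_zero
    have h4 : t ∈ Metric.ball (0 : ℝ) R := by
      rw [mem_ball_zero_iff, Real.norm_eq_abs, hR]
      linarith
    exact hasDerivAt_tsum_of_isPreconnected (g := fun n => picardIterate A (n + 1))
      (g' := fun n y => A y * picardIterate A n y)
      ((Real.summable_pow_div_factorial (K * R)).mul_left K) Metric.isOpen_ball
      (convex_ball 0 R).isPreconnected (fun n y _ => hasDerivAt_picardIterate hA n y)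
      hb (Metric.mem_ball_self (by positivity)) h3 h4

variable {Φ : ℝ → E →L[ℂ] E}

omit [CompleteSpace E] in
theorem hasDerivAt_flow_apply (hΦ : ∀ t, HasDerivAt Φ (A t * Φ t) t) (e : E) (t : ℝ) :
    HasDerivAt (fun t => Φ t e) (A t (Φ t e)) t := by
  have h1 : HasDerivAt (fun t => (ContinuousLinearMap.apply ℂ E e) (Φ t))
      ((ContinuousLinearMap.apply ℂ E e) (A t * Φ t)) t :=
    ((ContinuousLinearMap.apply ℂ E e).restrictScalars ℝ).hasFDerivAt.comp_hasDerivAt t (hΦ t)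
  exact h1

omit [CompleteSpace E] in
/-- Solutions of the homogeneous equation are determined by their value at `0`. -/
theorem eq_of_hasDerivAt {K : ℝ} (hK : ∀ t, ‖A t‖ ≤ K) {Y Z : ℝ → E}
    (hY : ∀ t, HasDerivAt Y (A t (Y t)) t) (hZ : ∀ t, HasDerivAt Z (A t (Z t)) t)
    (h0 : Y 0 = Z 0) : Y = Z := by
  have hK0 : 0 ≤ K := (norm_nonneg _).trans (hK 0)
  refine ODE_solution_unique_univ (v := fun t x => A t x) (s := fun _ => Set.univ) (K := ⟨K, hK0⟩)
    (fun t => ?_) (fun t => ⟨hY t, Set.mem_univ _⟩) (fun t => ⟨hZ t, Set.mem_univ _⟩) h0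
  refine ((A t).lipschitz.weaken ?_).lipschitzOnWith
  exact hK t

omit [CompleteSpace E] in
theorem eq_flow_apply {K : ℝ} (hK : ∀ t, ‖A t‖ ≤ K) (hΦ0 : Φ 0 = 1)
    (hΦ : ∀ t, HasDerivAt Φ (A t * Φ t) t) {Y : ℝ → E} (hY : ∀ t, HasDerivAt Y (A t (Y t)) t)
    (t : ℝ) : Y t = Φ t (Y 0) :=
  congrFun (eq_of_hasDerivAt hK hY (hasDerivAt_flow_apply hΦ (Y 0)) (by rw [hΦ0]; rfl)) t

omit [CompleteSpace E] in
/-- Comparison of a solution of the inhomogeneous equation with the flow. -/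
theorem norm_sub_flow_le {K ε : ℝ} (hK1 : 1 ≤ K) (hK : ∀ t, ‖A t‖ ≤ K) (hΦ0 : Φ 0 = 1)
    (hΦ : ∀ t, HasDerivAt Φ (A t * Φ t) t) {Y F : ℝ → E} (hε : 0 ≤ ε)
    (hF : ∀ t ∈ Set.Icc (0 : ℝ) 1, ‖F t‖ ≤ ε)
    (hY : ∀ t, HasDerivAt Y (A t (Y t) + F t) t) {t : ℝ} (ht : t ∈ Set.Icc (0 : ℝ) 1) :
    ‖Y t - Φ t (Y 0)‖ ≤ Real.exp K * ε := by
  have hd : ∀ t, HasDerivAt (fun t => Y t - Φ t (Y 0)) (A t (Y t - Φ t (Y 0)) + F t) t := by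
    intro t
    refine ((hY t).sub (hasDerivAt_flow_apply hΦ (Y 0) t)).congr_deriv ?_
    rw [map_sub]
    abel
  have h1 := norm_le_gronwallBound_of_norm_deriv_right_le (δ := 0) (K := K) (ε := ε) (a := 0)
    (b := 1) (f := fun t => Y t - Φ t (Y 0))
    (fun t _ => (hd t).continuousAt.continuousWithinAt) (fun t _ => (hd t).hasDerivWithinAt)
    (by rw [hΦ0]; simp) (fun t ht => (norm_add_le _ _).trans
      (add_le_add ((A t).le_of_opNorm_le (hK t) _) (hF t ⟨ht.1, ht.2.le⟩))) t ht
  refine h1.trans ?_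
  rw [gronwallBound_of_K_ne_0 (by positivity), sub_zero]
  simp only [zero_mul, zero_add]
  have h2 : Real.exp (K * t) ≤ Real.exp K := Real.exp_le_exp.2 (by nlinarith [ht.2])
  -- Here `1 ≤ K` is needed: it replaces Gronwall's `(ε/K)(e^{Kt} - 1)` by `e^K ε`.
  have h3 : ε / K ≤ ε := div_le_self hε hK1
  have h4 : 0 ≤ Real.exp (K * t) - 1 := by
    have := Real.one_le_exp (mul_nonneg (zero_le_one.trans hK1) ht.1)
    linarith
  calc ε / K * (Real.exp (K * t) - 1) ≤ ε * (Real.exp K) := by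
        refine mul_le_mul h3 (by linarith) h4 hε
    _ = _ := mul_comm _ _

end LinearODE

/-! ### Finite-dimensional recurrences in `ℓ²(ℤ)` -/

section Recurrence

open Module Module.End

/-- The minimal polynomial splits over `ℂ` and its roots are eigenvalues. The list form lets factors
be peeled off one by one. -/
theorem exists_eigenvalue_list {E : Type*} [AddCommGroup E] [Module ℂ E] [FiniteDimensional ℂ E]
    (M : End ℂ E) : ∃ l : List ℂ, (∀ μ ∈ l, M.HasEigenvalue μ) ∧
      (l.map fun μ => M - μ • (1 : End ℂ E)).prod = 0 := by
  have hm : (minpoly ℂ M).Monic := minpoly.monic (Algebra.IsIntegral.isIntegral M)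
  refine ⟨(minpoly ℂ M).roots.toList, fun μ hμ => ?_, ?_⟩
  · rw [Multiset.mem_toList] at hμ
    exact hasEigenvalue_of_isRoot (Polynomial.isRoot_of_mem_roots hμ)
  · have h1 := (IsAlgClosed.splits (minpoly ℂ M)).eq_prod_roots_of_monic hm
    have h2 := minpoly.aeval ℂ M
    rw [h1, ← Multiset.coe_toList (minpoly ℂ M).roots, Multiset.map_coe, Multiset.prod_coe,
      map_list_prod, List.map_map] at h2
    rw [← h2]
    congr 1
    refine List.map_congr_left fun μ _ => ?_
    simp [Algebra.algebraMap_eq_smul_one]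

section Abstract

variable {L : Type*} [NormedAddCommGroup L] [NormedSpace ℂ L]

/-- Let `P` be the product without its first factor. It commutes with `S` and `M`, so `S(Py) = M(Py)
= μPy`; as `S` has no eigenvectors, `Py = 0`, and the list has become shorter. -/
theorem eq_zero_of_prod_eq_zero {S M : End ℂ L} (hS : ∀ (μ : ℂ) u, S u = μ • u → u = 0)
    (hc : Commute S M) {y : L} (hy : S y = M y) (l : List ℂ)
    (h : (l.map fun μ => M - μ • (1 : End ℂ L)).prod y = 0) : y = 0 := by
  induction l with
  | nil => simpa using h
  | cons μ l ih =>
    refine ih (hS μ _ ?_)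
    set P := (l.map fun μ => M - μ • (1 : End ℂ L)).prod with hP
    have hPS : Commute S P := Commute.list_prod_right _ _ fun x hx => by
      obtain ⟨ν, -, rfl⟩ := List.mem_map.1 hx
      exact hc.sub_right ((Commute.one_right S).smul_right ν)
    have hPM : Commute M P := Commute.list_prod_right _ _ fun x hx => by
      obtain ⟨ν, -, rfl⟩ := List.mem_map.1 hx
      exact (Commute.refl M).sub_right ((Commute.one_right M).smul_right ν)
    have h1 : S (P y) = M (P y) := by
      have e1 : S (P y) = P (S y) := LinearMap.congr_fun hPS y
      have e2 : M (P y) = P (M y) := LinearMap.congr_fun hPM y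
      rw [e1, e2, hy]
    rw [h1]
    rw [List.map_cons, List.prod_cons, Module.End.mul_apply] at h
    exact sub_eq_zero.1 h

/-- Quantitative form of the same peeling: for an isometry, `‖Su - μu‖ ≥ |1 - |μ|| ‖u‖`, so each
factor with `|μ| ≠ 1` can be removed with control of constants and of the defect `Sy - My`. -/
theorem exists_bound_of_prod {S M : L →L[ℂ] L} (hS : ∀ u, ‖S u‖ = ‖u‖) (hc : Commute S M)
    (l : List ℂ) (hl : ∀ μ ∈ l, ‖μ‖ ≠ 1) : ∃ C, ∀ y,
      ‖y‖ ≤ C * (‖(l.map fun μ => M - μ • (1 : L →L[ℂ] L)).prod y‖ + ‖S y - M y‖) := by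
  induction l with
  | nil => exact ⟨1, fun y => by simp⟩
  | cons μ l ih =>
    obtain ⟨C, hC⟩ := ih fun ν hν => hl ν (List.mem_cons_of_mem _ hν)
    set P := (l.map fun μ => M - μ • (1 : L →L[ℂ] L)).prod with hP
    have hμ : 0 < |1 - ‖μ‖| := abs_pos.2 (sub_ne_zero.2 (hl μ List.mem_cons_self).symm)
    have hPS : Commute S P := Commute.list_prod_right _ _ fun x hx => by
      obtain ⟨ν, -, rfl⟩ := List.mem_map.1 hx
      exact hc.sub_right ((Commute.one_right S).smul_right ν)
    have hPM : Commute M P := Commute.list_prod_right _ _ fun x hx => by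
      obtain ⟨ν, -, rfl⟩ := List.mem_map.1 hx
      exact (Commute.refl M).sub_right ((Commute.one_right M).smul_right ν)
    set δ := |1 - ‖μ‖| with hδ
    refine ⟨|C| * (δ⁻¹ * (1 + ‖P‖) + 1), fun y => ?_⟩
    rw [List.map_cons, List.prod_cons]
    set a := ‖((M - μ • (1 : L →L[ℂ] L)) * P) y‖ with ha
    set b := ‖S y - M y‖ with hb
    have ha0 : 0 ≤ a := norm_nonneg _
    have hb0 : 0 ≤ b := norm_nonneg _
    have h1 : δ * ‖P y‖ ≤ ‖P‖ * b + a := by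
      have e1 : S (P y) = P (S y) := DFunLike.congr_fun hPS y
      have e2 : M (P y) = P (M y) := DFunLike.congr_fun hPM y
      have e3 : δ * ‖P y‖ ≤ ‖S (P y) - μ • P y‖ := by
        have := abs_norm_sub_norm_le (S (P y)) (μ • P y)
        rwa [hS, norm_smul, ← one_sub_mul, abs_mul, abs_norm] at this
      have e4 : S (P y) - μ • P y = P (S y - M y) + ((M - μ • (1 : L →L[ℂ] L)) * P) y := by
        have e5 : ((M - μ • (1 : L →L[ℂ] L)) * P) y = M (P y) - μ • P y := rfl
        rw [e5, map_sub, e1, e2]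
        abel
      rw [e4] at e3
      exact e3.trans ((norm_add_le _ _).trans (add_le_add_left (P.le_opNorm _) _))
    have h2 : ‖P y‖ ≤ δ⁻¹ * (1 + ‖P‖) * (a + b) := by
      rw [mul_assoc, ← div_eq_inv_mul, le_div_iff₀ hμ, mul_comm]
      nlinarith [norm_nonneg P, mul_nonneg (norm_nonneg P) ha0]
    have h3 := hC y
    have h4 : C * (‖P y‖ + b) ≤ |C| * (‖P y‖ + b) :=
      mul_le_mul_of_nonneg_right (le_abs_self C) (by positivity)
    calc ‖y‖ ≤ |C| * (‖P y‖ + b) := h3.trans h4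
      _ ≤ |C| * (δ⁻¹ * (1 + ‖P‖) * (a + b) + (a + b)) := by
        gcongr
        linarith
      _ = |C| * (δ⁻¹ * (1 + ‖P‖) + 1) * (a + b) := by ring

end Abstract

variable {E : Type*} [NormedAddCommGroup E] [NormedSpace ℂ E]

/-- Square summable two-sided sequences. -/
abbrev SeqSpace (E : Type*) [NormedAddCommGroup E] : Type _ := lp (fun _ : ℤ => E) 2

omit [NormedSpace ℂ E] in
theorem memℓp_iff_summable_sq {y : ℤ → E} : Memℓp y 2 ↔ Summable fun n => ‖y n‖ ^ 2 := by
  rw [memℓp_gen_iff (by norm_num)]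
  simp

omit [NormedSpace ℂ E] in
theorem norm_sq_seqSpace (y : SeqSpace E) : ‖y‖ ^ 2 = ∑' n, ‖y n‖ ^ 2 := by
  have := lp.norm_rpow_eq_tsum (p := 2) (by norm_num) y
  simpa using this

/-- The shift. -/
def seqShift (E : Type*) [NormedAddCommGroup E] [NormedSpace ℂ E] :
    SeqSpace E →ₗᵢ[ℂ] SeqSpace E where
  toFun y := ⟨fun n => y (n + 1), memℓp_iff_summable_sq.2
    ((memℓp_iff_summable_sq.1 (lp.memℓp y)).comp_injective (add_left_injective 1))⟩
  map_add' _ _ := rfl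
  map_smul' _ _ := rfl
  norm_map' y := by
    rw [← sq_eq_sq₀ (norm_nonneg _) (norm_nonneg _), norm_sq_seqSpace, norm_sq_seqSpace]
    exact (Equiv.addRight (1 : ℤ)).tsum_eq (fun n => ‖y n‖ ^ 2)

/-- The coordinatewise action of an operator. -/
def seqMap (M : E →L[ℂ] E) : SeqSpace E →L[ℂ] SeqSpace E :=
  LinearMap.mkContinuous
    { toFun := fun y => ⟨fun n => M (y n), memℓp_iff_summable_sq.2 (by
        refine Summable.of_nonneg_of_le (fun n => sq_nonneg _) (fun n => ?_)
          ((memℓp_iff_summable_sq.1 (lp.memℓp y)).mul_left (‖M‖ ^ 2))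
        rw [← mul_pow]
        gcongr
        exact M.le_opNorm _)⟩
      map_add' := fun y z => Subtype.ext (funext fun n => map_add M _ _)
      map_smul' := fun a y => Subtype.ext (funext fun n => map_smul M _ _) }
    ‖M‖ (by
      intro y
      have h1 := memℓp_iff_summable_sq.1 (lp.memℓp y)
      rw [← sq_le_sq₀ (norm_nonneg _) (by positivity), mul_pow, norm_sq_seqSpace, norm_sq_seqSpace,
        ← tsum_mul_left]
      have h2 : ∀ n, ‖M (y n)‖ ^ 2 ≤ ‖M‖ ^ 2 * ‖y n‖ ^ 2 := fun n => by
        rw [← mul_pow]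
        gcongr
        exact M.le_opNorm _
      exact Summable.tsum_le_tsum h2 (Summable.of_nonneg_of_le (fun n => sq_nonneg _) h2
        (h1.mul_left _)) (h1.mul_left _))

theorem seqShift_apply (y : SeqSpace E) (n : ℤ) : seqShift E y n = y (n + 1) := rfl

theorem prod_seqMap_apply (M : E →L[ℂ] E) (l : List ℂ) (y : SeqSpace E) (n : ℤ) :
    (l.map fun μ => seqMap M - μ • (1 : SeqSpace E →L[ℂ] SeqSpace E)).prod y n =
      (l.map fun μ => (M : End ℂ E) - μ • (1 : End ℂ E)).prod (y n) := by
  induction l generalizing y with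
  | nil => rfl
  | cons μ l ih =>
    rw [List.map_cons, List.prod_cons, List.map_cons, List.prod_cons, Module.End.mul_apply, ← ih]
    rfl

/-- The shift is isometric, so `|μ| = 1` and `‖u n‖` does not depend on `n`; square summability
leaves only zero. -/
theorem eq_zero_of_seqShift_eq_smul {μ : ℂ} {u : SeqSpace E} (h : seqShift E u = μ • u) :
    u = 0 := by
  by_contra hu
  have h1 : ‖μ‖ = 1 := by
    have h2 := congrArg norm h
    rw [LinearIsometry.norm_map, norm_smul] at h2
    exact (mul_right_cancel₀ (norm_ne_zero_iff.2 hu) (by rw [one_mul]; exact h2)).symm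
  have h2 : ∀ n : ℤ, ‖u (n + 1)‖ = ‖u n‖ := fun n => by
    have : u (n + 1) = μ • u n := by
      rw [← seqShift_apply, h]
      rfl
    rw [this, norm_smul, h1, one_mul]
  have h3 : ∀ n : ℤ, ‖u n‖ = ‖u 0‖ := fun n => by
    induction n using Int.induction_on with
    | zero => rfl
    | succ i hi => rw [h2, hi]
    | pred i hi => rw [← h2, sub_add_cancel, hi]
  have h4 := memℓp_iff_summable_sq.1 (lp.memℓp u)
  simp only [h3] at h4
  rw [summable_const_iff] at h4
  refine hu (lp.ext (funext fun n => ?_))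
  have h5 : ‖u 0‖ = 0 := by simpa using h4
  exact norm_eq_zero.1 ((h3 n).trans h5)

theorem commute_seqShift_seqMap (M : E →L[ℂ] E) :
    Commute (seqShift E).toContinuousLinearMap (seqMap M) :=
  ContinuousLinearMap.ext fun _ => Subtype.ext rfl

/-- A linear recurrence has no nontrivial square summable two-sided solutions. -/
theorem eq_zero_of_recurrence [FiniteDimensional ℂ E] {M : E →L[ℂ] E} {y : ℤ → E}
    (hy : Summable fun n => ‖y n‖ ^ 2) (h : ∀ n, y (n + 1) = M (y n)) (n : ℤ) : y n = 0 := by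
  obtain ⟨l, -, hl⟩ := exists_eigenvalue_list (M : End ℂ E)
  let Y : SeqSpace E := ⟨y, memℓp_iff_summable_sq.2 hy⟩
  have hprod : (l.map fun μ => seqMap M - μ • (1 : SeqSpace E →L[ℂ] SeqSpace E)).prod Y = 0 := by
    refine lp.ext (funext fun n => ?_)
    rw [prod_seqMap_apply, hl]
    rfl
  -- The recurrence says that the shift and `M` agree on `Y`, while the minimal polynomial of `M`
  -- kills `Y`.
  have h0 : Y = 0 := by
    refine eq_zero_of_prod_eq_zero (S := ((seqShift E).toLinearMap : End ℂ (SeqSpace E)))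
      (M := (seqMap M : End ℂ (SeqSpace E)))
      (fun μ u hu => eq_zero_of_seqShift_eq_smul hu)
      (LinearMap.ext fun _ => Subtype.ext rfl) (lp.ext (funext h)) l ?_
    rw [← hprod]
    clear hprod hl
    generalize Y = Z
    induction l generalizing Z with
    | nil => rfl
    | cons μ l ih =>
      rw [List.map_cons, List.prod_cons, List.map_cons, List.prod_cons, Module.End.mul_apply, ih]
      rfl
  exact congrFun (congrArg Subtype.val h0) n

/-- A hyperbolic linear recurrence controls square summable sequences. -/
theorem exists_bound_recurrence [FiniteDimensional ℂ E] {M : E →L[ℂ] E}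
    (hM : ∀ (μ : ℂ) e, ‖μ‖ = 1 → M e = μ • e → e = 0) : ∃ C, ∀ y : ℤ → E,
      Summable (fun n => ‖y n‖ ^ 2) → Summable (fun n => ‖y (n + 1) - M (y n)‖ ^ 2) ∧
      ∑' n, ‖y n‖ ^ 2 ≤ C * ∑' n, ‖y (n + 1) - M (y n)‖ ^ 2 := by
  obtain ⟨l, hl1, hl⟩ := exists_eigenvalue_list (M : End ℂ E)
  obtain ⟨C, hC⟩ := exists_bound_of_prod (S := (seqShift E).toContinuousLinearMap) (M := seqMap M)
    (fun u => (seqShift E).norm_map u) (commute_seqShift_seqMap M) l (fun μ hμ h1 => by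
      obtain ⟨e, he⟩ := (hl1 μ hμ).exists_hasEigenvector
      exact he.2 (hM μ e h1 he.apply_eq_smul))
  refine ⟨C ^ 2, fun y hy => ?_⟩
  let Y : SeqSpace E := ⟨y, memℓp_iff_summable_sq.2 hy⟩
  have hprod : (l.map fun μ => seqMap M - μ • (1 : SeqSpace E →L[ℂ] SeqSpace E)).prod Y = 0 := by
    refine lp.ext (funext fun n => ?_)
    rw [prod_seqMap_apply, hl]
    rfl
  have h1 := hC Y
  rw [hprod, norm_zero, zero_add] at h1
  refine ⟨memℓp_iff_summable_sq.1 (lp.memℓp (seqShift E Y - seqMap M Y)), ?_⟩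
  have h2 := pow_le_pow_left₀ (norm_nonneg _) h1 2
  rw [mul_pow, norm_sq_seqSpace, norm_sq_seqSpace] at h2
  exact h2

end Recurrence

/-! ### Sobolev estimates on unit intervals -/

section UnitIntervals

theorem sq_integral_le {f : ℝ → ℝ} {a : ℝ} (hf : IntervalIntegrable f volume a (a + 1))
    (hf2 : IntervalIntegrable (fun x => f x ^ 2) volume a (a + 1)) :
    (∫ x in a..a + 1, f x) ^ 2 ≤ ∫ x in a..a + 1, f x ^ 2 := by
  set I := ∫ x in a..a + 1, f x with hI
  have h1 : 0 ≤ ∫ x in a..a + 1, (f x - I) ^ 2 :=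
    intervalIntegral.integral_nonneg (by linarith) fun x _ => sq_nonneg _
  have h2 : ∀ x, (f x - I) ^ 2 = f x ^ 2 - 2 * I * f x + I ^ 2 := fun x => by ring
  simp only [h2] at h1
  rw [intervalIntegral.integral_add (hf2.sub (hf.const_mul _)) (by simp),
    intervalIntegral.integral_sub hf2 (hf.const_mul _), intervalIntegral.integral_const_mul, ← hI,
    intervalIntegral.integral_const] at h1
  simp only [add_sub_cancel_left, one_smul] at h1
  linarith [h1, sq I]

/-- The Sobolev inequality on intervals of length one. -/
theorem IsPrimitive.norm_sq_le {V w : ℝ → ℂ} (h : IsPrimitive V w) {a : ℝ}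
    (hw : IntervalIntegrable (fun x => ‖w x‖ ^ 2) volume a (a + 1)) {s : ℝ}
    (hs : s ∈ Set.Icc a (a + 1)) :
    ‖V s‖ ^ 2 ≤ 2 * ∫ x in a..a + 1, (‖V x‖ ^ 2 + ‖w x‖ ^ 2) := by
  have hw1 : ∀ s t, IntervalIntegrable (fun x => ‖w x‖) volume s t := fun s t =>
    (h.intervalIntegrable s t).norm
  have hV : IntervalIntegrable (fun x => ‖V x‖ ^ 2) volume a (a + 1) :=
    (h.continuous.norm.pow 2).intervalIntegrable _ _
  set I := ∫ x in a..a + 1, ‖w x‖ with hI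
  -- Averaging this over `t` and using `I² ≤ ∫ ‖w‖²` gives the estimate.
  have h1 : ∀ t ∈ Set.Icc a (a + 1), ‖V s‖ ^ 2 ≤ 2 * ‖V t‖ ^ 2 + 2 * I ^ 2 := by
    intro t ht
    have h2 : ‖V s - V t‖ ≤ I := by
      rw [h.sub_eq]
      refine intervalIntegral.norm_integral_le_integral_norm_uIoc.trans ?_
      rw [hI, intervalIntegral.integral_of_le (by linarith)]
      refine setIntegral_mono_set ?_ (Filter.Eventually.of_forall fun x => norm_nonneg _) ?_
      · rw [← intervalIntegrable_iff_integrableOn_Ioc_of_le (by linarith)]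
        exact hw1 _ _
      · refine Filter.Eventually.of_forall fun x hx => ?_
        rcases Set.mem_uIoc.1 hx with hx | hx
        · exact ⟨lt_of_le_of_lt ht.1 hx.1, hx.2.trans hs.2⟩
        · exact ⟨lt_of_le_of_lt hs.1 hx.1, hx.2.trans ht.2⟩
    have h3 : ‖V s‖ ≤ ‖V t‖ + I := by
      have := norm_add_le (V t) (V s - V t)
      rw [add_sub_cancel] at this
      linarith
    nlinarith [norm_nonneg (V s), sq_nonneg (‖V t‖ - I), norm_nonneg (V t)]
  have h2 : ∫ _ in a..a + 1, ‖V s‖ ^ 2 ≤ ∫ t in a..a + 1, (2 * ‖V t‖ ^ 2 + 2 * I ^ 2) :=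
    intervalIntegral.integral_mono_on (by linarith) (by simp)
      ((hV.const_mul 2).add (by simp)) h1
  rw [intervalIntegral.integral_add (hV.const_mul 2) (by simp),
    intervalIntegral.integral_const_mul, intervalIntegral.integral_const,
    intervalIntegral.integral_const] at h2
  simp only [add_sub_cancel_left, one_smul] at h2
  rw [intervalIntegral.integral_add hV hw]
  have h3 := sq_integral_le (hw1 a (a + 1)) hw
  linarith

theorem hasSum_intervalIntegral_int {h : ℝ → ℝ} (hi : Integrable h) :
    HasSum (fun n : ℤ => ∫ x in (n : ℝ)..(n : ℝ) + 1, h x) (∫ x, h x) := by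
  simpa using hi.hasSum_intervalIntegral 0

theorem integrable_norm_sq (v : L2R) : Integrable fun x => ‖v x‖ ^ 2 :=
  (Lp.memLp v).integrable_norm_pow (by norm_num)

theorem integral_norm_sq (v : L2R) : ∫ x, ‖v x‖ ^ 2 = ‖v‖ ^ 2 := by
  have h1 := L2.inner_def (𝕜 := ℂ) v v
  have h2 : ∀ x, inner ℂ (v x) (v x) = ((‖v x‖ ^ 2 : ℝ) : ℂ) := fun x => by
    rw [inner_self_eq_norm_sq_to_K]
    norm_cast
  simp only [h2] at h1
  rw [integral_complex_ofReal] at h1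
  rw [← inner_self_eq_norm_sq (𝕜 := ℂ) v, h1]
  rfl

end UnitIntervals

/-! ### The first-order system in `ℂ⁴` -/

section System

/-- The phase space of the first order system for `(v, v', q, q')`. -/
abbrev Phase : Type := ℂ × ℂ × ℂ × ℂ

/-- The constant part of the coefficient matrix of the first order system. -/
def systemConst (γ β k c : ℝ) (z : ℂ) : Phase →L[ℂ] Phase :=
  LinearMap.toContinuousLinearMap
    { toFun := fun y => (y.2.1, ((β : ℂ) * (k : ℂ) ^ 2)⁻¹ * ((c : ℂ) * y.1 - y.2.2.1), y.2.2.2,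
        ((k : ℂ) ^ 2)⁻¹ * (z * k * y.2.1 - (γ : ℂ) * y.1))
      map_add' := fun x y => by ext <;> simp <;> ring
      map_smul' := fun a y => by ext <;> simp <;> ring }

/-- The part of the coefficient matrix multiplying `φ`. -/
def systemPot (β k : ℝ) : Phase →L[ℂ] Phase :=
  LinearMap.toContinuousLinearMap
    { toFun := fun y => (0, -((β : ℂ) * (k : ℂ) ^ 2)⁻¹ * y.1, 0, 0)
      map_add' := fun x y => by ext <;> simp; ring
      map_smul' := fun a y => by ext <;> simp; ring }

/-- The coefficient matrix of the first order system. -/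
def systemOp (γ β k c : ℝ) (z : ℂ) (φ : ℝ → ℝ) (x : ℝ) : Phase →L[ℂ] Phase :=
  systemConst γ β k c z + (φ x : ℂ) • systemPot β k

theorem systemOp_apply (γ β k c : ℝ) (z : ℂ) (φ : ℝ → ℝ) (x : ℝ) (y : Phase) :
    systemOp γ β k c z φ x y =
      (y.2.1, ((β : ℂ) * (k : ℂ) ^ 2)⁻¹ * (((c : ℂ) - (φ x : ℂ)) * y.1 - y.2.2.1), y.2.2.2,
        ((k : ℂ) ^ 2)⁻¹ * (z * k * y.2.1 - (γ : ℂ) * y.1)) := by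
  change systemConst γ β k c z y + (φ x : ℂ) • systemPot β k y = _
  ext <;> simp [systemConst, systemPot]
  ring

theorem continuous_systemOp (γ β k c : ℝ) (z : ℂ) {φ : ℝ → ℝ} (hφ : Continuous φ) :
    Continuous (systemOp γ β k c z φ) :=
  continuous_const.add ((Complex.continuous_ofReal.comp hφ).smul continuous_const)

theorem exists_bound_systemOp (γ β k c : ℝ) (z : ℂ) {φ : ℝ → ℝ} (hφ : Continuous φ)
    (hper : Function.Periodic φ 1) : ∃ K, 1 ≤ K ∧ ∀ x, ‖systemOp γ β k c z φ x‖ ≤ K := by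
  obtain ⟨C, hC⟩ := exists_bound_of_periodic hφ hper
  refine ⟨max 1 (‖systemConst γ β k c z‖ + C * ‖systemPot β k‖), le_max_left _ _, fun x =>
    le_trans ?_ (le_max_right _ _)⟩
  refine (norm_add_le _ _).trans (add_le_add_right ?_ _)
  rw [norm_smul]
  exact mul_le_mul_of_nonneg_right (hC x) (norm_nonneg _)

theorem systemOp_add_int (γ β k c : ℝ) (z : ℂ) {φ : ℝ → ℝ} (hper : Function.Periodic φ 1)
    (x : ℝ) (n : ℤ) : systemOp γ β k c z φ (n + x) = systemOp γ β k c z φ x := by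
  have h := hper.int_mul n x
  rw [mul_one] at h
  rw [systemOp, systemOp, add_comm (n : ℝ), h]

theorem phase_norm_sq_le (y : Phase) :
    ‖y‖ ^ 2 ≤ ‖y.1‖ ^ 2 + ‖y.2.1‖ ^ 2 + ‖y.2.2.1‖ ^ 2 + ‖y.2.2.2‖ ^ 2 := by
  have h : ∀ {a b A B : ℝ}, 0 ≤ a → 0 ≤ b → a ^ 2 ≤ A → b ^ 2 ≤ B → (max a b) ^ 2 ≤ A + B := by
    intro a b A B ha hb hA hB
    rcases max_choice a b with h | h <;> rw [h] <;> nlinarith [sq_nonneg a, sq_nonneg b]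
  rw [Prod.norm_def, Prod.norm_def, Prod.norm_def, add_assoc, add_assoc]
  exact h (norm_nonneg _) (by positivity) le_rfl (h (norm_nonneg _) (by positivity) le_rfl
    (h (norm_nonneg _) (norm_nonneg _) le_rfl le_rfl))

/-- A classical solution of the first order system with forcing `g`. -/
def IsSystemSolution (γ β k c : ℝ) (z : ℂ) (φ : ℝ → ℝ) (Y : ℝ → Phase) (g : ℝ → ℂ) : Prop :=
  ∀ x, HasDerivAt Y (systemOp γ β k c z φ x (Y x) +
    (0, ((β : ℂ) * (k : ℂ) ^ 2)⁻¹ * g x, 0, g x)) x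

end System

/-! ### From the pencil on the line to classical solutions -/

section LineSolutions

variable {V : ℝ → ℂ} {v w : L2R}

theorem IsPrimitive.hasSum_energy (hv : v =ᵐ[volume] V) :
    HasSum (fun n : ℤ => ∫ x in (n : ℝ)..(n : ℝ) + 1, (‖V x‖ ^ 2 + ‖w x‖ ^ 2))
      (‖v‖ ^ 2 + ‖w‖ ^ 2) := by
  have e : (fun x => ‖v x‖ ^ 2 + ‖w x‖ ^ 2) =ᵐ[volume] fun x => ‖V x‖ ^ 2 + ‖w x‖ ^ 2 := by
    filter_upwards [hv] with x hx
    rw [hx]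
  have h1 := hasSum_intervalIntegral_int
    (((integrable_norm_sq v).add (integrable_norm_sq w)).congr e)
  rwa [← integral_congr_ae e, integral_add (integrable_norm_sq v) (integrable_norm_sq w),
    integral_norm_sq, integral_norm_sq] at h1

theorem IsPrimitive.norm_sq_le_energy (h : IsPrimitive V w) (n : ℤ) {s : ℝ}
    (hs : s ∈ Set.Icc (n : ℝ) (n + 1)) :
    ‖V s‖ ^ 2 ≤ 2 * ∫ x in (n : ℝ)..(n : ℝ) + 1, (‖V x‖ ^ 2 + ‖w x‖ ^ 2) :=
  h.norm_sq_le (integrable_norm_sq w).intervalIntegrable hs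

/-- Each sample is controlled by the `H¹` energy of its unit interval, and these energies add up to
the `H¹` norm. -/
theorem IsPrimitive.summable_sq_int (h : IsPrimitive V w) (hv : v =ᵐ[volume] V) :
    Summable fun n : ℤ => ‖V n‖ ^ 2 :=
  Summable.of_nonneg_of_le (fun n => sq_nonneg _)
    (fun n => h.norm_sq_le_energy n ⟨le_rfl, by linarith⟩)
    ((hasSum_energy (w := w) hv).summable.mul_left 2)

/-- `Y` and `g` represent elements of `L²(ℝ)` with weak derivatives in `L²(ℝ)`. -/
structure IsSobolevData (Y : ℝ → Phase) (g : ℝ → ℂ) (v p G G' : L2R) : Prop where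
  fst : (fun x => (Y x).1) =ᵐ[volume] v
  thd : (fun x => (Y x).2.2.1) =ᵐ[volume] p
  forcing : G =ᵐ[volume] g
  primitive : IsPrimitive g G'
  summable : Summable fun n : ℤ => ‖Y n‖ ^ 2

/-- Solutions of the pencil equation on the line are classical solutions of a first order system
with continuous forcing. -/
theorem IsSolution.exists_systemSolution {Rp Rm : L2R →L[ℂ] L2R}
    (hD : SkewResolvent derivR Rp Rm) {φ : ℝ → ℝ} (hφ : Continuous φ)
    (hper : Function.Periodic φ 1) {γ β k c : ℝ} (hβ : β ≠ 0) (hk : k ≠ 0) {z : ℂ}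
    {v q f : L2R} (h : IsSolution derivR (mulR hφ hper) γ β k c z v q f) :
    ∃ Y g, IsSystemSolution γ β k c z φ Y g ∧
      IsSobolevData Y g v (q + ((k : ℂ) ^ 2)⁻¹ • Rp (Rm f)) (((k : ℂ) ^ 2)⁻¹ • Rp (Rm f))
        (((k : ℂ) ^ 2)⁻¹ • derivInv Rp Rm f) := by
  obtain ⟨v1, v2, q1, q2, hv1, hv2, hq, hq1, hq2, hf⟩ := h
  have hk2 : (k : ℂ) ^ 2 ≠ 0 := pow_ne_zero _ (Complex.ofReal_ne_zero.2 hk)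
  have hβk : (β : ℂ) * (k : ℂ) ^ 2 ≠ 0 := mul_ne_zero (Complex.ofReal_ne_zero.2 hβ) hk2
  -- The datum `f` is merely `L²`. Replacing `q` by `p = q + G`, with `G = k⁻²(D² - 1)⁻¹f`, cancels
  -- `f` in the equation for `p''` and leaves only the continuous `G` as forcing, both there and in
  -- the equation for `v''`, where `q = p - G`.
  set G := ((k : ℂ) ^ 2)⁻¹ • Rp (Rm f) with hG
  set G1 := ((k : ℂ) ^ 2)⁻¹ • derivInv Rp Rm f with hG1
  have hg1 : (G, G1) ∈ derivR.graph := derivR.graph.smul_mem _ (hD.inv_mem f)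
  have hg2 : (G1, ((k : ℂ) ^ 2)⁻¹ • (f + Rp (Rm f))) ∈ derivR.graph :=
    derivR.graph.smul_mem _ (hD.derivInv_mem f)
  have hp1 : (q + G, q1 + G1) ∈ derivR.graph := derivR.graph.add_mem hq1 hg1
  have hp2 : (q1 + G1, q2 + ((k : ℂ) ^ 2)⁻¹ • (f + Rp (Rm f))) ∈ derivR.graph :=
    derivR.graph.add_mem hq2 hg2
  have e2 : v2 = ((β : ℂ) * (k : ℂ) ^ 2)⁻¹ • ((c : ℂ) • v - mulR hφ hper v - (q + G) + G) := by
    rw [hq, eq_inv_smul_iff₀ hβk]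
    abel
  have e4 : q2 + ((k : ℂ) ^ 2)⁻¹ • (f + Rp (Rm f)) =
      ((k : ℂ) ^ 2)⁻¹ • ((z * k) • v1 - (γ : ℂ) • v) + G := by
    have hf' : (z * k) • v1 - (γ : ℂ) • v = f + ((k : ℂ) ^ 2) • q2 := by
      rw [hf]
      abel
    rw [hf', hG, ← smul_add, eq_inv_smul_iff₀ hk2, smul_add, smul_inv_smul₀ hk2]
    abel
  obtain ⟨V, hV, hvV⟩ := isWeakDerivR_iff.1 (mem_graph_derivR.1 hv1)
  obtain ⟨V1, hV1, hvV1⟩ := isWeakDerivR_iff.1 (mem_graph_derivR.1 hv2)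
  obtain ⟨P, hP, hpP⟩ := isWeakDerivR_iff.1 (mem_graph_derivR.1 hp1)
  obtain ⟨P1, hP1, hpP1⟩ := isWeakDerivR_iff.1 (mem_graph_derivR.1 hp2)
  obtain ⟨g, hg, hgG⟩ := isWeakDerivR_iff.1 (mem_graph_derivR.1 hg1)
  have e2' : v2 =ᵐ[volume] fun x => ((β : ℂ) * (k : ℂ) ^ 2)⁻¹ *
      (((c : ℂ) - (φ x : ℂ)) * V x - P x + g x) := by
    rw [e2]
    filter_upwards [hvV, hpP, hgG, coeFn_mulR hφ hper v,
      Lp.coeFn_smul (((β : ℂ) * (k : ℂ) ^ 2)⁻¹) ((c : ℂ) • v - mulR hφ hper v - (q + G) + G),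
      Lp.coeFn_add ((c : ℂ) • v - mulR hφ hper v - (q + G)) G,
      Lp.coeFn_sub ((c : ℂ) • v - mulR hφ hper v) (q + G),
      Lp.coeFn_sub ((c : ℂ) • v) (mulR hφ hper v), Lp.coeFn_smul (c : ℂ) v]
      with x h1 h2 h3 h4 h5 h6 h7 h8 h9
    rw [h5, Pi.smul_apply, h6, Pi.add_apply, h7, Pi.sub_apply, h8, Pi.sub_apply, h9, Pi.smul_apply,
      h4, h1, h2, h3, smul_eq_mul, smul_eq_mul]
    ring
  have e4' : (q2 + ((k : ℂ) ^ 2)⁻¹ • (f + Rp (Rm f)) : L2R) =ᵐ[volume] fun x =>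
      ((k : ℂ) ^ 2)⁻¹ * (z * k * V1 x - (γ : ℂ) * V x) + g x := by
    rw [e4]
    filter_upwards [hvV, hvV1, hgG, Lp.coeFn_add (((k : ℂ) ^ 2)⁻¹ • ((z * k) • v1 - (γ : ℂ) • v)) G,
      Lp.coeFn_smul (((k : ℂ) ^ 2)⁻¹) ((z * k) • v1 - (γ : ℂ) • v),
      Lp.coeFn_sub ((z * k) • v1) ((γ : ℂ) • v), Lp.coeFn_smul (z * k) v1,
      Lp.coeFn_smul (γ : ℂ) v] with x h1 h2 h3 h4 h5 h6 h7 h8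
    rw [h4, Pi.add_apply, h5, Pi.smul_apply, h6, Pi.sub_apply, h7, h8, Pi.smul_apply, Pi.smul_apply,
      h1, h2, h3, smul_eq_mul, smul_eq_mul, smul_eq_mul]
  have hφc : Continuous fun x => (φ x : ℂ) := Complex.continuous_ofReal.comp hφ
  have cV := hV.continuous
  have cV1 := hV1.continuous
  have cP := hP.continuous
  have cg := hg.continuous
  have d1 := (hV.congr hvV1).hasDerivAt cV1
  have d2 := (hV1.congr e2').hasDerivAt (by fun_prop)
  have d3 := (hP.congr hpP1).hasDerivAt hP1.continuous
  have d4 := (hP1.congr e4').hasDerivAt (by fun_prop)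
  refine ⟨fun x => (V x, V1 x, P x, P1 x), g, fun x => ?_, hvV.symm, hpP.symm, hgG, hg, ?_⟩
  · refine ((d1 x).prodMk ((d2 x).prodMk ((d3 x).prodMk (d4 x)))).congr_deriv ?_
    rw [systemOp_apply]
    ext <;> simp
    ring
  · refine Summable.of_nonneg_of_le (fun n => sq_nonneg _) (fun n => phase_norm_sq_le _) ?_
    exact (((hV.summable_sq_int hvV).add (hV1.summable_sq_int hvV1)).add
      (hP.summable_sq_int hpP)).add (hP1.summable_sq_int hpP1)

end LineSolutions

/-! ### Sampling at the integers: uniqueness and bounds -/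

section LineEstimates

theorem systemForcing_norm_le (a g : ℂ) :
    ‖((0, a * g, 0, g) : Phase)‖ ≤ max ‖a‖ 1 * ‖g‖ := by
  have h1 : ‖a * g‖ ≤ max ‖a‖ 1 * ‖g‖ := by
    rw [norm_mul]
    exact mul_le_mul_of_nonneg_right (le_max_left _ _) (norm_nonneg _)
  have h2 : ‖g‖ ≤ max ‖a‖ 1 * ‖g‖ := le_mul_of_one_le_left (norm_nonneg _) (le_max_right _ _)
  have h0 : ‖(0 : ℂ)‖ ≤ max ‖a‖ 1 * ‖g‖ := by
    rw [norm_zero]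
    positivity
  exact norm_prod_le_iff.2 ⟨h0, norm_prod_le_iff.2 ⟨h1, norm_prod_le_iff.2 ⟨h0, h2⟩⟩⟩

variable {γ β k c : ℝ} {z : ℂ} {φ : ℝ → ℝ} {Φ : ℝ → Phase →L[ℂ] Phase}
  {Y : ℝ → Phase} {g : ℝ → ℂ} {v p G G' : L2R}

/-- The energy of the forcing over the `n`-th period. -/
def energy (g : ℝ → ℂ) (G' : L2R) (n : ℤ) : ℝ :=
  ∫ x in (n : ℝ)..(n : ℝ) + 1, (‖g x‖ ^ 2 + ‖G' x‖ ^ 2)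

theorem energy_nonneg (g : ℝ → ℂ) (G' : L2R) (n : ℤ) : 0 ≤ energy g G' n :=
  intervalIntegral.integral_nonneg (by linarith) fun x _ => by positivity

theorem IsSobolevData.hasSum_energy (h : IsSobolevData Y g v p G G') :
    HasSum (energy g G') (‖G‖ ^ 2 + ‖G'‖ ^ 2) :=
  IsPrimitive.hasSum_energy h.forcing

/-- By periodicity the same flow on `[0, 1]` serves every period. Gronwall bounds the deviation by
the supremum of the forcing, which the Sobolev inequality bounds by the energy on that period. -/
theorem IsSystemSolution.norm_sub_flow_sq_le (hper : Function.Periodic φ 1) {K : ℝ} (hK1 : 1 ≤ K)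
    (hK : ∀ x, ‖systemOp γ β k c z φ x‖ ≤ K) (hΦ0 : Φ 0 = 1)
    (hΦ : ∀ t, HasDerivAt Φ (systemOp γ β k c z φ t * Φ t) t)
    (hY : IsSystemSolution γ β k c z φ Y g) (h : IsSobolevData Y g v p G G') (n : ℤ) {t : ℝ}
    (ht : t ∈ Set.Icc (0 : ℝ) 1) :
    ‖Y (n + t) - Φ t (Y n)‖ ^ 2 ≤
      2 * (Real.exp K * max ‖((β : ℂ) * (k : ℂ) ^ 2)⁻¹‖ 1) ^ 2 * energy g G' n := by
  set a := ((β : ℂ) * (k : ℂ) ^ 2)⁻¹ with ha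
  have hb : 0 ≤ max ‖a‖ 1 := by positivity
  have hE := energy_nonneg g G' n
  have h1 := norm_sub_flow_le (Y := fun t => Y (n + t))
    (F := fun t => (0, a * g (n + t), 0, g (n + t))) hK1 hK hΦ0 hΦ
    (ε := max ‖a‖ 1 * Real.sqrt (2 * energy g G' n)) (by positivity) (fun s hs => by
      refine (systemForcing_norm_le _ _).trans (mul_le_mul_of_nonneg_left ?_ hb)
      exact Real.le_sqrt_of_sq_le (h.primitive.norm_sq_le_energy n
        ⟨by linarith [hs.1], by linarith [hs.2]⟩)) (fun s => by
      have h2 := (hY (n + s)).comp_const_add (n : ℝ) s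
      rw [systemOp_add_int _ _ _ _ _ hper] at h2
      exact h2) ht
  rw [add_zero] at h1
  have h2 := pow_le_pow_left₀ (norm_nonneg _) h1 2
  rw [mul_pow, mul_pow, Real.sq_sqrt (by positivity)] at h2
  rw [mul_pow]
  linarith

/-- There are no nontrivial square integrable solutions of the homogeneous system. -/
theorem IsSystemSolution.eq_zero (hper : Function.Periodic φ 1) {K : ℝ} (hK1 : 1 ≤ K)
    (hK : ∀ x, ‖systemOp γ β k c z φ x‖ ≤ K) (hΦ0 : Φ 0 = 1)
    (hΦ : ∀ t, HasDerivAt Φ (systemOp γ β k c z φ t * Φ t) t)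
    (hY : IsSystemSolution γ β k c z φ Y g) (h : IsSobolevData Y g v p 0 0) : Y = 0 := by
  have hE : ∀ n, energy g 0 n = 0 := by
    have h1 := h.hasSum_energy
    rw [norm_zero] at h1
    simp only [ne_eq, OfNat.ofNat_ne_zero, not_false_eq_true, zero_pow, add_zero] at h1
    exact fun n => congrFun ((hasSum_zero_iff_of_nonneg (energy_nonneg g 0)).1 h1) n
  have hflow : ∀ (n : ℤ), ∀ t ∈ Set.Icc (0 : ℝ) 1, Y (n + t) = Φ t (Y n) := fun n t ht => by
    have h1 := hY.norm_sub_flow_sq_le hper hK1 hK hΦ0 hΦ h n ht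
    rw [hE, mul_zero] at h1
    have h2 : ‖Y (n + t) - Φ t (Y n)‖ = 0 := by
      nlinarith [norm_nonneg (Y (n + t) - Φ t (Y n))]
    exact sub_eq_zero.1 (norm_eq_zero.1 h2)
  -- With no forcing the samples satisfy an exact recurrence with the monodromy.
  have h0 : ∀ n : ℤ, Y n = 0 := eq_zero_of_recurrence (M := Φ 1) h.summable fun n => by
    have := hflow n 1 ⟨zero_le_one, le_rfl⟩
    push_cast
    exact this
  funext x
  have h1 := hflow ⌊x⌋ (Int.fract x) ⟨Int.fract_nonneg x, (Int.fract_lt_one x).le⟩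
  rw [Int.floor_add_fract, h0, map_zero] at h1
  exact h1

/-- Hyperbolicity of the monodromy bounds square integrable solutions by the forcing. -/
theorem exists_bound_systemSolution (hper : Function.Periodic φ 1) {K : ℝ} (hK1 : 1 ≤ K)
    (hK : ∀ x, ‖systemOp γ β k c z φ x‖ ≤ K) (hΦ0 : Φ 0 = 1)
    (hΦ : ∀ t, HasDerivAt Φ (systemOp γ β k c z φ t * Φ t) t)
    (hM : ∀ (μ : ℂ) e, ‖μ‖ = 1 → Φ 1 e = μ • e → e = 0) :
    ∃ C, 0 ≤ C ∧ ∀ Y g (v p G G' : L2R), IsSystemSolution γ β k c z φ Y g →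
      IsSobolevData Y g v p G G' →
      ‖v‖ ^ 2 ≤ C * (‖G‖ ^ 2 + ‖G'‖ ^ 2) ∧ ‖p‖ ^ 2 ≤ C * (‖G‖ ^ 2 + ‖G'‖ ^ 2) := by
  obtain ⟨C, hC⟩ := exists_bound_recurrence hM
  obtain ⟨B, hB⟩ := isCompact_Icc.exists_bound_of_continuousOn (s := Set.Icc (0 : ℝ) 1) (f := Φ)
    fun t _ => (hΦ t).continuousAt.continuousWithinAt
  set b := 2 * (Real.exp K * max ‖((β : ℂ) * (k : ℂ) ^ 2)⁻¹‖ 1) ^ 2 with hb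
  have hb0 : 0 ≤ b := by positivity
  refine ⟨2 * B ^ 2 * (|C| * b) + 2 * b, by positivity, fun Y g v p G G' hY h => ?_⟩
  have hE := h.hasSum_energy
  set D := ‖G‖ ^ 2 + ‖G'‖ ^ 2 with hD
  have hflow : ∀ (n : ℤ), ∀ t ∈ Set.Icc (0 : ℝ) 1,
      ‖Y (n + t) - Φ t (Y n)‖ ^ 2 ≤ b * energy g G' n := fun n t ht =>
    hY.norm_sub_flow_sq_le hper hK1 hK hΦ0 hΦ h n ht
  obtain ⟨hs1, hs2⟩ := hC (fun n : ℤ => Y n) h.summable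
  -- The defect of the recurrence is summed period by period; hyperbolicity then bounds the samples,
  -- and the flow carries the bound into the interior of each period.
  have hs3 : ∑' n : ℤ, ‖Y ((n + 1 : ℤ) : ℝ) - Φ 1 (Y n)‖ ^ 2 ≤ b * D := by
    rw [← hE.tsum_eq, ← tsum_mul_left]
    refine Summable.tsum_le_tsum (fun n => ?_) hs1 (hE.summable.mul_left b)
    have := hflow n 1 ⟨zero_le_one, le_rfl⟩
    push_cast
    exact this
  have hs4 : ∑' n : ℤ, ‖Y n‖ ^ 2 ≤ |C| * (b * D) :=
    hs2.trans ((mul_le_mul_of_nonneg_right (le_abs_self C)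
      (tsum_nonneg fun n => sq_nonneg _)).trans (mul_le_mul_of_nonneg_left hs3 (abs_nonneg C)))
  have hpt : ∀ (n : ℤ), ∀ x ∈ Set.Icc (n : ℝ) (n + 1),
      ‖Y x‖ ^ 2 ≤ 2 * B ^ 2 * ‖Y n‖ ^ 2 + 2 * b * energy g G' n := by
    intro n x hx
    have ht : x - n ∈ Set.Icc (0 : ℝ) 1 := ⟨by linarith [hx.1], by linarith [hx.2]⟩
    have h1 := hflow n _ ht
    rw [add_sub_cancel] at h1
    have h2 : ‖Φ (x - n) (Y n)‖ ^ 2 ≤ B ^ 2 * ‖Y n‖ ^ 2 := by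
      rw [← mul_pow]
      exact pow_le_pow_left₀ (norm_nonneg _) (ContinuousLinearMap.le_of_opNorm_le _ (hB _ ht) _) 2
    have h3 : ‖Y x‖ ≤ ‖Φ (x - n) (Y n)‖ + ‖Y x - Φ (x - n) (Y n)‖ := by
      have := norm_add_le (Φ (x - n) (Y n)) (Y x - Φ (x - n) (Y n))
      rwa [add_sub_cancel] at this
    nlinarith [norm_nonneg (Y x), sq_nonneg (‖Φ (x - n) (Y n)‖ - ‖Y x - Φ (x - n) (Y n)‖)]
  have hsum : HasSum (fun n : ℤ => 2 * B ^ 2 * ‖Y n‖ ^ 2 + 2 * b * energy g G' n)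
      (2 * B ^ 2 * (∑' n : ℤ, ‖Y n‖ ^ 2) + 2 * b * D) :=
    (h.summable.hasSum.mul_left _).add (hE.mul_left _)
  have hcomp : ∀ (a : L2R) (W : ℝ → ℂ), (fun x => W x) =ᵐ[volume] a → (∀ x, ‖W x‖ ≤ ‖Y x‖) →
      ‖a‖ ^ 2 ≤ (2 * B ^ 2 * (|C| * b) + 2 * b) * D := by
    intro a W ha hW
    have h1 := hasSum_intervalIntegral_int (integrable_norm_sq a)
    rw [integral_norm_sq] at h1
    have h2 : ‖a‖ ^ 2 ≤ 2 * B ^ 2 * (∑' n : ℤ, ‖Y n‖ ^ 2) + 2 * b * D := by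
      refine hasSum_le (fun n : ℤ => ?_) h1 hsum
      set m := 2 * B ^ 2 * ‖Y n‖ ^ 2 + 2 * b * energy g G' n with hm
      have h3 : ∫ x in (n : ℝ)..(n : ℝ) + 1, ‖a x‖ ^ 2 ≤ ∫ _ in (n : ℝ)..(n : ℝ) + 1, m := by
        refine intervalIntegral.integral_mono_ae_restrict (by linarith)
          (integrable_norm_sq a).intervalIntegrable (by simp) ?_
        rw [Filter.EventuallyLE, ae_restrict_iff' measurableSet_Icc]
        filter_upwards [ha] with x hx hx1
        rw [← hx]
        exact (pow_le_pow_left₀ (norm_nonneg _) (hW x) 2).trans (hpt n x hx1)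
      simpa using h3
    refine h2.trans ?_
    have h4 := mul_le_mul_of_nonneg_left hs4 (by positivity : 0 ≤ 2 * B ^ 2)
    linarith
  exact ⟨hcomp v _ h.fst fun x => norm_fst_le _, hcomp p _ h.thd fun x =>
    (norm_fst_le _).trans ((norm_snd_le _).trans (norm_snd_le _))⟩

end LineEstimates

/-! ### Closed and dense range gives surjectivity -/

section ClosedRange

open Filter Topology

variable {X : Type*} [NormedAddCommGroup X] [InnerProductSpace ℂ X]
  {D : X →ₗ.[ℂ] X} {Rp Rm : X →L[ℂ] X}

theorem IsSolution.add_smul {m : X →L[ℂ] X} {γ β k c : ℝ} {z a : ℂ} {v v' q q' f f' : X}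
    (h : IsSolution D m γ β k c z v q f) (h' : IsSolution D m γ β k c z v' q' f') :
    IsSolution D m γ β k c z (v + a • v') (q + a • q') (f + a • f') := by
  obtain ⟨v1, v2, q1, q2, h1, h2, rfl, h3, h4, rfl⟩ := h
  obtain ⟨w1, w2, p1, p2, g1, g2, rfl, g3, g4, rfl⟩ := h'
  have key : ∀ {x x' y y' : X}, (x, x') ∈ D.graph → (y, y') ∈ D.graph →
      (x + a • y, x' + a • y') ∈ D.graph := fun h h' =>
    D.graph.add_mem h (D.graph.smul_mem a h')
  refine ⟨_, _, _, _, key h1 g1, key h2 g2, ?_, key h3 g3, key h4 g4, ?_⟩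
  · rw [map_add, map_smul]
    module
  · module

/-- A pencil that is bounded below and has dense range is surjective. -/
theorem exists_isSolution_of_bound [CompleteSpace X] (hD : SkewResolvent D Rp Rm)
    (m : X →L[ℂ] X) {γ β k c : ℝ} (hβ : β ≠ 0) (hk : k ≠ 0) {z : ℂ} {C : ℝ}
    (hC : ∀ v q f, IsSolution D m γ β k c z v q f → ‖v‖ ≤ C * ‖f‖ ∧ ‖q‖ ≤ C * ‖f‖)
    (hdense : ∀ g, (∀ v q f, IsSolution D m γ β k c z v q f → inner ℂ f g = 0) → g = 0) (f : X) :
    ∃ v q, IsSolution D m γ β k c z v q f := by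
  have h0 : IsSolution D m γ β k c z 0 0 0 :=
    ⟨0, 0, 0, 0, D.graph.zero_mem, D.graph.zero_mem, by simp, D.graph.zero_mem, D.graph.zero_mem,
      by simp⟩
  let W : Submodule ℂ X :=
    { carrier := {f | ∃ v q, IsSolution D m γ β k c z v q f}
      zero_mem' := ⟨0, 0, h0⟩
      add_mem' := by
        rintro f g ⟨v, q, h⟩ ⟨v', q', h'⟩
        have := h.add_smul (a := 1) h'
        rw [one_smul, one_smul, one_smul] at this
        exact ⟨_, _, this⟩
      smul_mem' := by
        rintro a f ⟨v, q, h⟩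
        have := h0.add_smul (a := a) h
        rw [zero_add, zero_add, zero_add] at this
        exact ⟨_, _, this⟩ }
  have hcl : IsClosed (W : Set X) := by
    refine isClosed_of_closure_subset fun f hf => ?_
    obtain ⟨F, hF, hlim⟩ := mem_closure_iff_seq_limit.1 hf
    choose V Q hVQ using hF
    have hdist : ∀ i j, dist (V i, Q i) (V j, Q j) ≤ |C| * dist (F i) (F j) := by
      intro i j
      obtain ⟨h1, h2⟩ := hC _ _ _ ((hVQ i).sub (hVQ j))
      have h3 : C * ‖F i - F j‖ ≤ |C| * ‖F i - F j‖ :=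
        mul_le_mul_of_nonneg_right (le_abs_self C) (norm_nonneg _)
      rw [Prod.dist_eq, dist_eq_norm, dist_eq_norm, dist_eq_norm]
      exact max_le (h1.trans h3) (h2.trans h3)
    have hcau : CauchySeq fun i => (V i, Q i) := by
      have h1 := hlim.cauchySeq
      rw [Metric.cauchySeq_iff] at h1 ⊢
      intro ε hε
      obtain ⟨N, hN⟩ := h1 (ε / (|C| + 1)) (by positivity)
      refine ⟨N, fun i hi j hj => (hdist i j).trans_lt ?_⟩
      have h2 := hN i hi j hj
      rw [lt_div_iff₀ (by positivity)] at h2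
      nlinarith [dist_nonneg (x := F i) (y := F j), abs_nonneg C]
    obtain ⟨⟨v, q⟩, hvq⟩ := cauchySeq_tendsto_of_complete hcau
    refine ⟨v, q, (hD.isSolution_iff m γ c hβ hk z v q f).2 ?_⟩
    -- The bound makes `(V i, Q i)` Cauchy. The limit is taken in the fixed-point form, where all
    -- operators are bounded.
    have h1 := fun i => (hD.isSolution_iff m γ c hβ hk z (V i) (Q i) (F i)).1 (hVQ i)
    have hcont : Continuous fun f : X => ((0 : X), -(((k : ℂ) ^ 2)⁻¹ • Rp (Rm f))) := by fun_prop
    have h2 : Tendsto (fun i => fixedPointOp Rp Rm m γ β k c z (V i, Q i) +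
        ((0 : X), -(((k : ℂ) ^ 2)⁻¹ • Rp (Rm (F i))))) atTop
        (𝓝 (fixedPointOp Rp Rm m γ β k c z (v, q) + (0, -(((k : ℂ) ^ 2)⁻¹ • Rp (Rm f))))) :=
      (((fixedPointOp Rp Rm m γ β k c z).continuous.tendsto _).comp hvq).add
        ((hcont.tendsto _).comp hlim)
    simp only [← h1] at h2
    exact tendsto_nhds_unique hvq h2
  have hcomp : CompleteSpace W := hcl.completeSpace_coe
  have hW : W = ⊤ := by
    rw [← Submodule.orthogonal_eq_bot_iff, Submodule.eq_bot_iff]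
    intro g hg
    exact hdense g fun v q f h => (Submodule.mem_orthogonal W g).1 hg f ⟨v, q, h⟩
  have hf : f ∈ W := by
    rw [hW]
    trivial
  exact hf

end ClosedRange

/-! ### The pencil on the line -/

section LineSpectrum

variable {γ β k c : ℝ} (hγ : 0 < γ) (hβ : β ≠ 0) (hk : 0 < k)
  {φ : ℝ → ℝ} (hφ : ContDiff ℝ ∞ φ) (hper : Function.Periodic φ 1)

/-- `Φ` is the fundamental solution of the first order system. -/
structure IsSystemFlow (γ β k c : ℝ) (z : ℂ) (φ : ℝ → ℝ) (Φ : ℝ → Phase →L[ℂ] Phase) : Prop where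
  zero : Φ 0 = 1
  hasDerivAt : ∀ t, HasDerivAt Φ (systemOp γ β k c z φ t * Φ t) t

include hφ hper in
theorem exists_isSystemFlow (γ β k c : ℝ) (z : ℂ) : ∃ Φ, IsSystemFlow γ β k c z φ Φ := by
  obtain ⟨K, -, hK⟩ := exists_bound_systemOp γ β k c z hφ.continuous hper
  obtain ⟨Φ, h0, h1⟩ := exists_flow (continuous_systemOp γ β k c z hφ.continuous) hK
  exact ⟨Φ, h0, h1⟩

include hβ hk hφ hper in
-- For `f = 0` the forcing vanishes and the recurrence has no `ℓ²` solution. This holds at every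
-- `z`, so it excludes eigenvalues and also feeds the density argument at `-z̄`.
theorem eq_zero_of_isSolution_derivR {z : ℂ} {v q : L2R}
    (h : IsSolution derivR (mulR hφ.continuous hper) γ β k c z v q 0) : v = 0 := by
  obtain ⟨Rp, Rm, hD⟩ := exists_skewResolvent_derivR
  obtain ⟨K, hK1, hK⟩ := exists_bound_systemOp γ β k c z hφ.continuous hper
  obtain ⟨Φ, hΦ⟩ := exists_isSystemFlow hφ hper γ β k c z
  obtain ⟨Y, g, hY, hS⟩ := h.exists_systemSolution hD hφ.continuous hper hβ hk.ne'
  simp only [map_zero, smul_zero] at hS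
  have h0 := hY.eq_zero hper hK1 hK hΦ.zero hΦ.hasDerivAt hS
  refine Lp.ext ?_
  filter_upwards [hS.fst, Lp.coeFn_zero ℂ 2 (volume : Measure ℝ)] with x h1 h2
  rw [← h1, h2, h0]
  rfl

include hγ hβ hk hφ hper in
-- Hyperbolicity of the monodromy bounds solutions by data, so the range is closed; duality with the
-- injective pencil at `-z̄` makes it dense.
theorem boundedlyInvertible_of_hyperbolic {z : ℂ} {Φ : ℝ → Phase →L[ℂ] Phase}
    (hΦ : IsSystemFlow γ β k c z φ Φ) (hM : ∀ (μ : ℂ) e, ‖μ‖ = 1 → Φ 1 e = μ • e → e = 0) :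
    BoundedlyInvertible (z • opH k - opL φ γ β k c) := by
  obtain ⟨Rp, Rm, hD⟩ := exists_skewResolvent_derivR
  obtain ⟨K, hK1, hK⟩ := exists_bound_systemOp γ β k c z hφ.continuous hper
  obtain ⟨C, hC0, hC⟩ := exists_bound_systemSolution hper hK1 hK hΦ.zero hΦ.hasDerivAt hM
  set m := mulR hφ.continuous hper with hm
  set a := ‖((k : ℂ) ^ 2)⁻¹ • (Rp ∘L Rm)‖ with ha
  set b := ‖((k : ℂ) ^ 2)⁻¹ • derivInv Rp Rm‖ with hb
  -- The square root comes from the bound on `v` and `p = q + G`; the extra `a` is the price of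
  -- returning from `p` to `q`.
  have hbound : ∀ v q f, IsSolution derivR m γ β k c z v q f →
      ‖v‖ ≤ (Real.sqrt (C * (a ^ 2 + b ^ 2)) + a) * ‖f‖ ∧
        ‖q‖ ≤ (Real.sqrt (C * (a ^ 2 + b ^ 2)) + a) * ‖f‖ := by
    intro v q f h
    obtain ⟨Y, g, hY, hS⟩ := h.exists_systemSolution hD hφ.continuous hper hβ hk.ne'
    obtain ⟨h1, h2⟩ := hC _ _ _ _ _ _ hY hS
    set G := ((k : ℂ) ^ 2)⁻¹ • Rp (Rm f) with hG
    set G' := ((k : ℂ) ^ 2)⁻¹ • derivInv Rp Rm f with hG'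
    have hGn : ‖G‖ ≤ a * ‖f‖ := (((k : ℂ) ^ 2)⁻¹ • (Rp ∘L Rm)).le_opNorm f
    have hGn' : ‖G'‖ ≤ b * ‖f‖ := (((k : ℂ) ^ 2)⁻¹ • derivInv Rp Rm).le_opNorm f
    have h3 : C * (‖G‖ ^ 2 + ‖G'‖ ^ 2) ≤ (Real.sqrt (C * (a ^ 2 + b ^ 2)) * ‖f‖) ^ 2 := by
      rw [mul_pow, Real.sq_sqrt (by positivity), mul_assoc]
      refine mul_le_mul_of_nonneg_left ?_ hC0
      have := pow_le_pow_left₀ (norm_nonneg _) hGn 2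
      have := pow_le_pow_left₀ (norm_nonneg _) hGn' 2
      linarith [mul_pow a ‖f‖ 2, mul_pow b ‖f‖ 2, add_mul (a ^ 2) (b ^ 2) (‖f‖ ^ 2)]
    have h4 := le_of_sq_le_sq (h1.trans h3) (by positivity)
    have h5 := le_of_sq_le_sq (h2.trans h3) (by positivity)
    have h6 : 0 ≤ a * ‖f‖ := by positivity
    have h7 : ‖q‖ ≤ ‖q + G‖ + ‖G‖ := by
      have := norm_sub_le (q + G) G
      rwa [add_sub_cancel_right] at this
    rw [add_mul]
    exact ⟨by linarith, by linarith⟩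
  have hφ' : ContDiff ℝ ∞ (deriv φ) := (contDiff_infty_iff_deriv.1 hφ).2
  have hφ'' : Continuous (deriv (deriv φ)) := hφ'.continuous_deriv (by simp)
  have hsurj := exists_isSolution_of_bound hD m hβ hk.ne' hbound fun g hg =>
    eq_zero_of_orthogonal_range (m1 := mulR hφ'.continuous (periodic_deriv hper))
      (m2 := mulR hφ'' (periodic_deriv (periodic_deriv hper))) hD (inner_mulL_comm _ _)
      (fun h => leibniz_derivR hφ hper hφ'.continuous h)
      (fun h => leibniz_derivR hφ' (periodic_deriv hper) hφ'' h) hγ.ne' hβ hk.ne'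
      (fun v q h => eq_zero_of_isSolution_derivR hβ hk hφ hper h) hg
  exact boundedlyInvertible_of_bijective hD (mem_graph_mulOp _ _) γ c hβ hk.ne' z
    (fun v q h => eq_zero_of_isSolution_derivR hβ hk hφ hper h) hsurj

include hφ in
theorem mem_graph_linePencil (z : ℂ) (v f : L2R) :
    (v, f) ∈ (z • opH k - opL φ γ β k c).graph ↔
      ∃ q, IsSolution derivR (mulR hφ.continuous hper) γ β k c z v q f :=
  mem_graph_pencil (mem_graph_mulOp _ _) γ β k c z v f

include hβ hk hφ hper in
theorem not_isEigenvalue_line (z : ℂ) : ¬ IsEigenvalue (opL φ γ β k c) (opH k) z := by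
  rw [isEigenvalue_iff]
  rintro ⟨v, hv, h⟩
  obtain ⟨q, hq⟩ := (mem_graph_linePencil hφ hper z v 0).1 h
  exact hv (eq_zero_of_isSolution_derivR hβ hk hφ hper hq)

include hβ hk hφ hper in
/-- The spectrum on the line is purely essential. -/
theorem essentialSpectrum_line :
    essentialSpectrum (opL φ γ β k c) (opH k) = spectrum (opL φ γ β k c) (opH k) := by
  refine Set.Subset.antisymm (fun z hz => hz.1) fun z hz => ⟨hz, ?_⟩
  rintro ⟨hF, hi⟩
  obtain ⟨Rp, Rm, hD⟩ := exists_skewResolvent_derivR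
  set T := z • opH k - opL φ γ β k c with hT
  have hker : LinearMap.ker T.toFun = ⊥ := by
    rw [LinearMap.ker_eq_bot']
    intro x hx
    have h1 := T.mem_graph x
    rw [show T x = 0 from hx] at h1
    obtain ⟨q, hq⟩ := (mem_graph_linePencil hφ hper z _ 0).1 h1
    exact Subtype.ext (eq_zero_of_isSolution_derivR hβ hk hφ hper hq)
  -- With trivial kernel and index zero the cokernel is zero.
  have hrange : LinearMap.range T.toFun = ⊤ := by
    have := hF.finite_coker
    rw [fredholmIndex, hker, finrank_bot, Nat.cast_zero, zero_sub, neg_eq_zero, Nat.cast_eq_zero,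
      Module.finrank_zero_iff, Submodule.Quotient.subsingleton_iff] at hi
    exact hi
  refine hz (boundedlyInvertible_of_bijective hD (mem_graph_mulOp _ _) γ c hβ hk.ne' z
    (m := mulR hφ.continuous hper)
    (fun v q h => eq_zero_of_isSolution_derivR hβ hk hφ hper h) fun f => ?_)
  obtain ⟨x, hx⟩ := LinearMap.range_eq_top.1 hrange f
  have h1 := T.mem_graph x
  rw [show T x = f from hx] at h1
  obtain ⟨q, hq⟩ := (mem_graph_linePencil hφ hper z _ f).1 h1
  exact ⟨_, q, hq⟩

end LineSpectrum

/-! ### Quasi-periodic functions and their periodic parts -/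

section QuasiPeriodic

theorem ae_real_of_ae_circle {p : AddCircle (1 : ℝ) → Prop}
    (h : ∀ᵐ x ∂(AddCircle.haarAddCircle (T := (1 : ℝ))), p x) :
    ∀ᵐ x : ℝ, p (x : AddCircle (1 : ℝ)) := by
  rw [haarAddCircle_eq_volume] at h
  rw [← Measure.restrict_univ (μ := (volume : Measure ℝ)), ← iUnion_Ioc_intCast ℝ,
    ae_restrict_iUnion_iff]
  intro n
  exact (AddCircle.measurePreserving_mk (1 : ℝ) n).quasiMeasurePreserving.ae h

theorem locallyIntegrable_coe (w : L2per) :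
    LocallyIntegrable fun x : ℝ => w (x : AddCircle (1 : ℝ)) := by
  intro x
  refine ⟨Set.Ioc (x - 1 / 2) (x - 1 / 2 + 1), Ioc_mem_nhds (by linarith) (by linarith), ?_⟩
  have h1 : Integrable w (volume : Measure (AddCircle (1 : ℝ))) := by
    rw [← haarAddCircle_eq_volume]
    exact (Lp.memLp w).integrable (by norm_num)
  exact ((AddCircle.measurePreserving_mk (1 : ℝ) (x - 1 / 2)).integrable_comp_of_integrable h1)

/-- The factor `e^{i ξ x}`. -/
def blochFactor (ξ x : ℝ) : ℂ := Complex.exp (Complex.I * ξ * x)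

theorem blochFactor_add (ξ x y : ℝ) :
    blochFactor ξ (x + y) = blochFactor ξ x * blochFactor ξ y := by
  rw [blochFactor, blochFactor, blochFactor, ← Complex.exp_add]
  congr 1
  push_cast
  ring

theorem blochFactor_ne_zero (ξ x : ℝ) : blochFactor ξ x ≠ 0 := Complex.exp_ne_zero _

theorem norm_blochFactor (ξ x : ℝ) : ‖blochFactor ξ x‖ = 1 := by
  rw [blochFactor, show Complex.I * ξ * x = ((ξ * x : ℝ) : ℂ) * Complex.I by push_cast; ring]
  exact Complex.norm_exp_ofReal_mul_I _

theorem hasDerivAt_blochFactor (ξ x : ℝ) :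
    HasDerivAt (blochFactor ξ) (Complex.I * ξ * blochFactor ξ x) x := by
  have h1 : HasDerivAt (fun x : ℝ => Complex.I * ξ * (x : ℂ)) (Complex.I * ξ) x := by
    simpa using (Complex.ofRealCLM.hasDerivAt (x := x)).const_mul (Complex.I * ξ)
  refine h1.cexp.congr_deriv ?_
  rw [mul_comm, blochFactor]

theorem continuous_blochFactor (ξ : ℝ) : Continuous (blochFactor ξ) :=
  continuous_iff_continuousAt.2 fun x => (hasDerivAt_blochFactor ξ x).continuousAt

theorem isPrimitive_blochFactor (ξ : ℝ) :
    IsPrimitive (blochFactor ξ) (fun x => Complex.I * ξ * blochFactor ξ x) :=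
  IsPrimitive.of_hasDerivAt (hasDerivAt_blochFactor ξ)
    (continuous_const.mul (continuous_blochFactor ξ))

/-- A continuous periodic function as an element of `L²_per(0,1)`. -/
def toPer {W : ℝ → ℂ} (hc : Continuous W) (hp : Function.Periodic W 1) : L2per :=
  ContinuousMap.toLp 2 AddCircle.haarAddCircle ℂ ⟨hp.lift, continuous_lift hc hp⟩

theorem coeFn_toPer {W : ℝ → ℂ} (hc : Continuous W) (hp : Function.Periodic W 1) :
    toPer hc hp =ᵐ[AddCircle.haarAddCircle] hp.lift :=
  ContinuousMap.coeFn_toLp (𝕜 := ℂ) (p := 2) AddCircle.haarAddCircle _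

theorem toPer_eq_zero {W : ℝ → ℂ} (hc : Continuous W) (hp : Function.Periodic W 1)
    (h : toPer hc hp = 0) (x : ℝ) : W x = 0 := by
  have h1 : (⟨hp.lift, continuous_lift hc hp⟩ : C(AddCircle (1 : ℝ), ℂ)) = 0 := by
    refine ContinuousMap.toLp_injective (μ := AddCircle.haarAddCircle) (p := 2) (𝕜 := ℂ) ?_
    rw [map_zero]
    exact h
  exact DFunLike.congr_fun h1 (x : AddCircle (1 : ℝ))

theorem isWeakDerivPer_toPer {W : ℝ → ℂ} {w : L2per} (hp : Function.Periodic W 1)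
    (h : IsPrimitive W fun x => w (x : AddCircle (1 : ℝ))) :
    IsWeakDerivPer (toPer h.continuous hp) w := by
  intro η hη hper
  have hcη' : Continuous (deriv η) := hη.continuous_deriv (by simp)
  have h1 : IsPrimitive η (deriv η) := IsPrimitive.of_hasDerivAt
    (fun x => (hη.differentiable (by simp) x).hasDerivAt) hcη'
  have h2 := (h.mul h1).sub_eq 0 1
  have hp0 := hp 0
  have hη0 := hper 0
  rw [zero_add] at hp0 hη0
  simp only [hp0, hη0, sub_self] at h2
  have hi : IntervalIntegrable (fun x => W x * deriv η x) volume 0 1 :=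
    (h.continuous.mul hcη').intervalIntegrable _ _
  rw [intervalIntegral.integral_add (intervalIntegrable_mul w hη.continuous) hi] at h2
  have h3 : ∫ x in (0 : ℝ)..1, toPer h.continuous hp (x : AddCircle (1 : ℝ)) * deriv η x =
      ∫ x in (0 : ℝ)..1, W x * deriv η x := by
    refine intervalIntegral.integral_congr_ae ?_
    filter_upwards [ae_coe (coeFn_toPer h.continuous hp)] with x hx hx1
    rw [hx hx1, Function.Periodic.lift_coe]
  rw [h3]
  linear_combination -h2

/-- Weak derivatives on the circle are derivatives of periodic absolutely continuous
representatives. -/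
theorem IsWeakDerivPer.exists_isPrimitive {v w : L2per} (h : IsWeakDerivPer v w) :
    ∃ V : ℝ → ℂ, Function.Periodic V 1 ∧ (IsPrimitive V fun x => w (x : AddCircle (1 : ℝ))) ∧
      ∀ᵐ x : ℝ, v (x : AddCircle (1 : ℝ)) = V x := by
  have hl := locallyIntegrable_coe w
  have hi := fun a b => intervalIntegrable_of_locallyIntegrable hl a b
  have h0 : IsPrimitive (fun x => ∫ t in (0 : ℝ)..x, w (t : AddCircle (1 : ℝ)))
      (fun x => w (x : AddCircle (1 : ℝ))) :=
    ⟨hl, fun a b => intervalIntegral.integral_interval_sub_left (hi _ _) (hi _ _)⟩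
  set V0 : ℝ → ℂ := fun x => ∫ t in (0 : ℝ)..x, w (t : AddCircle (1 : ℝ)) with hV0
  -- Testing with the constant 1 gives mean zero, which is what makes the primitive periodic.
  have hmean : ∫ t in (0 : ℝ)..1, w (t : AddCircle (1 : ℝ)) = 0 := by
    have h1 := h (fun _ => 1) contDiff_const (fun _ => rfl)
    simpa using h1
  have hp0 : Function.Periodic V0 1 := by
    intro x
    have hper : Function.Periodic (fun t : ℝ => w (t : AddCircle (1 : ℝ))) 1 := fun t => by
      simp only
      rw [AddCircle.coe_add_period]
    have h1 := h0.sub_eq x (x + 1)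
    rw [hper.intervalIntegral_add_eq x 0, zero_add, hmean] at h1
    exact sub_eq_zero.1 h1
  have hw0 := isWeakDerivPer_toPer hp0 h0
  set C := fourierBasis.repr (v - toPer h0.continuous hp0) 0 with hC
  -- `v` and the primitive have the same weak derivative, so they can differ only in the zeroth
  -- Fourier mode.
  have hcoef : ∀ n : ℤ, n ≠ 0 → fourierBasis.repr (v - toPer h0.continuous hp0) n = 0 := by
    intro n hn
    have h1 := isWeakDerivPer_iff.1 h n
    rw [isWeakDerivPer_iff.1 hw0 n] at h1
    have h2 : (Complex.I * ((2 * Real.pi * n : ℝ) : ℂ)) ≠ 0 := by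
      refine mul_ne_zero Complex.I_ne_zero (Complex.ofReal_ne_zero.2 ?_)
      have : (n : ℝ) ≠ 0 := Int.cast_ne_zero.2 hn
      positivity
    rw [map_sub]
    exact sub_eq_zero.2 (mul_left_cancel₀ h2 h1).symm
  have hconst : v - toPer h0.continuous hp0 = C • fourierBasis 0 := by
    refine fourierBasis.repr.injective (lp.ext (funext fun n => ?_))
    rw [map_smul, fourierBasis.repr_self]
    by_cases hn : n = 0
    · subst hn
      simp [hC]
    · rw [hcoef n hn]
      simp [hn]
  refine ⟨fun x => V0 x + C, fun x => by simp only [hp0 x], ⟨hl, fun a b => ?_⟩, ?_⟩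
  · rw [← h0.sub_eq]
    ring
  · have hv : v = toPer h0.continuous hp0 + C • (fourierBasis 0 : L2per) := by
      rw [← hconst]
      abel
    rw [coe_fourierBasis] at hv
    filter_upwards [ae_real_of_ae_circle (coeFn_toPer h0.continuous hp0),
      ae_real_of_ae_circle (coeFn_fourierLp 2 0),
      ae_real_of_ae_circle (Lp.coeFn_smul C (fourierLp 2 0 : L2per)),
      ae_real_of_ae_circle (Lp.coeFn_add (toPer h0.continuous hp0) (C • (fourierLp 2 0 : L2per)))]
      with x h1 h2 h3 h4
    rw [hv, h4, Pi.add_apply, h1, h3, Pi.smul_apply, h2, Function.Periodic.lift_coe]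
    simp

theorem periodic_blochFactor_mul {ξ : ℝ} {U : ℝ → ℂ}
    (hU : ∀ x, U (x + 1) = blochFactor ξ 1 * U x) :
    Function.Periodic (fun x => blochFactor ξ (-x) * U x) 1 := fun x => by
  simp only
  rw [hU, ← mul_assoc, ← blochFactor_add]
  congr 2
  ring

/-- The periodic part of a continuous quasi-periodic function. -/
def blochPart (ξ : ℝ) {U : ℝ → ℂ} (hc : Continuous U)
    (hU : ∀ x, U (x + 1) = blochFactor ξ 1 * U x) : L2per :=
  toPer (((continuous_blochFactor ξ).comp continuous_neg).mul hc) (periodic_blochFactor_mul hU)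

/-- This is the conjugation `(∂ + iξ)(e^{-iξx}U) = e^{-iξx}U'`. -/
theorem blochPart_mem_graph {ξ : ℝ} {U U' : ℝ → ℂ} (h : ∀ x, HasDerivAt U (U' x) x)
    (hc : Continuous U) (hc' : Continuous U') (hU : ∀ x, U (x + 1) = blochFactor ξ 1 * U x)
    (hU' : ∀ x, U' (x + 1) = blochFactor ξ 1 * U' x) :
    (blochPart ξ hc hU, blochPart ξ hc' hU') ∈ (blochDeriv ξ).graph := by
  have hcf : Continuous fun x => blochFactor ξ (-x) := (continuous_blochFactor ξ).comp continuous_neg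
  set W : ℝ → ℂ := fun x => blochFactor ξ (-x) * U x with hW
  have hd : ∀ x, HasDerivAt W
      (blochFactor ξ (-x) * U' x - Complex.I * ξ * (blochFactor ξ (-x) * U x)) x := by
    intro x
    have h1 : HasDerivAt (fun x => blochFactor ξ (-x))
        (-(Complex.I * ξ * blochFactor ξ (-x))) x := by
      refine HasDerivAt.congr_deriv (f := fun x => blochFactor ξ (-x))
        ((hasDerivAt_blochFactor ξ (-x)).scomp x (hasDerivAt_neg x)) ?_
      simp
    refine (h1.mul (h x)).congr_deriv ?_
    ring
  have hp := periodic_blochFactor_mul hU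
  have hp' := periodic_blochFactor_mul hU'
  refine mem_graph_blochDeriv.2 ⟨blochPart ξ hc' hU' - (Complex.I * ξ) • blochPart ξ hc hU, ?_,
    by abel⟩
  have h1 : IsPrimitive W fun x : ℝ =>
      (blochPart ξ hc' hU' - (Complex.I * ξ) • blochPart ξ hc hU : L2per)
        (x : AddCircle (1 : ℝ)) := by
    refine (IsPrimitive.of_hasDerivAt hd (by fun_prop)).congr ?_
    filter_upwards [ae_real_of_ae_circle (coeFn_toPer (hcf.mul hc) hp),
      ae_real_of_ae_circle (coeFn_toPer (hcf.mul hc') hp'),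
      ae_real_of_ae_circle (Lp.coeFn_sub (blochPart ξ hc' hU')
        ((Complex.I * ξ) • blochPart ξ hc hU)),
      ae_real_of_ae_circle (Lp.coeFn_smul (Complex.I * ξ) (blochPart ξ hc hU))] with x h1 h2 h3 h4
    rw [h3, Pi.sub_apply, h4, Pi.smul_apply, blochPart, blochPart, h1, h2,
      Function.Periodic.lift_coe, Function.Periodic.lift_coe, smul_eq_mul]
    rfl
  exact isWeakDerivPer_toPer hp h1

/-- Quasi-periodic representatives for the Bloch derivative. -/
theorem exists_isPrimitive_of_mem_graph_blochDeriv {ξ : ℝ} {v w : L2per}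
    (h : (v, w) ∈ (blochDeriv ξ).graph) :
    ∃ U : ℝ → ℂ, (∀ x, U (x + 1) = blochFactor ξ 1 * U x) ∧
      (IsPrimitive U fun x => blochFactor ξ x * w (x : AddCircle (1 : ℝ))) ∧
      (fun x : ℝ => blochFactor ξ x * v (x : AddCircle (1 : ℝ))) =ᵐ[volume] U := by
  obtain ⟨w0, h0, rfl⟩ := mem_graph_blochDeriv.1 h
  obtain ⟨V, hp, hV, hv⟩ := h0.exists_isPrimitive
  refine ⟨fun x => blochFactor ξ x * V x, fun x => ?_,
    ((isPrimitive_blochFactor ξ).mul hV).congr ?_, ?_⟩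
  · change blochFactor ξ (x + 1) * V (x + 1) = blochFactor ξ 1 * (blochFactor ξ x * V x)
    rw [hp, blochFactor_add]
    ring
  · filter_upwards [hv, ae_real_of_ae_circle (Lp.coeFn_add w0 ((Complex.I * ξ) • v)),
      ae_real_of_ae_circle (Lp.coeFn_smul (Complex.I * ξ) v)] with x h1 h2 h3
    rw [h2, Pi.add_apply, h3, Pi.smul_apply, h1, smul_eq_mul]
    ring
  · filter_upwards [hv] with x h1
    rw [h1]

end QuasiPeriodic

/-! ### Floquet multipliers and Bloch eigenvalues -/

section Floquet

variable {γ β k c : ℝ} {z : ℂ} {φ : ℝ → ℝ} {Φ : ℝ → Phase →L[ℂ] Phase}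

theorem hasDerivAt_components {Y : ℝ → Phase}
    (hY : ∀ x, HasDerivAt Y (systemOp γ β k c z φ x (Y x)) x) :
    (∀ x, HasDerivAt (fun x => (Y x).1) (Y x).2.1 x) ∧
    (∀ x, HasDerivAt (fun x => (Y x).2.1)
      (((β : ℂ) * (k : ℂ) ^ 2)⁻¹ * (((c : ℂ) - (φ x : ℂ)) * (Y x).1 - (Y x).2.2.1)) x) ∧
    (∀ x, HasDerivAt (fun x => (Y x).2.2.1) (Y x).2.2.2 x) ∧
    ∀ x, HasDerivAt (fun x => (Y x).2.2.2)
      (((k : ℂ) ^ 2)⁻¹ * (z * k * (Y x).2.1 - (γ : ℂ) * (Y x).1)) x := by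
  simp only [systemOp_apply] at hY
  have h1 : ∀ {E F : Type} [NormedAddCommGroup E] [NormedSpace ℝ E] [NormedAddCommGroup F]
      [NormedSpace ℝ F] {f : ℝ → E × F} {f' : E × F} {x : ℝ}, HasDerivAt f f' x →
      HasDerivAt (fun x => (f x).1) f'.1 x ∧ HasDerivAt (fun x => (f x).2) f'.2 x := by
    intro E F _ _ _ _ f f' x h
    exact ⟨(ContinuousLinearMap.fst ℝ E F).hasFDerivAt.comp_hasDerivAt x h,
      (ContinuousLinearMap.snd ℝ E F).hasFDerivAt.comp_hasDerivAt x h⟩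
  exact ⟨fun x => (h1 (hY x)).1, fun x => (h1 (h1 (hY x)).2).1,
    fun x => (h1 (h1 (h1 (hY x)).2).2).1, fun x => (h1 (h1 (h1 (hY x)).2).2).2⟩

/-- The remaining components are recovered from the first by differentiation, so a nonzero Floquet
vector has a nonzero `v`. -/
theorem eq_zero_of_fst (hβ : β ≠ 0) (hk : 0 < k) {Y : ℝ → Phase}
    (hY : ∀ x, HasDerivAt Y (systemOp γ β k c z φ x (Y x)) x) (h : ∀ x, (Y x).1 = 0) (x : ℝ) :
    Y x = 0 := by
  have hk2 : (k : ℂ) ^ 2 ≠ 0 := pow_ne_zero _ (Complex.ofReal_ne_zero.2 hk.ne')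
  have hβk : (β : ℂ) * (k : ℂ) ^ 2 ≠ 0 := mul_ne_zero (Complex.ofReal_ne_zero.2 hβ) hk2
  obtain ⟨d1, d2, d3, d4⟩ := hasDerivAt_components hY
  have hz : ∀ {f g : ℝ → ℂ}, (∀ x, f x = 0) → (∀ x, HasDerivAt f (g x) x) → ∀ x, g x = 0 := by
    intro f g hf hg x
    obtain rfl : f = 0 := funext hf
    exact (hg x).unique (hasDerivAt_const x (0 : ℂ))
  have z2 := hz h d1
  have z3 : ∀ x, (Y x).2.2.1 = 0 := fun x => by
    have h1 := hz z2 d2 x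
    rw [mul_eq_zero, h, mul_zero, zero_sub, neg_eq_zero] at h1
    exact h1.resolve_left (inv_ne_zero hβk)
  have z4 := hz z3 d3
  exact Prod.ext (h x) (Prod.ext (z2 x) (Prod.ext (z3 x) (z4 x)))

/-- Both sides solve the same system, by periodicity of the coefficients, and agree at 0. -/
theorem IsSystemFlow.apply_add_one (hΦ : IsSystemFlow γ β k c z φ Φ) (hφ : Continuous φ)
    (hper : Function.Periodic φ 1) {μ : ℂ} {e : Phase} (he : Φ 1 e = μ • e) (x : ℝ) :
    Φ (x + 1) e = μ • Φ x e := by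
  obtain ⟨K, -, hK⟩ := exists_bound_systemOp γ β k c z hφ hper
  have hd := hasDerivAt_flow_apply hΦ.hasDerivAt e
  refine congrFun (eq_of_hasDerivAt hK (Y := fun x => Φ (x + 1) e) (Z := fun x => μ • Φ x e)
    (fun t => ?_) (fun t => ?_) ?_) x
  · refine ((hd (t + 1)).comp_add_const t 1).congr_deriv ?_
    have := systemOp_add_int γ β k c z hper t 1
    rw [Int.cast_one, add_comm] at this
    rw [this]
  · refine ((hd t).const_smul μ).congr_deriv ?_
    rw [map_smul]
  · simp only [zero_add, he, hΦ.zero]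
    rfl

theorem coeFn_blochPart {ξ : ℝ} {U : ℝ → ℂ} (hc : Continuous U)
    (hU : ∀ x, U (x + 1) = blochFactor ξ 1 * U x) :
    ∀ᵐ y ∂(AddCircle.haarAddCircle (T := (1 : ℝ))),
      ∀ x : ℝ, y = (x : AddCircle (1 : ℝ)) → blochPart ξ hc hU y = blochFactor ξ (-x) * U x := by
  filter_upwards [coeFn_toPer
    (((continuous_blochFactor ξ).comp continuous_neg).mul hc) (periodic_blochFactor_mul hU)]
    with y hy x hx
  subst hx
  exact hy

theorem eq_zero_of_ae_real {v : L2per} (h : ∀ᵐ x : ℝ, v (x : AddCircle (1 : ℝ)) = 0) : v = 0 := by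
  refine Lp.ext ?_
  have h1 := (ae_map_iff measurePreserving_coe.measurable.aemeasurable
    ((Lp.stronglyMeasurable v).measurable (measurableSet_singleton 0))).2
    (ae_restrict_of_ae (s := Set.Ioc 0 1) h)
  rw [measurePreserving_coe.map_eq] at h1
  filter_upwards [h1, Lp.coeFn_zero ℂ 2 (AddCircle.haarAddCircle (T := (1 : ℝ)))] with y h2 h3
  rw [h3]
  exact h2

/-- Floquet solutions of the first order system yield eigenfunctions of the Bloch pencil. -/
theorem isEigenvalue_bloch_of_floquet (hβ : β ≠ 0) (hk : 0 < k) (hφ : ContDiff ℝ ∞ φ)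
    (hper : Function.Periodic φ 1) (hΦ : IsSystemFlow γ β k c z φ Φ) {ξ : ℝ} {e : Phase}
    (he0 : e ≠ 0) (he : Φ 1 e = blochFactor ξ 1 • e) :
    IsEigenvalue (blochL hper γ β k c ξ) (blochH k ξ) z := by
  rw [isEigenvalue_bloch_iff hφ hper]
  have hk2 : (k : ℂ) ^ 2 ≠ 0 := pow_ne_zero _ (Complex.ofReal_ne_zero.2 hk.ne')
  have hβk : (β : ℂ) * (k : ℂ) ^ 2 ≠ 0 := mul_ne_zero (Complex.ofReal_ne_zero.2 hβ) hk2
  set Y : ℝ → Phase := fun x => Φ x e with hY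
  obtain ⟨d1, d2, d3, d4⟩ := hasDerivAt_components (hasDerivAt_flow_apply hΦ.hasDerivAt e)
  have hq : ∀ x, Y (x + 1) = blochFactor ξ 1 • Y x := hΦ.apply_add_one hφ.continuous hper he
  have hcY : Continuous Y :=
    continuous_iff_continuousAt.2 fun x => (hasDerivAt_flow_apply hΦ.hasDerivAt e x).continuousAt
  have hφc : Continuous fun x => (φ x : ℂ) := Complex.continuous_ofReal.comp hφ.continuous
  have c1 : Continuous fun x => (Y x).1 := by fun_prop
  have c2 : Continuous fun x => (Y x).2.1 := by fun_prop
  have c3 : Continuous fun x => (Y x).2.2.1 := by fun_prop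
  have c4 : Continuous fun x => (Y x).2.2.2 := by fun_prop
  have c5 : Continuous fun x => ((β : ℂ) * (k : ℂ) ^ 2)⁻¹ *
    (((c : ℂ) - (φ x : ℂ)) * (Y x).1 - (Y x).2.2.1) := by fun_prop
  have c6 : Continuous fun x => ((k : ℂ) ^ 2)⁻¹ * (z * k * (Y x).2.1 - (γ : ℂ) * (Y x).1) := by
    fun_prop
  have q1 : ∀ x, (Y (x + 1)).1 = blochFactor ξ 1 * (Y x).1 := fun x => by rw [hq]; rfl
  have q2 : ∀ x, (Y (x + 1)).2.1 = blochFactor ξ 1 * (Y x).2.1 := fun x => by rw [hq]; rfl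
  have q3 : ∀ x, (Y (x + 1)).2.2.1 = blochFactor ξ 1 * (Y x).2.2.1 := fun x => by rw [hq]; rfl
  have q4 : ∀ x, (Y (x + 1)).2.2.2 = blochFactor ξ 1 * (Y x).2.2.2 := fun x => by rw [hq]; rfl
  have q5 : ∀ x, ((β : ℂ) * (k : ℂ) ^ 2)⁻¹ *
      (((c : ℂ) - (φ (x + 1) : ℂ)) * (Y (x + 1)).1 - (Y (x + 1)).2.2.1) =
      blochFactor ξ 1 * (((β : ℂ) * (k : ℂ) ^ 2)⁻¹ *
        (((c : ℂ) - (φ x : ℂ)) * (Y x).1 - (Y x).2.2.1)) := fun x => by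
    rw [q1, q3, hper]
    ring
  have q6 : ∀ x, ((k : ℂ) ^ 2)⁻¹ * (z * k * (Y (x + 1)).2.1 - (γ : ℂ) * (Y (x + 1)).1) =
      blochFactor ξ 1 * (((k : ℂ) ^ 2)⁻¹ * (z * k * (Y x).2.1 - (γ : ℂ) * (Y x).1)) := fun x => by
    rw [q1, q2]
    ring
  refine ⟨blochPart ξ c1 q1, blochPart ξ c3 q3, fun h0 => he0 ?_, blochPart ξ c2 q2,
    blochPart ξ c5 q5, blochPart ξ c4 q4, blochPart ξ c6 q6,
    blochPart_mem_graph d1 c1 c2 q1 q2, blochPart_mem_graph d2 c2 c5 q2 q5, ?_,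
    blochPart_mem_graph d3 c3 c4 q3 q4, blochPart_mem_graph d4 c4 c6 q4 q6, ?_⟩
  · have h1 := eq_zero_of_fst hβ hk (hasDerivAt_flow_apply hΦ.hasDerivAt e) (fun x =>
      (mul_eq_zero.1 (toPer_eq_zero _ _ h0 x)).resolve_left (blochFactor_ne_zero _ _)) 0
    rwa [hΦ.zero] at h1
  · refine Lp.ext ?_
    set v := blochPart ξ c1 q1
    set v2 := blochPart ξ c5 q5
    filter_upwards [coeFn_blochPart c1 q1, coeFn_blochPart c3 q3, coeFn_blochPart c5 q5,
      coeFn_mulPer hφ.continuous hper v,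
      Lp.coeFn_sub ((c : ℂ) • v - mulPer hφ.continuous hper v) (((β : ℂ) * (k : ℂ) ^ 2) • v2),
      Lp.coeFn_sub ((c : ℂ) • v) (mulPer hφ.continuous hper v), Lp.coeFn_smul (c : ℂ) v,
      Lp.coeFn_smul ((β : ℂ) * (k : ℂ) ^ 2) v2] with y h1 h2 h3 h4 h5 h6 h7 h8
    obtain ⟨x, rfl⟩ := QuotientAddGroup.mk_surjective y
    rw [h5, Pi.sub_apply, h6, Pi.sub_apply, h7, Pi.smul_apply, h8, Pi.smul_apply, h4, h1 x rfl,
      h2 x rfl, h3 x rfl, smul_eq_mul, smul_eq_mul,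
      show hper.lift (QuotientAddGroup.mk x) = φ x from rfl]
    linear_combination (blochFactor ξ (-x) * (((c : ℂ) - (φ x : ℂ)) * (Y x).1 - (Y x).2.2.1)) *
      mul_inv_cancel₀ hβk
  · refine Lp.ext ?_
    set v := blochPart ξ c1 q1
    set v1 := blochPart ξ c2 q2
    set w := blochPart ξ c6 q6
    filter_upwards [coeFn_blochPart c1 q1, coeFn_blochPart c2 q2, coeFn_blochPart c6 q6,
      Lp.coeFn_zero ℂ 2 (AddCircle.haarAddCircle (T := (1 : ℝ))),
      Lp.coeFn_sub ((z * k) • v1 - (γ : ℂ) • v) (((k : ℂ) ^ 2) • w),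
      Lp.coeFn_sub ((z * k) • v1) ((γ : ℂ) • v), Lp.coeFn_smul (z * k) v1,
      Lp.coeFn_smul (γ : ℂ) v, Lp.coeFn_smul ((k : ℂ) ^ 2) w] with y h1 h2 h3 h4 h5 h6 h7 h8 h9
    obtain ⟨x, rfl⟩ := QuotientAddGroup.mk_surjective y
    rw [h4, h5, Pi.sub_apply, h6, Pi.sub_apply, h7, Pi.smul_apply, h8, Pi.smul_apply, h9,
      Pi.smul_apply, h1 x rfl, h2 x rfl, h3 x rfl, smul_eq_mul, smul_eq_mul, smul_eq_mul,
      Pi.zero_apply]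
    linear_combination (blochFactor ξ (-x) * (z * k * (Y x).2.1 - (γ : ℂ) * (Y x).1)) *
      mul_inv_cancel₀ hk2

/-- Eigenfunctions of the Bloch pencil yield Floquet solutions of the first order system. -/
theorem exists_floquet_of_isEigenvalue_bloch (hβ : β ≠ 0) (hk : 0 < k) (hφ : ContDiff ℝ ∞ φ)
    (hper : Function.Periodic φ 1) (hΦ : IsSystemFlow γ β k c z φ Φ) {ξ : ℝ}
    (h : IsEigenvalue (blochL hper γ β k c ξ) (blochH k ξ) z) :
    ∃ e, e ≠ 0 ∧ Φ 1 e = blochFactor ξ 1 • e := by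
  obtain ⟨v, q, hv0, v1, v2, q1, q2, hv1, hv2, hq, hq1, hq2, hf⟩ :=
    (isEigenvalue_bloch_iff hφ hper ξ z).1 h
  obtain ⟨K, -, hK⟩ := exists_bound_systemOp γ β k c z hφ.continuous hper
  have hk2 : (k : ℂ) ^ 2 ≠ 0 := pow_ne_zero _ (Complex.ofReal_ne_zero.2 hk.ne')
  have hβk : (β : ℂ) * (k : ℂ) ^ 2 ≠ 0 := mul_ne_zero (Complex.ofReal_ne_zero.2 hβ) hk2
  set m := mulPer hφ.continuous hper with hm
  have e2 : v2 = ((β : ℂ) * (k : ℂ) ^ 2)⁻¹ • ((c : ℂ) • v - m v - q) := by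
    rw [hq, eq_inv_smul_iff₀ hβk]
    abel
  have e4 : q2 = ((k : ℂ) ^ 2)⁻¹ • ((z * k) • v1 - (γ : ℂ) • v) := by
    rw [eq_inv_smul_iff₀ hk2]
    exact (sub_eq_zero.1 hf.symm).symm
  obtain ⟨V, pV, hV, hvV⟩ := exists_isPrimitive_of_mem_graph_blochDeriv hv1
  obtain ⟨V1, pV1, hV1, hvV1⟩ := exists_isPrimitive_of_mem_graph_blochDeriv hv2
  obtain ⟨P, pP, hP, hpP⟩ := exists_isPrimitive_of_mem_graph_blochDeriv hq1
  obtain ⟨P1, pP1, hP1, hpP1⟩ := exists_isPrimitive_of_mem_graph_blochDeriv hq2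
  have e2' : (fun x : ℝ => blochFactor ξ x * v2 (x : AddCircle (1 : ℝ))) =ᵐ[volume] fun x =>
      ((β : ℂ) * (k : ℂ) ^ 2)⁻¹ * (((c : ℂ) - (φ x : ℂ)) * V x - P x) := by
    rw [e2]
    filter_upwards [hvV, hpP, ae_real_of_ae_circle (coeFn_mulPer hφ.continuous hper v),
      ae_real_of_ae_circle
        (Lp.coeFn_smul (((β : ℂ) * (k : ℂ) ^ 2)⁻¹) ((c : ℂ) • v - m v - q)),
      ae_real_of_ae_circle (Lp.coeFn_sub ((c : ℂ) • v - m v) q),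
      ae_real_of_ae_circle (Lp.coeFn_sub ((c : ℂ) • v) (m v)),
      ae_real_of_ae_circle (Lp.coeFn_smul (c : ℂ) v)] with x h1 h2 h3 h4 h5 h6 h7
    rw [h4, Pi.smul_apply, h5, Pi.sub_apply, h6, Pi.sub_apply, h7, Pi.smul_apply, hm, h3, ← h1,
      ← h2, smul_eq_mul, smul_eq_mul, Function.Periodic.lift_coe]
    ring
  have e4' : (fun x : ℝ => blochFactor ξ x * q2 (x : AddCircle (1 : ℝ))) =ᵐ[volume] fun x =>
      ((k : ℂ) ^ 2)⁻¹ * (z * k * V1 x - (γ : ℂ) * V x) := by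
    rw [e4]
    filter_upwards [hvV, hvV1,
      ae_real_of_ae_circle (Lp.coeFn_smul (((k : ℂ) ^ 2)⁻¹) ((z * k) • v1 - (γ : ℂ) • v)),
      ae_real_of_ae_circle (Lp.coeFn_sub ((z * k) • v1) ((γ : ℂ) • v)),
      ae_real_of_ae_circle (Lp.coeFn_smul (z * k) v1),
      ae_real_of_ae_circle (Lp.coeFn_smul (γ : ℂ) v)] with x h1 h2 h3 h4 h5 h6
    rw [h3, Pi.smul_apply, h4, Pi.sub_apply, h5, Pi.smul_apply, h6, Pi.smul_apply, ← h1, ← h2,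
      smul_eq_mul, smul_eq_mul, smul_eq_mul]
    ring
  have hφc : Continuous fun x => (φ x : ℂ) := Complex.continuous_ofReal.comp hφ.continuous
  have cV := hV.continuous
  have cV1 := hV1.continuous
  have cP := hP.continuous
  have d1 := (hV.congr hvV1).hasDerivAt cV1
  have d2 := (hV1.congr e2').hasDerivAt (by fun_prop)
  have d3 := (hP.congr hpP1).hasDerivAt hP1.continuous
  have d4 := (hP1.congr e4').hasDerivAt (by fun_prop)
  set Y : ℝ → Phase := fun x => (V x, V1 x, P x, P1 x) with hY
  have hYd : ∀ x, HasDerivAt Y (systemOp γ β k c z φ x (Y x)) x := fun x => by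
    refine ((d1 x).prodMk ((d2 x).prodMk ((d3 x).prodMk (d4 x)))).congr_deriv ?_
    rw [systemOp_apply]
  have hflow := eq_flow_apply hK hΦ.zero hΦ.hasDerivAt hYd
  refine ⟨Y 0, fun h0 => hv0 (eq_zero_of_ae_real ?_), ?_⟩
  · filter_upwards [hvV] with x hx
    have h1 : Y x = 0 := by rw [hflow, h0, map_zero]
    have h2 : V x = 0 := congrArg Prod.fst h1
    rw [h2] at hx
    exact (mul_eq_zero.1 hx).resolve_left (blochFactor_ne_zero _ _)
  · rw [← hflow]
    have h1 := pV 0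
    have h2 := pV1 0
    have h3 := pP 0
    have h4 := pP1 0
    rw [zero_add] at h1 h2 h3 h4
    exact Prod.ext h1 (Prod.ext h2 (Prod.ext h3 h4))

theorem exists_blochFactor_eq {μ : ℂ} (hμ : ‖μ‖ = 1) :
    ∃ ξ ∈ Set.Ico (-Real.pi) Real.pi, blochFactor ξ 1 = μ := by
  have h1 : Complex.exp (Complex.arg μ * Complex.I) = μ := by
    have := Complex.norm_mul_exp_arg_mul_I μ
    rwa [hμ, Complex.ofReal_one, one_mul] at this
  rcases (Complex.arg_le_pi μ).lt_or_eq with h | h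
  · refine ⟨Complex.arg μ, ⟨(Complex.neg_pi_lt_arg μ).le, h⟩, ?_⟩
    rw [blochFactor, Complex.ofReal_one, mul_one, mul_comm, h1]
  -- `arg` takes values in `(-π, π]`, so the value `π` has to be moved to `-π`.
  · refine ⟨-Real.pi, ⟨le_rfl, by linarith [Real.pi_pos]⟩, ?_⟩
    rw [h, Complex.exp_pi_mul_I] at h1
    rw [blochFactor, ← h1, Complex.ofReal_one, mul_one, Complex.ofReal_neg, mul_neg, Complex.exp_neg,
      mul_comm, Complex.exp_pi_mul_I]
    norm_num

end Floquet

/-! ### Weyl sequences and the spectral decomposition -/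

section Weyl

/-- `b j` is the `j`-th derivative of a bump rescaled to width `N`, so each derivative brings a
factor `1/N`. Orders one to four are needed because the operator has order four. -/
theorem exists_cutoff : ∃ C : ℝ, 0 ≤ C ∧ ∀ N : ℕ, 0 < N → ∃ b : ℕ → ℝ → ℂ,
    (∀ j x, HasDerivAt (b j) (b (j + 1) x) x) ∧ (∀ j (x : ℝ), 2 * (N : ℝ) < |x| → b j x = 0) ∧
      (∀ x : ℝ, |x| ≤ N → b 0 x = 1) ∧ ∀ j < 4, ∀ x, ‖b (j + 1) x‖ ≤ C / N := by
  let χ : ContDiffBump (0 : ℝ) := ⟨1, 2, one_pos, one_lt_two⟩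
  have hs : ContDiff ℝ ∞ fun x => (χ x : ℂ) := Complex.ofRealCLM.contDiff.comp χ.contDiff
  set a : ℕ → ℝ → ℂ := fun j => iteratedDeriv j fun x => (χ x : ℂ) with ha
  have hd : ∀ j x, HasDerivAt (a j) (a (j + 1) x) x := fun j x => by
    simp only [ha, iteratedDeriv_succ]
    exact ((hs.differentiable_iteratedDeriv j
      (WithTop.coe_lt_coe.2 (WithTop.coe_lt_top j))) x).hasDerivAt
  have hz : ∀ j (x : ℝ), 2 < |x| → a j x = 0 := by
    intro j
    induction j with
    | zero =>
      intro x hx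
      have : χ x = 0 := χ.zero_of_le_dist (by rw [Real.dist_0_eq_abs]; exact hx.le)
      simp [ha, this]
    | succ j ih =>
      intro x hx
      have h1 : a j =ᶠ[nhds x] fun _ => 0 := by
        filter_upwards [(isOpen_lt continuous_const continuous_abs).mem_nhds hx] with y hy
        exact ih y hy
      exact ((hd j x).congr_of_eventuallyEq h1.symm).unique (hasDerivAt_const x (0 : ℂ))
  have hb : ∀ j, ∃ C, 0 ≤ C ∧ ∀ x, ‖a j x‖ ≤ C := by
    intro j
    have hc : Continuous (a j) := continuous_iff_continuousAt.2 fun x => (hd j x).continuousAt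
    obtain ⟨C, hC⟩ := (isCompact_Icc (a := (-2 : ℝ)) (b := 2)).exists_bound_of_continuousOn
      hc.continuousOn
    refine ⟨|C|, abs_nonneg C, fun x => ?_⟩
    by_cases hx : 2 < |x|
    · rw [hz j x hx, norm_zero]
      exact abs_nonneg C
    · exact (hC x (abs_le.1 (not_lt.1 hx))).trans (le_abs_self C)
  choose B hB0 hB using hb
  refine ⟨∑ j ∈ Finset.range 4, B (j + 1), Finset.sum_nonneg fun j _ => hB0 _, fun N hN =>
    ⟨fun j x => ((N : ℂ)⁻¹) ^ j * a j ((N : ℝ)⁻¹ * x), fun j x => ?_, fun j x hx => ?_,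
      fun x hx => ?_, fun j hj x => ?_⟩⟩
  · have hN0 : (0 : ℝ) < N := Nat.cast_pos.2 hN
    have h1 := ((hd j ((N : ℝ)⁻¹ * x)).scomp x
      ((hasDerivAt_id x).const_mul (N : ℝ)⁻¹)).const_mul (((N : ℂ)⁻¹) ^ j)
    refine HasDerivAt.congr_deriv (f := fun x => ((N : ℂ)⁻¹) ^ j * a j ((N : ℝ)⁻¹ * x)) h1 ?_
    simp only [mul_one, Complex.real_smul, pow_succ]
    push_cast
    ring
  · have hN0 : (0 : ℝ) < N := Nat.cast_pos.2 hN
    simp only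
    rw [hz j, mul_zero]
    rw [abs_mul, abs_of_pos (inv_pos.2 hN0), inv_mul_eq_div, lt_div_iff₀ hN0]
    exact hx
  · have hN0 : (0 : ℝ) < N := Nat.cast_pos.2 hN
    have : χ ((N : ℝ)⁻¹ * x) = 1 := by
      refine χ.one_of_mem_closedBall ?_
      rw [mem_closedBall_zero_iff, Real.norm_eq_abs, abs_mul, abs_of_pos (inv_pos.2 hN0),
        inv_mul_eq_div]
      exact (div_le_one hN0).2 hx
    simp [ha, this]
  · have hN1 : (1 : ℝ) ≤ N := by exact_mod_cast hN
    have h1 : B (j + 1) ≤ ∑ j ∈ Finset.range 4, B (j + 1) :=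
      Finset.single_le_sum (f := fun j => B (j + 1)) (fun i _ => hB0 _) (Finset.mem_range.2 hj)
    rw [norm_mul, norm_pow, norm_inv, Complex.norm_natCast, div_eq_inv_mul]
    refine mul_le_mul ?_ ((hB _ _).trans h1) (norm_nonneg _) (by positivity)
    exact pow_le_of_le_one (by positivity) (inv_le_one_of_one_le₀ hN1) (by simp)

/-- A continuous function vanishing outside `[-r, r]` as an element of `L²(ℝ)`. -/
def compactLp {F : ℝ → ℂ} {r : ℝ} (hc : Continuous F) (h : ∀ x, r < |x| → F x = 0) : L2R :=
  (hc.memLp_of_hasCompactSupport (HasCompactSupport.intro (isCompact_Icc (a := -r) (b := r))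
    fun x hx => h x (not_le.1 fun h1 => hx (abs_le.1 h1))) : MemLp F 2 volume).toLp F

theorem coeFn_compactLp {F : ℝ → ℂ} {r : ℝ} (hc : Continuous F) (h : ∀ x, r < |x| → F x = 0) :
    compactLp hc h =ᵐ[volume] F := MemLp.coeFn_toLp _

theorem norm_compactLp_sq {F : ℝ → ℂ} {r : ℝ} (hc : Continuous F)
    (h : ∀ x, r < |x| → F x = 0) : ‖compactLp hc h‖ ^ 2 = ∫ x, ‖F x‖ ^ 2 := by
  rw [← integral_norm_sq]
  refine integral_congr_ae ?_
  filter_upwards [coeFn_compactLp hc h] with x hx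
  rw [hx]

theorem norm_compactLp_sq_le {F : ℝ → ℂ} {r B : ℝ} (hr : 0 ≤ r) (hc : Continuous F)
    (h : ∀ x, r < |x| → F x = 0) (hB : ∀ x, ‖F x‖ ≤ B) :
    ‖compactLp hc h‖ ^ 2 ≤ 2 * r * B ^ 2 := by
  rw [norm_compactLp_sq, ← setIntegral_eq_integral_of_forall_compl_eq_zero (s := Set.Icc (-r) r)
    fun x hx => by rw [h x (not_le.1 fun h1 => hx (abs_le.1 h1))]; simp,
    integral_Icc_eq_integral_Ioc, ← intervalIntegral.integral_of_le (by linarith)]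
  have h1 : ∫ x in (-r)..r, ‖F x‖ ^ 2 ≤ ∫ _ in (-r)..r, B ^ 2 :=
    intervalIntegral.integral_mono_on (by linarith)
      ((hc.norm.pow 2).intervalIntegrable _ _) (by simp)
      fun x _ => pow_le_pow_left₀ (norm_nonneg _) (hB x) 2
  rw [intervalIntegral.integral_const, smul_eq_mul] at h1
  linarith

theorem intervalIntegral_le_norm_compactLp_sq {F : ℝ → ℂ} {r a b : ℝ} (hab : a ≤ b)
    (hc : Continuous F) (h : ∀ x, r < |x| → F x = 0) :
    ∫ x in a..b, ‖F x‖ ^ 2 ≤ ‖compactLp hc h‖ ^ 2 := by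
  have hi : Integrable fun x => ‖F x‖ ^ 2 := by
    refine (integrable_norm_sq (compactLp hc h)).congr ?_
    filter_upwards [coeFn_compactLp hc h] with x hx
    rw [hx]
  rw [norm_compactLp_sq, intervalIntegral.integral_of_le hab]
  exact setIntegral_le_integral hi (Filter.Eventually.of_forall fun x => sq_nonneg _)

theorem compactLp_mem_graph {F G : ℝ → ℂ} {r : ℝ} (hF : Continuous F)
    (hF0 : ∀ x, r < |x| → F x = 0) (hG : Continuous G) (hG0 : ∀ x, r < |x| → G x = 0)
    (h : ∀ x, HasDerivAt F (G x) x) :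
    (compactLp hF hF0, compactLp hG hG0) ∈ derivR.graph :=
  (IsPrimitive.of_hasDerivAt h hG).mem_graph_derivR _ _

variable {γ β k c : ℝ} {z : ℂ} {φ : ℝ → ℝ}

theorem isSolution_compactLp (hφ : Continuous φ) (hper : Function.Periodic φ 1) {r : ℝ}
    {V V1 V2 Q Q1 Q2 F : ℝ → ℂ} (hV : Continuous V) (hV1 : Continuous V1) (hV2 : Continuous V2)
    (hQ : Continuous Q) (hQ1 : Continuous Q1) (hQ2 : Continuous Q2) (hF : Continuous F)
    (hV0 : ∀ x, r < |x| → V x = 0) (hV10 : ∀ x, r < |x| → V1 x = 0)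
    (hV20 : ∀ x, r < |x| → V2 x = 0) (hQ0 : ∀ x, r < |x| → Q x = 0)
    (hQ10 : ∀ x, r < |x| → Q1 x = 0) (hQ20 : ∀ x, r < |x| → Q2 x = 0)
    (hF0 : ∀ x, r < |x| → F x = 0) (dV : ∀ x, HasDerivAt V (V1 x) x)
    (dV1 : ∀ x, HasDerivAt V1 (V2 x) x) (dQ : ∀ x, HasDerivAt Q (Q1 x) x)
    (dQ1 : ∀ x, HasDerivAt Q1 (Q2 x) x)
    (e1 : ∀ x, Q x = ((c : ℂ) - (φ x : ℂ)) * V x - (β : ℂ) * (k : ℂ) ^ 2 * V2 x)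
    (e2 : ∀ x, F x = z * k * V1 x - (γ : ℂ) * V x - (k : ℂ) ^ 2 * Q2 x) :
    IsSolution derivR (mulR hφ hper) γ β k c z (compactLp hV hV0) (compactLp hQ hQ0)
      (compactLp hF hF0) := by
  refine ⟨compactLp hV1 hV10, compactLp hV2 hV20, compactLp hQ1 hQ10, compactLp hQ2 hQ20,
    compactLp_mem_graph _ _ _ _ dV, compactLp_mem_graph _ _ _ _ dV1, ?_,
    compactLp_mem_graph _ _ _ _ dQ, compactLp_mem_graph _ _ _ _ dQ1, ?_⟩
  · set v := compactLp hV hV0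
    set v2 := compactLp hV2 hV20
    refine Lp.ext ?_
    filter_upwards [coeFn_compactLp hV hV0, coeFn_compactLp hV2 hV20, coeFn_compactLp hQ hQ0,
      coeFn_mulR hφ hper v,
      Lp.coeFn_sub ((c : ℂ) • v - mulR hφ hper v) (((β : ℂ) * (k : ℂ) ^ 2) • v2),
      Lp.coeFn_sub ((c : ℂ) • v) (mulR hφ hper v), Lp.coeFn_smul (c : ℂ) v,
      Lp.coeFn_smul ((β : ℂ) * (k : ℂ) ^ 2) v2] with x h1 h2 h3 h4 h5 h6 h7 h8
    rw [h5, Pi.sub_apply, h6, Pi.sub_apply, h7, Pi.smul_apply, h8, Pi.smul_apply, h4, h1, h2, h3,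
      e1, smul_eq_mul, smul_eq_mul]
    ring
  · set v := compactLp hV hV0
    set v1 := compactLp hV1 hV10
    set q2 := compactLp hQ2 hQ20
    refine Lp.ext ?_
    filter_upwards [coeFn_compactLp hV hV0, coeFn_compactLp hV1 hV10, coeFn_compactLp hQ2 hQ20,
      coeFn_compactLp hF hF0,
      Lp.coeFn_sub ((z * k) • v1 - (γ : ℂ) • v) (((k : ℂ) ^ 2) • q2),
      Lp.coeFn_sub ((z * k) • v1) ((γ : ℂ) • v), Lp.coeFn_smul (z * k) v1,
      Lp.coeFn_smul (γ : ℂ) v, Lp.coeFn_smul ((k : ℂ) ^ 2) q2] with x h1 h2 h3 h4 h5 h6 h7 h8 h9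
    rw [h4, h5, Pi.sub_apply, h6, Pi.sub_apply, h7, Pi.smul_apply, h8, Pi.smul_apply, h9,
      Pi.smul_apply, h1, h2, h3, e2, smul_eq_mul, smul_eq_mul, smul_eq_mul]

theorem exists_bound_of_quasiperiodic {U : ℝ → ℂ} {μ : ℂ} (hμ : ‖μ‖ = 1) (hc : Continuous U)
    (hU : ∀ x, U (x + 1) = μ * U x) : ∃ B, 0 ≤ B ∧ ∀ x, ‖U x‖ ≤ B := by
  have hp : Function.Periodic (fun x => ‖U x‖) 1 := fun x => by
    simp only
    rw [hU, norm_mul, hμ, one_mul]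
  obtain ⟨B, hB⟩ := hp.compact_of_continuous (c := 1) one_ne_zero hc.norm |>.bddAbove
  have h := fun x => hB (Set.mem_range_self x)
  exact ⟨B, (norm_nonneg _).trans (h 0), h⟩

/-- A Floquet multiplier of modulus one obstructs bounded invertibility on the line. -/
theorem not_boundedlyInvertible_of_floquet (hβ : β ≠ 0) (hk : 0 < k) (hφ : ContDiff ℝ ∞ φ)
    (hper : Function.Periodic φ 1) {Φ : ℝ → Phase →L[ℂ] Phase}
    (hΦ : IsSystemFlow γ β k c z φ Φ) {μ : ℂ} (hμ : ‖μ‖ = 1) {e : Phase} (he0 : e ≠ 0)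
    (he : Φ 1 e = μ • e) : ¬ BoundedlyInvertible (z • opH k - opL φ γ β k c) := by
  rintro ⟨R, -, hR⟩
  have hk2 : (k : ℂ) ^ 2 ≠ 0 := pow_ne_zero _ (Complex.ofReal_ne_zero.2 hk.ne')
  have hβk : (β : ℂ) * (k : ℂ) ^ 2 ≠ 0 := mul_ne_zero (Complex.ofReal_ne_zero.2 hβ) hk2
  set Y : ℝ → Phase := fun x => Φ x e with hY
  have hYd : ∀ x, HasDerivAt Y (systemOp γ β k c z φ x (Y x)) x :=
    hasDerivAt_flow_apply hΦ.hasDerivAt e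
  obtain ⟨d1, d2, d3, d4⟩ := hasDerivAt_components hYd
  have hq : ∀ x, Y (x + 1) = μ • Y x := hΦ.apply_add_one hφ.continuous hper he
  have hcY : Continuous Y := continuous_iff_continuousAt.2 fun x => (hYd x).continuousAt
  have hφc : Continuous fun x => (φ x : ℂ) := Complex.continuous_ofReal.comp hφ.continuous
  have hφc' : Continuous fun x => ((deriv φ x : ℝ) : ℂ) :=
    Complex.continuous_ofReal.comp (hφ.continuous_deriv (by simp))
  have hφd : ∀ x, HasDerivAt (fun x => (φ x : ℂ)) ((deriv φ x : ℝ) : ℂ) x := fun x =>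
    ((hφ.differentiable (by simp)) x).hasDerivAt.ofReal_comp
  have hper' := periodic_deriv hper
  set u : ℝ → ℂ := fun x => (Y x).1 with hu
  set u1 : ℝ → ℂ := fun x => (Y x).2.1 with hu1
  set p : ℝ → ℂ := fun x => (Y x).2.2.1 with hp
  set p1 : ℝ → ℂ := fun x => (Y x).2.2.2 with hp1
  set u2 : ℝ → ℂ := fun x =>
    ((β : ℂ) * (k : ℂ) ^ 2)⁻¹ * (((c : ℂ) - (φ x : ℂ)) * u x - p x) with hu2
  set u3 : ℝ → ℂ := fun x => ((β : ℂ) * (k : ℂ) ^ 2)⁻¹ *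
    (((c : ℂ) - (φ x : ℂ)) * u1 x - ((deriv φ x : ℝ) : ℂ) * u x - p1 x) with hu3
  set p2 : ℝ → ℂ := fun x => ((k : ℂ) ^ 2)⁻¹ * (z * k * u1 x - (γ : ℂ) * u x) with hp2
  have d2' : ∀ x, HasDerivAt u2 (u3 x) x := fun x => by
    refine ((((((hφd x).const_sub (c : ℂ)).mul (d1 x)).sub (d3 x)).const_mul
      (((β : ℂ) * (k : ℂ) ^ 2)⁻¹))).congr_deriv ?_
    simp only [hu3]
    ring
  have cu : Continuous u := by fun_prop
  have cu1 : Continuous u1 := by fun_prop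
  have cp : Continuous p := by fun_prop
  have cp1 : Continuous p1 := by fun_prop
  have cu2 : Continuous u2 := by fun_prop
  have cu3 : Continuous u3 := by fun_prop
  have cp2 : Continuous p2 := by fun_prop
  have qu : ∀ x, u (x + 1) = μ * u x := fun x => by simp only [hu]; rw [hq]; rfl
  have qu1 : ∀ x, u1 (x + 1) = μ * u1 x := fun x => by simp only [hu1]; rw [hq]; rfl
  have qp : ∀ x, p (x + 1) = μ * p x := fun x => by simp only [hp]; rw [hq]; rfl
  have qp1 : ∀ x, p1 (x + 1) = μ * p1 x := fun x => by simp only [hp1]; rw [hq]; rfl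
  have qu2 : ∀ x, u2 (x + 1) = μ * u2 x := fun x => by
    simp only [hu2]; rw [qu, qp, hper]; ring
  have qu3 : ∀ x, u3 (x + 1) = μ * u3 x := fun x => by
    simp only [hu3]; rw [qu, qu1, qp1, hper, hper']; ring
  -- These four functions are the coefficients of `b 1`, …, `b 4` when the pencil is applied to `b 0
  -- · u`. The coefficient of `b 0` itself vanishes because `u` solves the equation. Multipliers of
  -- modulus one keep all of them bounded.
  obtain ⟨B1, hB10, hB1⟩ := exists_bound_of_quasiperiodic
    (U := fun x => z * k * u x - 2 * (k : ℂ) ^ 2 * p1 x + 2 * (β : ℂ) * (k : ℂ) ^ 4 * u3 x) hμ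
    (by fun_prop) fun x => by simp only [qu, qp1, qu3]; ring
  obtain ⟨B2, hB20, hB2⟩ := exists_bound_of_quasiperiodic
    (U := fun x => -(k : ℂ) ^ 2 * p x + 5 * (β : ℂ) * (k : ℂ) ^ 4 * u2 x) hμ
    (by fun_prop) fun x => by simp only [qp, qu2]; ring
  obtain ⟨B3, hB30, hB3⟩ := exists_bound_of_quasiperiodic
    (U := fun x => 4 * (β : ℂ) * (k : ℂ) ^ 4 * u1 x) hμ
    (by fun_prop) fun x => by simp only [qu1]; ring
  obtain ⟨B4, hB40, hB4⟩ := exists_bound_of_quasiperiodic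
    (U := fun x => (β : ℂ) * (k : ℂ) ^ 4 * u x) hμ
    (by fun_prop) fun x => by simp only [qu]; ring
  obtain ⟨C, hC0, hC⟩ := exists_cutoff
  obtain ⟨x0, hx0⟩ : ∃ x0, u x0 ≠ 0 := by
    by_contra! h0
    have h1 := eq_zero_of_fst hβ hk hYd h0 0
    simp only [hY, hΦ.zero] at h1
    exact he0 h1
  set δ := ∫ x in (x0 - 1)..(x0 + 1), ‖u x‖ ^ 2 with hδ
  have hδ0 : 0 < δ := intervalIntegral.integral_pos (by linarith) (cu.norm.pow 2).continuousOn
    (fun x _ => sq_nonneg _) ⟨x0, ⟨by linarith, by linarith⟩, by positivity⟩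
  set S := C * (B1 + B2 + B3 + B4) with hS
  -- The cut-off solution keeps mass at least `δ` near `x0`, while its image is at most `S/N` on an
  -- interval of length `4N`, hence has squared norm at most `4S²/N`. A bounded inverse would bound
  -- `N`.
  have key : ∀ N : ℕ, |x0| + 1 ≤ N → δ * N ≤ 4 * (‖R‖ * S) ^ 2 := by
    intro N hN
    have hN0 : (0 : ℝ) < N := lt_of_lt_of_le (by positivity) hN
    obtain ⟨b, db, zb, ob, bb⟩ := hC N (Nat.cast_pos.1 hN0)
    have cb : ∀ j, Continuous (b j) := fun j =>
      continuous_iff_continuousAt.2 fun x => (db j x).continuousAt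
    set κ : ℂ := (β : ℂ) * (k : ℂ) ^ 2 with hκ
    set V : ℝ → ℂ := fun x => b 0 x * u x with hV
    set V1 : ℝ → ℂ := fun x => b 1 x * u x + b 0 x * u1 x with hV1
    set V2 : ℝ → ℂ := fun x => b 2 x * u x + 2 * (b 1 x * u1 x) + b 0 x * u2 x with hV2
    -- This is `(c - φ)V - κV2`, simplified by `κ u2 = (c - φ)u - p`.
    set Q : ℝ → ℂ := fun x => b 0 x * p x - κ * (b 2 x * u x + 2 * (b 1 x * u1 x)) with hQ
    set Q1 : ℝ → ℂ := fun x => b 1 x * p x + b 0 x * p1 x -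
      κ * (b 3 x * u x + 3 * (b 2 x * u1 x) + 2 * (b 1 x * u2 x)) with hQ1
    set Q2 : ℝ → ℂ := fun x => b 2 x * p x + 2 * (b 1 x * p1 x) + b 0 x * p2 x -
      κ * (b 4 x * u x + 4 * (b 3 x * u1 x) + 5 * (b 2 x * u2 x) + 2 * (b 1 x * u3 x)) with hQ2
    set F : ℝ → ℂ := fun x =>
      b 1 x * (z * k * u x - 2 * (k : ℂ) ^ 2 * p1 x + 2 * (β : ℂ) * (k : ℂ) ^ 4 * u3 x) +
      b 2 x * (-(k : ℂ) ^ 2 * p x + 5 * (β : ℂ) * (k : ℂ) ^ 4 * u2 x) +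
      b 3 x * (4 * (β : ℂ) * (k : ℂ) ^ 4 * u1 x) + b 4 x * ((β : ℂ) * (k : ℂ) ^ 4 * u x) with hF
    have hFB : ∀ x, ‖F x‖ ≤ S / N := by
      intro x
      have hm : ∀ j < 4, ∀ {w : ℂ} {B : ℝ}, ‖w‖ ≤ B → ‖b (j + 1) x * w‖ ≤ C / N * B := by
        intro j hj w B hw
        rw [norm_mul]
        exact mul_le_mul (bb j hj x) hw (norm_nonneg _) (by positivity)
      refine (norm_add₄_le).trans ?_
      have h1 := hm 0 (by norm_num) (hB1 x)
      have h2 := hm 1 (by norm_num) (hB2 x)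
      have h3 := hm 2 (by norm_num) (hB3 x)
      have h4 := hm 3 (by norm_num) (hB4 x)
      have h5 : S / N = C / N * B1 + C / N * B2 + C / N * B3 + C / N * B4 := by
        rw [hS]
        ring
      rw [h5]
      exact add_le_add (add_le_add (add_le_add h1 h2) h3) h4
    have z0 : ∀ x, 2 * (N : ℝ) < |x| → V x = 0 := fun x hx => by simp [hV, zb _ x hx]
    have zF : ∀ x, 2 * (N : ℝ) < |x| → F x = 0 := fun x hx => by simp [hF, zb _ x hx]
    have cV : Continuous V := by fun_prop
    have cF : Continuous F := by fun_prop
    have hsol := isSolution_compactLp (γ := γ) (β := β) (k := k) (c := c) (z := z) (r := 2 * N)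
      (V := V) (V1 := V1) (V2 := V2) (Q := Q) (Q1 := Q1) (Q2 := Q2) (F := F) hφ.continuous hper
      cV (by fun_prop) (by fun_prop) (by fun_prop) (by fun_prop) (by fun_prop) cF z0
      (fun x hx => by simp [hV1, zb _ x hx]) (fun x hx => by simp [hV2, zb _ x hx])
      (fun x hx => by simp [hQ, zb _ x hx]) (fun x hx => by simp [hQ1, zb _ x hx])
      (fun x hx => by simp [hQ2, zb _ x hx]) zF
      (fun x => ((db 0 x).mul (d1 x)))
      (fun x => (((db 1 x).mul (d1 x)).add ((db 0 x).mul (d2 x))).congr_deriv (by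
        simp only [hV2]; ring))
      (fun x => (((db 0 x).mul (d3 x)).sub ((((db 2 x).mul (d1 x)).add
        (((db 1 x).mul (d2 x)).const_mul 2)).const_mul κ)).congr_deriv (by
          simp only [hQ1]; ring))
      (fun x => ((((db 1 x).mul (d3 x)).add ((db 0 x).mul (d4 x))).sub
        (((((db 3 x).mul (d1 x)).add (((db 2 x).mul (d2 x)).const_mul 3)).add
          (((db 1 x).mul (d2' x)).const_mul 2)).const_mul κ)).congr_deriv (by
          simp only [hQ2]; ring))
      (fun x => by
        simp only [hQ, hV, hV2, hu2]
        linear_combination b 0 x * (((c : ℂ) - (φ x : ℂ)) * u x - p x) * mul_inv_cancel₀ hβk)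
      (fun x => by
        simp only [hF, hV, hV1, hQ2, hp2, hκ]
        linear_combination b 0 x * (z * k * u1 x - (γ : ℂ) * u x) * mul_inv_cancel₀ hk2)
    have hg := (mem_graph_linePencil hφ hper z _ _).2 ⟨_, hsol⟩
    obtain ⟨y, hy1, hy2⟩ := (LinearPMap.mem_graph_iff _).1 hg
    have h1 : ‖compactLp cV z0‖ ≤ ‖R‖ * ‖compactLp cF zF‖ := by
      have h0 : R (compactLp cF zF) = compactLp cV z0 := by
        have h1 := hR y
        rw [hy1, hy2] at h1
        exact h1
      rw [← h0]
      exact R.le_opNorm _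
    have h2 := norm_compactLp_sq_le (by positivity) cF zF hFB
    have h3 := intervalIntegral_le_norm_compactLp_sq (a := x0 - 1) (b := x0 + 1) (by linarith) cV z0
    have h4 : ∫ x in (x0 - 1)..(x0 + 1), ‖V x‖ ^ 2 = δ := by
      refine intervalIntegral.integral_congr fun x hx => ?_
      rw [Set.uIcc_of_le (by linarith)] at hx
      have : |x| ≤ N := by
        have := abs_le.1 (le_refl |x0|)
        exact abs_le.2 ⟨by linarith [hx.1], by linarith [hx.2]⟩
      simp only [hV, ob x this, one_mul]
    rw [h4] at h3
    have h5 := pow_le_pow_left₀ (norm_nonneg _) h1 2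
    rw [mul_pow] at h5
    have h6 := mul_le_mul_of_nonneg_left h2 (sq_nonneg ‖R‖)
    have h7 : δ ≤ ‖R‖ ^ 2 * (2 * (2 * N) * (S / N) ^ 2) := h3.trans (h5.trans h6)
    have h8 := mul_le_mul_of_nonneg_right h7 hN0.le
    refine h8.trans_eq ?_
    field_simp
    ring
  obtain ⟨N, hN⟩ := exists_nat_gt (max (|x0| + 1) (4 * (‖R‖ * S) ^ 2 / δ))
  have h1 := key N ((le_max_left _ _).trans hN.le)
  have h2 := (le_max_right _ _).trans_lt hN
  rw [div_lt_iff₀ hδ0] at h2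
  linarith

/-- Both conditions say that the monodromy has an eigenvalue of modulus one: hyperbolicity gives
invertibility, a Weyl sequence refutes it, and such a multiplier is `e^{iξ}` for some `ξ ∈ [-π, π)`.
-/
theorem mem_spectrum_line_iff (hγ : 0 < γ) (hβ : β ≠ 0) (hk : 0 < k) (hφ : ContDiff ℝ ∞ φ)
    (hper : Function.Periodic φ 1) (z : ℂ) :
    z ∈ spectrum (opL φ γ β k c) (opH k) ↔ ∃ ξ ∈ Set.Ico (-Real.pi) Real.pi,
      IsEigenvalue (blochL hper γ β k c ξ) (blochH k ξ) z := by
  obtain ⟨Φ, hΦ⟩ := exists_isSystemFlow hφ hper γ β k c z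
  constructor
  · intro hz
    by_contra! h
    refine hz (boundedlyInvertible_of_hyperbolic hγ hβ hk hφ hper hΦ fun μ e hμ he => ?_)
    by_contra he0
    obtain ⟨ξ, hξ, rfl⟩ := exists_blochFactor_eq hμ
    exact h ξ hξ (isEigenvalue_bloch_of_floquet hβ hk hφ hper hΦ he0 he)
  · rintro ⟨ξ, -, h⟩
    obtain ⟨e, he0, he⟩ := exists_floquet_of_isEigenvalue_bloch hβ hk hφ hper hΦ h
    exact not_boundedlyInvertible_of_floquet hβ hk hφ hper hΦ (norm_blochFactor ξ 1) he0 he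

theorem mem_spectrum_bloch_iff (hβ : β ≠ 0) (hk : 0 < k) (hφ : ContDiff ℝ ∞ φ)
    (hper : Function.Periodic φ 1) (ξ : ℝ) (z : ℂ) :
    z ∈ spectrum (blochL hper γ β k c ξ) (blochH k ξ) ↔
      IsEigenvalue (blochL hper γ β k c ξ) (blochH k ξ) z :=
  ⟨isEigenvalue_of_mem_spectrum_bloch hβ hk hφ hper, fun h => h.mem_spectrum⟩

end Weyl

end Ostrovsky

end

theorem propositionP (γ β k c : ℝ) (hγ : 0 < γ) (hβ : β ≠ 0) (hk : 0 < k)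
    (φ : ℝ → ℝ) (hφ : ContDiff ℝ (⊤ : ℕ∞) φ) (hper : Function.Periodic φ 1) :
    -- (1) the spectrum on the line is purely essential, and there are no eigenvalues at all
    (Ostrovsky.pointSpectrum (Ostrovsky.opL φ γ β k c) (Ostrovsky.opH k) = ∅ ∧
      Ostrovsky.essentialSpectrum (Ostrovsky.opL φ γ β k c) (Ostrovsky.opH k) =
        Ostrovsky.spectrum (Ostrovsky.opL φ γ β k c) (Ostrovsky.opH k) ∧
      ∀ z : ℂ, ¬ Ostrovsky.IsEigenvalue (Ostrovsky.opL φ γ β k c) (Ostrovsky.opH k) z) ∧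
    -- (2) membership in the spectrum on the line through Bloch spectra and Bloch eigenvalues
    (∀ z : ℂ,
      (z ∈ Ostrovsky.spectrum (Ostrovsky.opL φ γ β k c) (Ostrovsky.opH k) ↔
        ∃ ξ ∈ Set.Ico (-Real.pi) Real.pi,
          z ∈ Ostrovsky.spectrum (Ostrovsky.blochL hper γ β k c ξ) (Ostrovsky.blochH k ξ)) ∧
      (z ∈ Ostrovsky.spectrum (Ostrovsky.opL φ γ β k c) (Ostrovsky.opH k) ↔
        ∃ ξ ∈ Set.Ico (-Real.pi) Real.pi,
          Ostrovsky.IsEigenvalue (Ostrovsky.blochL hper γ β k c ξ) (Ostrovsky.blochH k ξ) z)) ∧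
    -- (3) Bloch spectra consist of isolated eigenvalues of finite algebraic multiplicity
    (∀ ξ ∈ Set.Ico (-Real.pi) Real.pi,
      Ostrovsky.spectrum (Ostrovsky.blochL hper γ β k c ξ) (Ostrovsky.blochH k ξ) =
        Ostrovsky.pointSpectrum (Ostrovsky.blochL hper γ β k c ξ) (Ostrovsky.blochH k ξ) ∧
      (∀ z ∈ Ostrovsky.spectrum (Ostrovsky.blochL hper γ β k c ξ) (Ostrovsky.blochH k ξ),
        Ostrovsky.IsEigenvalue (Ostrovsky.blochL hper γ β k c ξ) (Ostrovsky.blochH k ξ) z ∧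
        Ostrovsky.algebraicMultiplicity (Ostrovsky.blochL hper γ β k c ξ)
          (Ostrovsky.blochH k ξ) z < ⊤) ∧
      ∀ z : ℂ, ¬ AccPt z (Filter.principal
        (Ostrovsky.spectrum (Ostrovsky.blochL hper γ β k c ξ) (Ostrovsky.blochH k ξ)))) ∧
    -- (4) the spectral decomposition
    Ostrovsky.spectrum (Ostrovsky.opL φ γ β k c) (Ostrovsky.opH k) =
      ⋃ ξ ∈ Set.Ico (-Real.pi) Real.pi,
        Ostrovsky.spectrum (Ostrovsky.blochL hper γ β k c ξ) (Ostrovsky.blochH k ξ) := by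
  
  have h1 := Ostrovsky.mem_spectrum_line_iff (c := c) hγ hβ hk hφ hper
  have h2 := Ostrovsky.mem_spectrum_bloch_iff (γ := γ) (c := c) hβ hk hφ hper
  refine ⟨⟨?_, Ostrovsky.essentialSpectrum_line hβ hk hφ hper,
    Ostrovsky.not_isEigenvalue_line hβ hk hφ hper⟩, fun z => ⟨?_, h1 z⟩,
    fun ξ _ => Ostrovsky.bloch_spectrum_discrete (c := c) hγ hβ hk hφ hper ξ, ?_⟩
  · rw [Ostrovsky.pointSpectrum, Ostrovsky.essentialSpectrum_line hβ hk hφ hper, Set.sdiff_self]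
  · simp only [h1, h2]
  · ext z
    simp only [Set.mem_iUnion, h1, h2, exists_prop]
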